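/- Throughout, smooth means $C^\infty$. A hybrid system $\mathcal H=(M,S,X,\Delta)$ consists of a smooth manifold $M$ (Hausdorff, second countable, without boundary) of dimension $d\ge 1$, a smooth embedded submanifold $S\subset M$ of codimension $1$ (with inclusion $\iota_S:S\to M$), a smooth vector field $X$ on $M$ and a smooth map $\Delta:S\to M$, such that $S\cap\Delta(S)=\emptyset$ and $\overline S\cap\overline{\Delta(S)}$ has codimension at least $2$ (in every chart it is empty or of Hausdorff dimension at most $d-2$). The hybrid flow $\varphi^{\mathcal H}_t(x)$, $t\ge 0$, is the following partially defined map: the trajectory of $x$ follows the integral curve of $X$ until it meets $S$; if it meets $S$ at time $t_1$ at the point $y$, then its value at time $t_1$ is $y$ and $\varphi^{\mathcal H}_{t_1+t}(x)=\varphi^{\mathcal H}_{t}(\Delta(y))$ for $t>0$. Trajectories are continued through finitely many impacts and as long as the integral curves exist; $X$ need not be complete. The system $\mathcal H$ is called smooth if (A.1) whenever $\varphi^{\mathcal H}_t(x)\in\overline S\setminus S$, there is $\varepsilon>0$ such that, for all $0<\delta<\varepsilon$, $\varphi^{\mathcal H}_{t+\delta}(x)$ is defined and not in $S$; and (A.2)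 $T_yM=T_yS\oplus\mathbb R\,X(y)$ for all $y\in S$. A differential form $\alpha$ on $M$ is hybrid-invariant if $(\varphi^{\mathcal H}_t)^*\alpha=\alpha$ for all $t\ge 0$, meaning that this identity holds at every point $x\in M\setminus S$ with $\varphi^{\mathcal H}_t(x)\notin S$ that has an open neighbourhood $U\subset M\setminus S$ on which $\varphi^{\mathcal H}_t$ is defined and smooth. **Theorem.** Let $\mathcal H=(M,S,X,\Delta)$ be a smooth hybrid system and let $\mu$ be a volume form on $M$ (a smooth nowhere vanishing form of degree $d=\dim M$). Then $\mu$ is hybrid-invariant if and only if $$\mathrm{div}_\mu(X)=0\qquad\text{and}\qquad \Delta^*\iota_{\tilde S}^*\,i_X\mu=\iota_S^*\,i_X\mu .$$ Here $\mathrm{div}_\mu(X)$ is the function with $\mathcal L_X\mu=\mathrm{div}_\mu(X)\,\mu$, $i_X$ is the interior product, and $\Delta^*\iota_{\tilde S}^*$, with $\tilde S=\Delta(S)$, denotes the pullback to $S$ along $S\xrightarrow{\Delta}\tilde S\hookrightarrow M$, that is, along $\Delta$ regarded as a map into $M$. Moreover, the specular condition $\Delta^*\iota_{\tilde S}^*\mu=\iota_S^*\mu$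 holds automatically. -/

import Mathlib

open Set Manifold
open scoped ContDiff Topology

noncomputable section

namespace Hybrid

section Forms

variable {E : Type*} [NormedAddCommGroup E] [NormedSpace ℝ E]
  {H : Type*} [TopologicalSpace H] (I : ModelWithCorners ℝ E H)
  (M : Type*) [TopologicalSpace M] [ChartedSpace H M]
  {E' : Type*} [NormedAddCommGroup E'] [NormedSpace ℝ E']
  {H' : Type*} [TopologicalSpace H'] (J : ModelWithCorners ℝ E' H')
  {N : Type*} [TopologicalSpace N] [ChartedSpace H' N]

/-- A (not necessarily continuous) differential `k`-form on `M`: an alternating `k`-linear form on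
each tangent space. -/
abbrev Form (k : ℕ) : Type _ := (x : M) → (TangentSpace I x) [⋀^Fin k]→L[ℝ] ℝ

variable {M} {k : ℕ}

/-- The pullback `f^* α` of a form `α` on `M` along a map `f : N → M`:
`(f^* α)_x (v₁, …, v_k) = α_{f x} (df_x v₁, …, df_x v_k)`. -/
def pullback (f : N → M) (α : Form I M k) : Form J N k :=
  fun x => (α (f x)).compContinuousLinearMap (mfderiv J I f x)

/-- The form `α` read in the preferred chart around `x₀`: its pullback along the inverse of the
chart, a form on the model vector space (meaningful on the target of the chart). -/
def formInChart (α : Form I M k) (x₀ : M) : E → E [⋀^Fin k]→L[ℝ] ℝ :=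
  pullback I 𝓘(ℝ, E) (extChartAt I x₀).symm α

/-- The vector field `X` read in the preferred chart around `x₀`. -/
def fieldInChart (X : (x : M) → TangentSpace I x) (x₀ : M) : E → E :=
  VectorField.mpullback 𝓘(ℝ, E) I (extChartAt I x₀).symm X

/-- A form is smooth if its coefficients are smooth in every chart. -/
def IsSmoothForm (α : Form I M k) : Prop :=
  ∀ x₀ : M, ContDiffOn ℝ ∞ (formInChart I α x₀) (extChartAt I x₀).target

/-- The interior product `i_X α = α(X, ·, …, ·)`. -/
def interiorProduct (X : (x : M) → TangentSpace I x) (α : Form I M (k + 1)) : Form I M k :=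
  fun x => ContinuousAlternatingMap.curryLeft (E := E) (α x) (X x)

/-- The Lie derivative of a form on a vector space along a vector field,
`(L_X α)_u (v) = D α_u [X u] (v) + ∑ i, α_u (v₁, …, D X_u [v_i], …, v_k)`. -/
def lieDerivCoord (X : E → E) (α : E → E [⋀^Fin k]→L[ℝ] ℝ) (u : E) : E [⋀^Fin k]→L[ℝ] ℝ :=
  fderiv ℝ α u (X u) +
    (α u).fderivCompContinuousLinearMap (ContinuousLinearMap.id ℝ E) (fderiv ℝ X u)

/-- The Lie derivative `L_X α` of a form on a manifold without boundary, computed at each point in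
the preferred chart around that point. -/
def lieDeriv (X : (x : M) → TangentSpace I x) (α : Form I M k) : Form I M k :=
  fun x => ContinuousAlternatingMap.compContinuousLinearMap
    (lieDerivCoord (fieldInChart I X x) (formInChart I α x) (extChartAt I x x) : E [⋀^Fin k]→L[ℝ] ℝ)
    (mfderiv I 𝓘(ℝ, E) (extChartAt I x) x)

theorem lieDerivCoord_apply (X : E → E) (α : E → E [⋀^Fin k]→L[ℝ] ℝ) (u : E) (v : Fin k → E) :
    lieDerivCoord X α u v =
      fderiv ℝ α u (X u) v + ∑ i, α u (Function.update v i (fderiv ℝ X u (v i))) := by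
  simp only [lieDerivCoord, ContinuousAlternatingMap.add_apply,
    ContinuousAlternatingMap.fderivCompContinuousLinearMap_apply]
  congr 1
  refine Finset.sum_congr rfl fun i _ => ?_
  congr 1
  funext j
  rcases eq_or_ne j i with rfl | h
  · simp
  · simp [h]

theorem interiorProduct_apply (X : (x : M) → TangentSpace I x) (α : Form I M (k + 1)) (x : M)
    (v : Fin k → TangentSpace I x) :
    interiorProduct I X α x v = α x (Matrix.vecCons (X x) v) := rfl

end Forms

section Volume

variable {d : ℕ} {M : Type*} [TopologicalSpace M] [ChartedSpace (EuclideanSpace ℝ (Fin d)) M]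

/-- A volume form on a `d`-dimensional manifold: a smooth nowhere vanishing `d`-form. -/
def IsVolumeForm (μ : Form (𝓡 d) M d) : Prop :=
  IsSmoothForm (𝓡 d) μ ∧ ∀ x, μ x ≠ 0

/-- The standard basis of the tangent space at `x`. -/
def tangentBasis (x : M) : Module.Basis (Fin d) ℝ (TangentSpace (𝓡 d) x) :=
  (EuclideanSpace.basisFun (Fin d) ℝ).toBasis

/-- The divergence `div_μ X` of a vector field with respect to a volume form `μ`: the function with
`L_X μ = (div_μ X) • μ` (see `lieDeriv_eq_divergence_smul`), obtained by evaluating both sides on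
a basis. -/
def divergence (μ : Form (𝓡 d) M d) (X : (x : M) → TangentSpace (𝓡 d) x) (x : M) : ℝ :=
  lieDeriv (𝓡 d) X μ x (tangentBasis x) / μ x (tangentBasis x)

theorem lieDeriv_eq_divergence_smul (μ : Form (𝓡 d) M d)
    (X : (x : M) → TangentSpace (𝓡 d) x) (x : M) (hμ : μ x ≠ 0) :
    lieDeriv (𝓡 d) X μ x = divergence μ X x • μ x := by
  have key : ∀ ν : (TangentSpace (𝓡 d) x) [⋀^Fin d]→L[ℝ] ℝ, ∀ v,
      ν v = ν (tangentBasis x) * (tangentBasis x).det v := fun ν v => by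
    have h := congrArg (fun g => g v) (ν.toAlternatingMap.eq_smul_basis_det (tangentBasis x))
    simpa using h
  have h0 : μ x (tangentBasis x) ≠ 0 := by
    intro h
    apply hμ
    ext v
    rw [key, h]
    simp
  ext v
  rw [key, ContinuousAlternatingMap.smul_apply, key (μ x) v, divergence, smul_eq_mul]
  field_simp

end Volume

section Systems

/-- The subset `A` of a `d`-dimensional manifold has codimension at least `c`: in every chart it is
empty or of Hausdorff dimension at most `d - c`. -/
def HasCodimAtLeast {M : Type*} [TopologicalSpace M] (d : ℕ)
    [ChartedSpace (EuclideanSpace ℝ (Fin d)) M] (c : ℕ) (A : Set M) : Prop :=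
  ∀ x : M, (A ∩ (extChartAt (𝓡 d) x).source).Nonempty →
    dimH (extChartAt (𝓡 d) x '' (A ∩ (extChartAt (𝓡 d) x).source)) + c ≤ d

variable (n : ℕ) (M : Type*) [TopologicalSpace M] [ChartedSpace (EuclideanSpace ℝ (Fin (n + 1))) M]
  [IsManifold (𝓡 (n + 1)) ∞ M]
  (S : Set M) [ChartedSpace (EuclideanSpace ℝ (Fin n)) S] [IsManifold (𝓡 n) ∞ S]

/-- A hybrid dynamical system on the `(n + 1)`-dimensional manifold `M` with impact surface `S`,
a subset of `M` with an `n`-dimensional smooth structure. -/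
structure HybridSystem where
  /-- the continuous dynamics -/
  X : (x : M) → TangentSpace (𝓡 (n + 1)) x
  /-- the impact map -/
  reset : S → M
  isSmoothEmbedding : IsSmoothEmbedding (𝓡 n) (𝓡 (n + 1)) ∞ (Subtype.val : S → M)
  smooth_X : ContMDiff (𝓡 (n + 1)) (𝓡 (n + 1)).tangent ∞
    (fun x => (⟨x, X x⟩ : TangentBundle (𝓡 (n + 1)) M))
  smooth_reset : ContMDiff (𝓡 n) (𝓡 (n + 1)) ∞ reset
  disjoint_reset : S ∩ range reset = ∅
  codim_closure : HasCodimAtLeast (n + 1) 2 (closure S ∩ closure (range reset))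

namespace HybridSystem

variable {n M S}
variable (𝓗 : HybridSystem n M S)

/-- The (forward) hybrid flow, as a relation: `𝓗.Flow t x z` says that the hybrid trajectory
starting at `x` is defined up to time `t ≥ 0` and is at `z` at time `t`. The trajectory follows
integral curves of `X` until it meets `S`; if it meets `S` at time `t₁`, at the point `y`, then its
value at time `t₁` is `y` and after time `t₁` it is the trajectory started at `Δ(y)`. Trajectories
are continued through finitely many impacts only. -/
inductive Flow : ℝ → M → M → Prop
  | glide {t : ℝ} {x : M} {γ : ℝ → M} (ht : 0 ≤ t)
      (hγ : IsMIntegralCurveOn (I := 𝓡 (n + 1)) γ 𝓗.X (Icc 0 t)) (h0 : γ 0 = x)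
      (hS : ∀ s ∈ Ico 0 t, γ s ∉ S) : Flow t x (γ t)
  | impact {t₁ t₂ : ℝ} {x z : M} {γ : ℝ → M} {y : S} (ht₁ : 0 ≤ t₁) (ht₂ : 0 < t₂)
      (hγ : IsMIntegralCurveOn (I := 𝓡 (n + 1)) γ 𝓗.X (Icc 0 t₁)) (h0 : γ 0 = x)
      (hS : ∀ s ∈ Ico 0 t₁, γ s ∉ S) (hy : γ t₁ = y) (hz : Flow t₂ (𝓗.reset y) z) :
      Flow (t₁ + t₂) x z

/-- A hybrid system is smooth if a trajectory that reaches a point of `closure S \ S` stays off `S`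
for a short time afterwards, and `X` is transverse to `S`. -/
structure IsSmooth : Prop where
  off_frontier : ∀ (t : ℝ) (x p : M), 𝓗.Flow t x p → p ∈ closure S \ S →
    ∃ ε > 0, ∀ δ, 0 < δ → δ < ε → ∃ q, 𝓗.Flow (t + δ) x q ∧ q ∉ S
  transverse : ∀ y : S, IsCompl
    (LinearMap.range
      (mfderiv (𝓡 n) (𝓡 (n + 1)) (Subtype.val : S → M) y).toLinearMap)
    (Submodule.span ℝ {𝓗.X y})

/-- A form `α` is hybrid-invariant if `(φ_t)^* α = α` for the hybrid flow `φ_t`, `t ≥ 0`, wherever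
this makes sense: at the points `x ∉ S` with `φ_t(x) ∉ S` that have an open neighbourhood `U`,
disjoint from `S`, on which `φ_t` is defined and smooth. -/
def IsHybridInvariant {k : ℕ} (α : Form (𝓡 (n + 1)) M k) : Prop :=
  ∀ (t : ℝ) (U : Set M) (f : M → M), IsOpen U → Disjoint U S →
    (∀ x ∈ U, 𝓗.Flow t x (f x)) → ContMDiffOn (𝓡 (n + 1)) (𝓡 (n + 1)) ∞ f U →
    ∀ x ∈ U, f x ∉ S → pullback (𝓡 (n + 1)) (𝓡 (n + 1)) f α x = α x

/-- The pullback to `S` of a form on `M` along the inclusion `ι : S → M`. -/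
def restrictForm {k : ℕ} (α : Form (𝓡 (n + 1)) M k) : Form (𝓡 n) S k :=
  pullback (𝓡 (n + 1)) (𝓡 n) (Subtype.val : S → M) α

/-- The pullback to `S` of a form on `M` along the impact map `Δ`. Since `Δ` is the composition of
`Δ : S → Δ(S)` with the inclusion `ι'` of `Δ(S)` into `M`, this is `Δ^* ι'^* α`. -/
def resetForm {k : ℕ} (α : Form (𝓡 (n + 1)) M k) : Form (𝓡 n) S k :=
  pullback (𝓡 (n + 1)) (𝓡 n) 𝓗.reset α

/-- The energy condition `Δ^* ι'^* i_X α = ι^* i_X α`. -/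
def EnergyCondition {k : ℕ} (α : Form (𝓡 (n + 1)) M (k + 1)) : Prop :=
  𝓗.resetForm (interiorProduct (𝓡 (n + 1)) 𝓗.X α) =
    restrictForm (interiorProduct (𝓡 (n + 1)) 𝓗.X α)

/-- The specular condition `Δ^* ι'^* α = ι^* α`. -/
def SpecularCondition {k : ℕ} (α : Form (𝓡 (n + 1)) M k) : Prop :=
  𝓗.resetForm α = restrictForm α

end HybridSystem

end Systems

end Hybrid

end

/-! Where the hitting times depend smoothly on the initial point, the hybrid flow is a composition
of flow maps of `X`, with variable flow times, and of `Δ`. The flow of `X` preserves `μ` if and only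
if `L_X μ = 0`, that is, `div_μ X = 0`. At an impact, transversality splits `T_y M` into `T_y S` and
the line of `X`, and the impact acts on tangent vectors as `ι'w + r X(y) ↦ Δ'w + r X(Δ y)`: a
variation of the hitting time only adds a multiple of `X`, which every flow map carries to the same
multiple of `X`. A form of top degree is determined by the restriction to `T_y S` of its contraction
with `X`, so this linear map preserves `μ` if and only if the energy condition holds at `y`
(`energy_iff`). The specular condition compares two forms of degree `n + 1` on the `n`-dimensional
`S`; both vanish.

The difficulty is regularity. As `S` need not be closed, first hitting times are only upper
semicontinuous (`eventually_glide_lt`), the number of impacts may change from point to point, and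
the time until the next impact need not be locally bounded below. But the forms to be compared are
continuous, so dense sets of points suffice, and Baire's theorem provides them.

Sufficiency (`isHybridInvariant`): in any open set on which the time-`t` map is smooth, some number
of impacts is attained on a set that is dense in a smaller open set. `exists_pullback_eq` removes
these impacts one at a time, shrinking the open set so that the hitting time becomes continuous,
hence smooth. `IsState` is the invariant of this induction: for a family of states `q` at times `T`,
the map `dq - dT • X` preserves `μ`.

Necessity: off the closure of `S` the hybrid flow is the flow of `X` for small times, and this
complement is dense, whence `lieDeriv_eq_zero`. For `y` in a dense subset of `S`, the trajectories
crossing `S` near `y` stay off `S` for a uniform time after the impact. The hybrid flow before the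
surface then extends smoothly across it, and its invariance at `y` is the energy condition
(`energy_of_eventually_not_hits`).

The analytic basis is a smooth flow near any compact piece of trajectory
(`exists_isFlowOn_of_curve`), built from the implicit function theorem in a space of continuous
curves (`exists_picardSolution`). -/

namespace Hybrid

/-! ### Smoothness of superposition operators on spaces of continuous functions. -/

section Nemytskii

universe u

variable {K : Type*} [TopologicalSpace K] [CompactSpace K]
  {E F : Type u} [NormedAddCommGroup E] [NormedSpace ℝ E] [NormedAddCommGroup F] [NormedSpace ℝ F]

/-- Pointwise application of a continuous family of linear maps to a continuous function. -/
noncomputable def pointwiseApply : C(K, E →L[ℝ] F) →L[ℝ] C(K, E) →L[ℝ] C(K, F) :=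
  LinearMap.mkContinuous₂
    (LinearMap.mk₂ ℝ (fun (A : C(K, E →L[ℝ] F)) (v : C(K, E)) =>
        (⟨fun k => A k (v k), by fun_prop⟩ : C(K, F)))
      (fun _ _ _ => by ext; simp) (fun _ _ _ => by ext; simp)
      (fun _ _ _ => by ext; simp) (fun _ _ _ => by ext; simp)) 1
    (fun A v => by
      rw [ContinuousMap.norm_le _ (by positivity)]
      intro k
      simp only [LinearMap.mk₂_apply, ContinuousMap.coe_mk, one_mul]
      exact ((A k).le_opNorm _).trans
        (mul_le_mul (A.norm_coe_le_norm k) (v.norm_coe_le_norm k) (norm_nonneg (v k))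
          (norm_nonneg A)))

@[simp]
theorem pointwiseApply_apply (A : C(K, E →L[ℝ] F)) (v : C(K, E)) (k : K) :
    pointwiseApply A v k = A k (v k) := rfl

/-- The superposition operator `γ ↦ X ∘ γ`. -/
def superposition (X : C(E, F)) (γ : C(K, E)) : C(K, F) := X.comp γ

/-- This is the mean value inequality on each segment from `γ k` to `γ k + v k`. The bound is
uniform in `k` because `γ ↦ X' ∘ γ` is continuous for the sup norm. -/
theorem hasFDerivAt_superposition (X : C(E, F)) (X' : C(E, E →L[ℝ] F))
    (hX : ∀ x, HasFDerivAt X (X' x) x) (γ : C(K, E)) :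
    HasFDerivAt (superposition X) (pointwiseApply (superposition X' γ)) γ := by
  rw [hasFDerivAt_iff_isLittleO_nhds_zero, Asymptotics.isLittleO_iff]
  intro c hc
  have hcont : Continuous fun γ : C(K, E) => superposition X' γ :=
    ContinuousMap.continuous_postcomp X'
  obtain ⟨δ, hδ, hδ'⟩ := Metric.continuous_iff.1 hcont γ c hc
  filter_upwards [Metric.ball_mem_nhds (0 : C(K, E)) hδ] with v hv
  rw [mem_ball_zero_iff] at hv
  rw [ContinuousMap.norm_le _ (by positivity)]
  intro k
  have hseg : ∀ z ∈ segment ℝ (γ k) (γ k + v k), ‖X' z - X' (γ k)‖ ≤ c := by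
    intro z hz
    rw [segment_eq_image'] at hz
    obtain ⟨θ, hθ, rfl⟩ := hz
    have h1 := hδ' (γ + θ • v) (by
      rw [dist_eq_norm, add_sub_cancel_left, norm_smul, Real.norm_of_nonneg hθ.1]
      exact lt_of_le_of_lt (mul_le_of_le_one_left (norm_nonneg _) hθ.2) hv)
    have h2 := ContinuousMap.norm_coe_le_norm
      (superposition X' (γ + θ • v) - superposition X' γ) k
    rw [dist_eq_norm] at h1
    have h3 := h2.trans h1.le
    simpa [superposition] using h3
  have h :=
    (convex_segment (𝕜 := ℝ) (γ k) (γ k + v k)).norm_image_sub_le_of_norm_hasFDerivWithin_le'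
    (f := X) (f' := X') (φ := X' (γ k)) (C := c)
    (fun z _ => (hX z).hasFDerivWithinAt) hseg (left_mem_segment ℝ _ _) (right_mem_segment ℝ _ _)
  simp only [add_sub_cancel_left] at h
  refine le_trans ?_ (h.trans (mul_le_mul_of_nonneg_left (v.norm_coe_le_norm k) hc.le))
  simp [superposition]

/-- Induction on `m`: the derivative is `pointwiseApply` after the superposition operator of `fderiv
ℝ X`. The target `F` varies in the induction, since `fderiv ℝ X` takes values in `E →L[ℝ] F`. -/
theorem contDiff_superposition_nat (m : ℕ) :
    ∀ {F : Type u} [NormedAddCommGroup F] [NormedSpace ℝ F] (X : C(E, F)),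
      ContDiff ℝ m X → ContDiff ℝ m (superposition (K := K) X) := by
  induction m with
  | zero =>
    intro F _ _ X _
    exact contDiff_zero.2 (ContinuousMap.continuous_postcomp X)
  | succ m ih =>
    intro F _ _ X hX
    have hX' : ContDiff ℝ m (fderiv ℝ X) := hX.fderiv_right (m := m) (by norm_cast)
    have hd := hasFDerivAt_superposition (K := K) X ⟨fderiv ℝ X, hX'.continuous⟩
      (fun x => (hX.differentiable (by norm_cast) x).hasFDerivAt)
    have h2 := ih (F := E →L[ℝ] F) ⟨fderiv ℝ X, hX'.continuous⟩ hX'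
    rw [show ((m + 1 : ℕ) : WithTop ℕ∞) = (m : WithTop ℕ∞) + 1 by norm_cast,
      contDiff_succ_iff_hasFDerivAt]
    refine ⟨fun γ => pointwiseApply (superposition ⟨fderiv ℝ X, hX'.continuous⟩ γ), ?_, hd⟩
    exact pointwiseApply.contDiff.comp h2

theorem contDiff_superposition (X : C(E, F)) (hX : ContDiff ℝ ∞ X) :
    ContDiff ℝ ∞ (superposition (K := K) X) :=
  contDiff_infty.2 fun m => contDiff_superposition_nat m X (contDiff_infty.1 hX m)

end Nemytskii

/-! ### Smooth local flows by the implicit function theorem. -/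

section LocalFlow

theorem neg_one_le_one : (-1 : ℝ) ≤ 1 := by norm_num

variable {E : Type*} [NormedAddCommGroup E] [NormedSpace ℝ E]

/-- Integration from `0` of continuous functions on `[-1, 1]`. -/
noncomputable def primitive : C(Icc (-1 : ℝ) 1, E) →L[ℝ] C(Icc (-1 : ℝ) 1, E) :=
  LinearMap.mkContinuous
    { toFun := fun γ =>
        (⟨fun s => ∫ r in (0 : ℝ)..s, IccExtend neg_one_le_one γ r,
          (intervalIntegral.continuous_primitive (f := IccExtend neg_one_le_one γ)
            (fun _ _ => (γ.continuous.Icc_extend'.intervalIntegrable _ _)) 0).comp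
            continuous_subtype_val⟩ : C(Icc (-1 : ℝ) 1, E))
      map_add' := fun γ δ => by
        ext s
        exact intervalIntegral.integral_add (γ.continuous.Icc_extend'.intervalIntegrable _ _)
          (δ.continuous.Icc_extend'.intervalIntegrable _ _)
      map_smul' := fun c γ => by
        ext s
        exact intervalIntegral.integral_smul c _ } 1
    (fun γ => by
      rw [ContinuousMap.norm_le _ (by positivity)]
      intro s
      refine (intervalIntegral.norm_integral_le_of_norm_le_const (C := ‖γ‖)
        (fun r _ => γ.norm_coe_le_norm _)).trans ?_
      rw [sub_zero, mul_comm]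
      exact mul_le_mul_of_nonneg_right (abs_le.2 ⟨s.2.1, s.2.2⟩) (norm_nonneg _))

/-- The equation `γ = x + t ∫ X ∘ γ` for the rescaled integral curve starting at `x`. -/
noncomputable def picardDefect (X : C(E, E)) (v : (ℝ × E) × C(Icc (-1 : ℝ) 1, E)) :
    C(Icc (-1 : ℝ) 1, E) :=
  v.2 - ContinuousLinearMap.const ℝ (Icc (-1 : ℝ) 1) v.1.2 - v.1.1 • primitive (superposition X v.2)

variable {X : C(E, E)}

theorem picardDefect_eq_zero_iff {t : ℝ} {x : E} {γ : C(Icc (-1 : ℝ) 1, E)} :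
    picardDefect X ((t, x), γ) = 0 ↔
      ∀ s, γ s = x + t • ∫ r in (0 : ℝ)..s, X (IccExtend neg_one_le_one γ r) := by
  rw [ContinuousMap.ext_iff]
  refine forall_congr' fun s => ?_
  simp only [picardDefect, ContinuousMap.sub_apply, ContinuousMap.zero_apply, sub_sub, sub_eq_zero]
  rfl

theorem contDiff_picardDefect (hX : ContDiff ℝ ∞ X) : ContDiff ℝ ∞ (picardDefect X) := by
  have h1 : ContDiff ℝ ∞ fun v : (ℝ × E) × C(Icc (-1 : ℝ) 1, E) =>
      primitive (superposition X v.2) :=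
    primitive.contDiff.comp ((contDiff_superposition X hX).comp contDiff_snd)
  have h2 : ContDiff ℝ ∞ fun v : (ℝ × E) × C(Icc (-1 : ℝ) 1, E) =>
      ContinuousLinearMap.const ℝ (Icc (-1 : ℝ) 1) v.1.2 :=
    (ContinuousLinearMap.const ℝ (Icc (-1 : ℝ) 1) : E →L[ℝ] C(Icc (-1 : ℝ) 1, E)).contDiff.comp
      contDiff_fst.snd
  exact (contDiff_snd.sub h2).sub (contDiff_fst.fst.smul h1)

/-- Time is a parameter of the rescaled equation, and at time `0` the equation reduces to `γ = x`.
This makes the implicit function theorem applicable. -/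
theorem fderiv_picardDefect_comp_inr (hX : ContDiff ℝ ∞ X) (x : E) (γ : C(Icc (-1 : ℝ) 1, E)) :
    fderiv ℝ (picardDefect X) ((0, x), γ) ∘L .inr ℝ (ℝ × E) C(Icc (-1 : ℝ) 1, E) =
      ContinuousLinearMap.id ℝ _ := by
  have h1 : HasFDerivAt (fun δ => picardDefect X ((0, x), δ))
      (fderiv ℝ (picardDefect X) ((0, x), γ) ∘L .inr ℝ (ℝ × E) C(Icc (-1 : ℝ) 1, E)) γ :=
    (((contDiff_picardDefect hX).differentiable (by simp) _).hasFDerivAt).comp γ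
      (hasFDerivAt_prodMk_right _ _)
  have h2 : HasFDerivAt (fun δ => picardDefect X ((0, x), δ))
      (ContinuousLinearMap.id ℝ C(Icc (-1 : ℝ) 1, E)) γ := by
    simp only [picardDefect, zero_smul, sub_zero]
    exact (hasFDerivAt_id γ).sub_const _
  exact h1.unique h2

/-- The solution of the rescaled integral equation depends smoothly on the time and the initial
value. -/
theorem exists_picardSolution [CompleteSpace E] (hX : ContDiff ℝ ∞ X) (x₀ : E) :
    ∃ ψ : ℝ × E → C(Icc (-1 : ℝ) 1, E),
      ψ (0, x₀) = ContinuousMap.const _ x₀ ∧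
      (∀ᶠ v in 𝓝 ((0, x₀), ContinuousMap.const (Icc (-1 : ℝ) 1) x₀),
        picardDefect X v = 0 ↔ ψ v.1 = v.2) ∧
      ∀ᶠ p in 𝓝 (0, x₀), ContDiffAt ℝ ∞ ψ p := by
  set u : (ℝ × E) × C(Icc (-1 : ℝ) 1, E) := ((0, x₀), ContinuousMap.const _ x₀) with hu
  have hF := contDiff_picardDefect hX
  have hu0 : picardDefect X u = 0 := by
    rw [picardDefect_eq_zero_iff]; simp
  have hinv : ∀ᶠ v in 𝓝 u, (fderiv ℝ (picardDefect X) v ∘L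
      .inr ℝ (ℝ × E) C(Icc (-1 : ℝ) 1, E)).IsInvertible := by
    have hc : Continuous fun v => fderiv ℝ (picardDefect X) v ∘L
        .inr ℝ (ℝ × E) C(Icc (-1 : ℝ) 1, E) :=
      (hF.continuous_fderiv (by simp)).clm_comp continuous_const
    refine hc.continuousAt.eventually (ContinuousLinearEquiv.isOpen.mem_nhds ?_)
    simp only [hu]
    rw [fderiv_picardDefect_comp_inr hX]
    exact ⟨.refl ℝ _, rfl⟩
  have hn : (∞ : WithTop ℕ∞) ≠ 0 := by simp
  have huc := hF.contDiffAt (x := u)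
  set ψ := huc.implicitFunction hn hinv.self_of_nhds with hψ
  have hψu : ψ (0, x₀) = ContinuousMap.const _ x₀ :=
    huc.implicitFunction_apply_self hn hinv.self_of_nhds
  have hiff : ∀ᶠ v in 𝓝 u, picardDefect X v = 0 ↔ ψ v.1 = v.2 := by
    have := huc.eventually_apply_eq_iff_implicitFunction hn hinv.self_of_nhds
    rwa [hu0] at this
  refine ⟨ψ, hψu, hiff, ?_⟩
  have hψc : ContinuousAt ψ (0, x₀) :=
    (huc.contDiffAt_implicitFunction hn hinv.self_of_nhds).continuousAt
  have hgr : Filter.Tendsto (fun p => (p, ψ p)) (𝓝 (0, x₀)) (𝓝 u) := by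
    have := (continuousAt_id (x := ((0 : ℝ), x₀))).prodMk hψc
    simpa [ContinuousAt, hψu, hu] using this
  -- Smoothness of order `∞` at one point gives each finite order on a neighbourhood that may depend
  -- on the order. The implicit function theorem is therefore applied again at every nearby `(p, ψ
  -- p)`, and local uniqueness identifies the new solution with `ψ`.
  filter_upwards [hgr.eventually hiff.eventually_nhds, hgr.eventually hinv] with p hp1 hp2
  have hpc := hF.contDiffAt (x := (p, ψ p))
  have hp0 : picardDefect X (p, ψ p) = 0 := hp1.self_of_nhds.2 rfl
  have hd := hpc.contDiffAt_implicitFunction hn hp2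
  refine hd.congr_of_eventuallyEq ?_
  have hself := hpc.implicitFunction_apply_self hn hp2
  have ht : Filter.Tendsto (fun q => (q, hpc.implicitFunction hn hp2 q)) (𝓝 p) (𝓝 (p, ψ p)) := by
    have := (continuousAt_id (x := p)).prodMk hd.continuousAt
    simpa [ContinuousAt, hself] using this
  filter_upwards [ht.eventually hp1, hpc.eventually_apply_implicitFunction hn hp2] with q hq1 hq2
  exact hq1.1 (hq2.trans hp0)

theorem mul_mem_Icc_neg_one_one {σ s : ℝ} (hσ : σ ∈ Icc (-1 : ℝ) 1) (hs : s ∈ Icc (-1 : ℝ) 1) :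
    σ * s ∈ Icc (-1 : ℝ) 1 := by
  rw [mem_Icc, ← abs_le] at *
  rw [abs_mul]
  exact mul_le_one₀ hσ (abs_nonneg _) hs

/-- Rescaling the time of a continuous function on `[-1, 1]`. -/
noncomputable def rescale (σ : Icc (-1 : ℝ) 1) (γ : C(Icc (-1 : ℝ) 1, E)) :
    C(Icc (-1 : ℝ) 1, E) :=
  γ.comp ⟨fun s => ⟨σ * s, mul_mem_Icc_neg_one_one σ.2 s.2⟩, by fun_prop⟩

/-- Substitute `r ↦ σ r` in the integral: the fraction `σ` of a curve run for the time `t` is a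
curve run for the time `t * σ`. -/
theorem picardDefect_rescale {t : ℝ} {x : E} {γ : C(Icc (-1 : ℝ) 1, E)}
    (h : picardDefect X ((t, x), γ) = 0) (σ : Icc (-1 : ℝ) 1) :
    picardDefect X ((t * σ, x), rescale σ γ) = 0 := by
  rw [picardDefect_eq_zero_iff] at h ⊢
  intro s
  have hs : rescale σ γ s = γ ⟨σ * s, _⟩ := rfl
  rw [hs, h]
  rw [mul_smul]
  congr 2
  rw [← mul_zero (σ : ℝ), ← intervalIntegral.smul_integral_comp_mul_left, mul_zero]
  congr 1
  refine intervalIntegral.integral_congr fun r hr => ?_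
  have hr' : r ∈ Icc (-1 : ℝ) 1 :=
    (uIcc_subset_Icc (by norm_num) s.2) hr
  rw [IccExtend_of_mem _ _ hr']
  have : rescale σ γ ⟨r, hr'⟩ = γ ⟨σ * r, _⟩ := rfl
  rw [this, IccExtend_of_mem _ _ (mul_mem_Icc_neg_one_one σ.2 hr')]

/-- A smooth vector field on a Banach space has a smooth local flow. -/
theorem exists_smooth_localFlow [CompleteSpace E] (hX : ContDiff ℝ ∞ X) (x₀ : E) :
    ∃ ε > 0, ∃ Φ : ℝ × E → E,
      ContDiffOn ℝ ∞ Φ (Ioo (-ε) ε ×ˢ Metric.ball x₀ ε) ∧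
      (∀ x ∈ Metric.ball x₀ ε, Φ (0, x) = x) ∧
      ∀ x ∈ Metric.ball x₀ ε, ∀ t ∈ Ioo (-ε) ε,
        HasDerivAt (fun s => Φ (s, x)) (X (Φ (t, x))) t := by
  obtain ⟨ψ, hψ0, hiff, hsm⟩ := exists_picardSolution hX x₀
  obtain ⟨r, hr, hball⟩ := Metric.eventually_nhds_iff_ball.1 hiff
  have hψc : ContinuousAt ψ (0, x₀) := hsm.self_of_nhds.continuousAt
  have hnear : ∀ᶠ p in 𝓝 (0, x₀), ContDiffAt ℝ ∞ ψ p ∧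
      ψ p ∈ Metric.ball (ContinuousMap.const (Icc (-1 : ℝ) 1) x₀) r :=
    hsm.and (hψc.eventually (by rw [hψ0]; exact Metric.ball_mem_nhds _ hr))
  obtain ⟨ε', hε', hball'⟩ := Metric.eventually_nhds_iff_ball.1 hnear
  set ε := min r ε' with hε
  have hε0 : 0 < ε := lt_min hr hε'
  have hmem : ∀ t ∈ Ioo (-ε) ε, ∀ x ∈ Metric.ball x₀ ε, ((t, x) : ℝ × E) ∈
      Metric.ball ((0 : ℝ), x₀) ε := by
    intro t ht x hx
    rw [← ball_prod_same]
    refine ⟨?_, hx⟩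
    simpa [abs_lt] using ht
  have hsol : ∀ t ∈ Ioo (-ε) ε, ∀ x ∈ Metric.ball x₀ ε, picardDefect X ((t, x), ψ (t, x)) = 0 := by
    intro t ht x hx
    have h1 := hmem t ht x hx
    refine (hball ((t, x), ψ (t, x)) ?_).2 rfl
    rw [← ball_prod_same]
    exact ⟨Metric.ball_subset_ball (min_le_left _ _) h1,
      (hball' _ (Metric.ball_subset_ball (min_le_right _ _) h1)).2⟩
  -- The rescaled curve takes only values of `ψ (t, x)`, so it is as close to the constant `x₀`, and
  -- the uniqueness of the solution applies to it.
  have hresc : ∀ t ∈ Ioo (-ε) ε, ∀ x ∈ Metric.ball x₀ ε, ∀ σ : Icc (-1 : ℝ) 1,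
      ψ (t * σ, x) = rescale σ (ψ (t, x)) := by
    intro t ht x hx σ
    have hσ : |(σ : ℝ)| ≤ 1 := abs_le.2 ⟨σ.2.1, σ.2.2⟩
    have htσ : t * σ ∈ Ioo (-ε) ε := by
      rw [mem_Ioo, ← abs_lt, abs_mul]
      exact lt_of_le_of_lt (mul_le_of_le_one_right (abs_nonneg _) hσ) (abs_lt.2 ht)
    refine (hball ((t * σ, x), rescale σ (ψ (t, x))) ?_).1 (picardDefect_rescale (hsol t ht x hx) σ)
    rw [← ball_prod_same]
    refine ⟨Metric.ball_subset_ball (min_le_left _ _) (hmem _ htσ x hx), ?_⟩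
    have h2 := (hball' _ (Metric.ball_subset_ball (min_le_right _ _) (hmem t ht x hx))).2
    rw [Metric.mem_ball, ContinuousMap.dist_lt_iff hr] at h2 ⊢
    exact fun s => h2 _
  have one_mem : (1 : ℝ) ∈ Icc (-1 : ℝ) 1 := by norm_num
  refine ⟨ε, hε0, fun p => ψ p ⟨1, one_mem⟩, ?_, ?_, ?_⟩
  · rintro ⟨t, x⟩ ⟨ht, hx⟩
    have h1 := (hball' _ (Metric.ball_subset_ball (min_le_right _ _) (hmem t ht x hx))).1
    exact ((ContinuousMap.evalCLM ℝ (⟨1, one_mem⟩ : Icc (-1 : ℝ) 1)).contDiff.contDiffAt.comp _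
      h1).contDiffWithinAt
  · intro x hx
    have h1 := (picardDefect_eq_zero_iff.1
      (hsol 0 ⟨neg_lt_zero.2 hε0, hε0⟩ x hx)) ⟨1, one_mem⟩
    simpa using h1
  · intro x hx t ht
    -- With `t₁` strictly larger than `|t|`, all times near `t` are read off the single curve `ψ
    -- (t₁, x)`, to which the fundamental theorem of calculus applies.
    obtain ⟨t₁, ht₁, ht₁'⟩ := exists_between (abs_lt.2 ht)
    have hpos : 0 < t₁ := (abs_nonneg t).trans_lt ht₁
    have ht₁m : t₁ ∈ Ioo (-ε) ε := ⟨by linarith, ht₁'⟩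
    have hγ := picardDefect_eq_zero_iff.1 (hsol t₁ ht₁m x hx)
    have hkey : ∀ s : ℝ, |s| < t₁ → ψ (s, x) ⟨1, one_mem⟩ =
        IccExtend neg_one_le_one (ψ (t₁, x)) (s / t₁) := by
      intro s hs
      have hs' : s / t₁ ∈ Icc (-1 : ℝ) 1 := by
        rw [mem_Icc, ← abs_le, abs_div, abs_of_pos hpos]
        exact (div_le_one hpos).2 hs.le
      have h1 := hresc t₁ ht₁m x hx ⟨s / t₁, hs'⟩
      simp only [mul_div_cancel₀ s hpos.ne'] at h1
      rw [h1, IccExtend_of_mem _ _ hs']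
      simp [rescale]
    have hkey' : ∀ s : ℝ, |s| < t₁ → ψ (s, x) ⟨1, one_mem⟩ =
        x + t₁ • ∫ r in (0 : ℝ)..(s / t₁), X (IccExtend neg_one_le_one (ψ (t₁, x)) r) := by
      intro s hs
      have hs' : s / t₁ ∈ Icc (-1 : ℝ) 1 := by
        rw [mem_Icc, ← abs_le, abs_div, abs_of_pos hpos]
        exact (div_le_one hpos).2 hs.le
      rw [hkey s hs, IccExtend_of_mem _ _ hs', hγ]
    have hcont : Continuous fun r => X (IccExtend neg_one_le_one (ψ (t₁, x)) r) :=
      X.continuous.comp (ψ (t₁, x)).continuous.Icc_extend'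
    have hint := (hcont.integral_hasStrictDerivAt 0 (t / t₁)).hasDerivAt
    have hd : HasDerivAt (fun s => x + t₁ • ∫ r in (0 : ℝ)..(s / t₁),
        X (IccExtend neg_one_le_one (ψ (t₁, x)) r))
        (t₁ • ((1 / t₁) • X (IccExtend neg_one_le_one (ψ (t₁, x)) (t / t₁)))) t :=
      (HasDerivAt.const_smul t₁ (HasDerivAt.scomp (h := fun s : ℝ => s / t₁) t hint
        ((hasDerivAt_id t).div_const t₁))).const_add x
    rw [smul_smul, mul_one_div_cancel hpos.ne', one_smul, ← hkey t ht₁] at hd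
    refine hd.congr_of_eventuallyEq ?_
    have : ∀ᶠ s in 𝓝 t, |s| < t₁ := continuous_abs.continuousAt.eventually_lt continuousAt_const ht₁
    filter_upwards [this] with s hs using hkey' s hs

/-- A vector field that is smooth on an open set of a finite-dimensional space has a smooth local
flow around each point of this set. -/
theorem exists_smooth_localFlow_of_contDiffOn [FiniteDimensional ℝ E] {Y : E → E} {Ω : Set E}
    (hΩ : IsOpen Ω) (hY : ContDiffOn ℝ ∞ Y Ω) {x₀ : E} (hx₀ : x₀ ∈ Ω) :
    ∃ ε > 0, ∃ Φ : ℝ × E → E,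
      ContDiffOn ℝ ∞ Φ (Ioo (-ε) ε ×ˢ Metric.ball x₀ ε) ∧
      (∀ x ∈ Metric.ball x₀ ε, Φ (0, x) = x) ∧
      ∀ x ∈ Metric.ball x₀ ε, ∀ t ∈ Ioo (-ε) ε,
        Φ (t, x) ∈ Ω ∧ HasDerivAt (fun s => Φ (s, x)) (Y (Φ (t, x))) t := by
  have := FiniteDimensional.complete ℝ E
  obtain ⟨R, hR, hRΩ⟩ := Metric.nhds_basis_closedBall.mem_iff.1 (hΩ.mem_nhds hx₀)
  -- The superposition operator needs a field on the whole space. A cut-off equal to `1` on the ball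
  -- of radius `R / 2` changes nothing for trajectories that stay in that ball.
  let f : ContDiffBump x₀ := ⟨R / 2, R, by positivity, by linarith⟩
  have hsm : ContDiff ℝ ∞ fun x => f x • Y x := by
    rw [← contMDiff_iff_contDiff]
    refine contMDiff_of_tsupport fun x hx => ?_
    have hxΩ : x ∈ Ω := hRΩ (by
      have := tsupport_smul_subset_left _ _ hx
      rwa [f.tsupport_eq] at this)
    exact (f.contDiff.contDiffAt.smul (hY.contDiffAt (hΩ.mem_nhds hxΩ))).contMDiffAt
  obtain ⟨ε, hε, Φ, h1, h2, h3⟩ :=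
    exists_smooth_localFlow (X := ⟨fun x => f x • Y x, hsm.continuous⟩) hsm x₀
  have hmem : Ioo (-ε) ε ×ˢ Metric.ball x₀ ε ∈ 𝓝 ((0 : ℝ), x₀) :=
    (isOpen_Ioo.prod Metric.isOpen_ball).mem_nhds
      ⟨⟨neg_lt_zero.2 hε, hε⟩, Metric.mem_ball_self hε⟩
  have hc : ContinuousAt Φ (0, x₀) := (h1.continuousOn).continuousAt hmem
  have hev : ∀ᶠ p in 𝓝 ((0 : ℝ), x₀), Φ p ∈ Metric.closedBall x₀ (R / 2) := by
    refine hc.eventually ?_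
    rw [h2 x₀ (Metric.mem_ball_self hε)]
    exact Metric.closedBall_mem_nhds _ (by positivity)
  obtain ⟨r, hr, hr'⟩ := Metric.eventually_nhds_iff_ball.1 hev
  have hb : Metric.ball x₀ (min ε r) ⊆ Metric.ball x₀ ε :=
    Metric.ball_subset_ball (min_le_left _ _)
  have hI : Ioo (-min ε r) (min ε r) ⊆ Ioo (-ε) ε :=
    Ioo_subset_Ioo (neg_le_neg (min_le_left _ _)) (min_le_left _ _)
  refine ⟨min ε r, lt_min hε hr, Φ, h1.mono (prod_mono hI hb), fun x hx => h2 x (hb hx),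
    fun x hx t ht => ?_⟩
  have hΦ : Φ (t, x) ∈ Metric.closedBall x₀ (R / 2) := by
    refine hr' _ ?_
    rw [← ball_prod_same]
    refine ⟨?_, Metric.ball_subset_ball (min_le_right _ _) hx⟩
    rw [mem_ball_zero_iff, Real.norm_eq_abs]
    exact (abs_lt.2 ht).trans_le (min_le_right _ _)
  refine ⟨hRΩ (Metric.closedBall_subset_closedBall (by linarith) hΦ), ?_⟩
  have h4 := h3 x (hb hx) t (hI ht)
  rwa [ContinuousMap.coe_mk, f.one_of_mem_closedBall hΦ, one_smul] at h4

end LocalFlow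

/-! ### Vector fields in charts. -/

section Charts

variable {E : Type*} [NormedAddCommGroup E] [NormedSpace ℝ E]
  {M : Type*} [TopologicalSpace M] [ChartedSpace E M] [IsManifold 𝓘(ℝ, E) ∞ M]

theorem isManifold_one : IsManifold 𝓘(ℝ, E) 1 M := IsManifold.of_le (n := ∞) (by simp)

theorem mdifferentiableAt_extChartAt_symm {x₀ : M} {u : E}
    (hu : u ∈ (extChartAt 𝓘(ℝ, E) x₀).target) :
    MDifferentiableAt 𝓘(ℝ, E) 𝓘(ℝ, E) (extChartAt 𝓘(ℝ, E) x₀).symm u :=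
  ((contMDiffOn_extChartAt_symm (n := ∞) x₀).contMDiffAt
    ((isOpen_extChartAt_target x₀).mem_nhds hu)).mdifferentiableAt (by simp)

theorem mdifferentiableAt_extChartAt' {x₀ x : M}
    (hx : x ∈ (extChartAt 𝓘(ℝ, E) x₀).source) :
    MDifferentiableAt 𝓘(ℝ, E) 𝓘(ℝ, E) (extChartAt 𝓘(ℝ, E) x₀) x :=
  (contMDiffAt_extChartAt' (n := ∞) (by simpa using hx)).mdifferentiableAt (by simp)

theorem mfderiv_extChartAt_comp_symm {x₀ : M} {u : E}
    (hu : u ∈ (extChartAt 𝓘(ℝ, E) x₀).target) :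
    (mfderiv 𝓘(ℝ, E) 𝓘(ℝ, E) (extChartAt 𝓘(ℝ, E) x₀) ((extChartAt 𝓘(ℝ, E) x₀).symm u)) ∘L
      (mfderiv 𝓘(ℝ, E) 𝓘(ℝ, E) (extChartAt 𝓘(ℝ, E) x₀).symm u) =
        ContinuousLinearMap.id ℝ _ := by
  have := isManifold_one (E := E) (M := M)
  have h := mfderiv_extChartAt_comp_mfderivWithin_extChartAt_symm (I := 𝓘(ℝ, E)) hu
  rwa [ModelWithCorners.range_eq_univ, mfderivWithin_univ] at h

theorem mfderiv_extChartAt_symm_comp {x₀ : M} {u : E}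
    (hu : u ∈ (extChartAt 𝓘(ℝ, E) x₀).target) :
    (mfderiv 𝓘(ℝ, E) 𝓘(ℝ, E) (extChartAt 𝓘(ℝ, E) x₀).symm u) ∘L
      (mfderiv 𝓘(ℝ, E) 𝓘(ℝ, E) (extChartAt 𝓘(ℝ, E) x₀) ((extChartAt 𝓘(ℝ, E) x₀).symm u)) =
        ContinuousLinearMap.id ℝ _ := by
  have := isManifold_one (E := E) (M := M)
  have h := mfderivWithin_extChartAt_symm_comp_mfderiv_extChartAt (I := 𝓘(ℝ, E)) hu
  rwa [ModelWithCorners.range_eq_univ, mfderivWithin_univ] at h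

theorem isInvertible_mfderiv_extChartAt_symm {x₀ : M} {u : E}
    (hu : u ∈ (extChartAt 𝓘(ℝ, E) x₀).target) :
    (mfderiv 𝓘(ℝ, E) 𝓘(ℝ, E) (extChartAt 𝓘(ℝ, E) x₀).symm u).IsInvertible :=
  .of_inverse (mfderiv_extChartAt_symm_comp hu) (mfderiv_extChartAt_comp_symm hu)

variable {X : (x : M) → TangentSpace 𝓘(ℝ, E) x}

theorem mfderiv_extChartAt_symm_fieldInChart {x₀ : M} {u : E}
    (hu : u ∈ (extChartAt 𝓘(ℝ, E) x₀).target) :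
    mfderiv 𝓘(ℝ, E) 𝓘(ℝ, E) (extChartAt 𝓘(ℝ, E) x₀).symm u (fieldInChart (E := E) 𝓘(ℝ, E) X x₀ u) =
      X ((extChartAt 𝓘(ℝ, E) x₀).symm u) := by
  obtain ⟨e, he⟩ := isInvertible_mfderiv_extChartAt_symm hu
  rw [fieldInChart, VectorField.mpullback_apply, ← he, ContinuousLinearMap.inverse_equiv]
  exact e.apply_symm_apply _

theorem mfderiv_extChartAt_apply {x₀ x : M} (hx : x ∈ (extChartAt 𝓘(ℝ, E) x₀).source) :
    mfderiv 𝓘(ℝ, E) 𝓘(ℝ, E) (extChartAt 𝓘(ℝ, E) x₀) x (X x) =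
      fieldInChart (E := E) 𝓘(ℝ, E) X x₀ (extChartAt 𝓘(ℝ, E) x₀ x) := by
  have hu := (extChartAt 𝓘(ℝ, E) x₀).map_source hx
  have h1 := mfderiv_extChartAt_symm_fieldInChart (X := X) hu
  have h2 := mfderiv_extChartAt_comp_symm hu
  rw [(extChartAt 𝓘(ℝ, E) x₀).left_inv hx] at h1 h2
  rw [← h1]
  exact congrArg (fun A => A (fieldInChart (E := E) 𝓘(ℝ, E) X x₀ (extChartAt 𝓘(ℝ, E) x₀ x))) h2

theorem contDiffOn_fieldInChart [CompleteSpace E]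
    (hX : ContMDiff 𝓘(ℝ, E) 𝓘(ℝ, E).tangent ∞ (fun x => (⟨x, X x⟩ : TangentBundle 𝓘(ℝ, E) M)))
    (x₀ : M) :
    ContDiffOn ℝ ∞ (fieldInChart (E := E) 𝓘(ℝ, E) X x₀) (extChartAt 𝓘(ℝ, E) x₀).target := by
  intro u hu
  have h := ContMDiffAt.mpullback_vectorField_preimage (m := ∞) (n := ∞)
    (hX.contMDiffAt (x := (extChartAt 𝓘(ℝ, E) x₀).symm u))
    ((contMDiffOn_extChartAt_symm (n := ∞) x₀).contMDiffAt
      ((isOpen_extChartAt_target x₀).mem_nhds hu))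
    (isInvertible_mfderiv_extChartAt_symm hu) (by simp)
  exact (contMDiffAt_vectorSpace_iff_contDiffAt.1 h).contDiffWithinAt

end Charts

/-! ### Gluing integral curves. -/

section Curves

variable {E : Type*} [NormedAddCommGroup E] [NormedSpace ℝ E]
  {M : Type*} [TopologicalSpace M] [ChartedSpace E M]
  {X : (x : M) → TangentSpace 𝓘(ℝ, E) x}

theorem _root_.IsMIntegralCurveOn.congr {γ δ : ℝ → M} {s : Set ℝ}
    (hγ : IsMIntegralCurveOn (I := 𝓘(ℝ, E)) γ X s) (h : EqOn δ γ s) :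
    IsMIntegralCurveOn (I := 𝓘(ℝ, E)) δ X s := by
  intro t ht
  have := (hγ t ht).congr_of_eventuallyEq (f₁ := δ) (Filter.eventually_of_mem self_mem_nhdsWithin h)
    (h ht)
  rw [h ht]
  exact this

/-- Gluing an integral curve on `(a, 0]` and one on `[0, b)`. -/
theorem _root_.IsMIntegralCurveOn.glue {γ δ : ℝ → M} {a b : ℝ}
    (hδ : IsMIntegralCurveOn (I := 𝓘(ℝ, E)) δ X (Ioc a 0))
    (hγ : IsMIntegralCurveOn (I := 𝓘(ℝ, E)) γ X (Ico 0 b)) (h0 : δ 0 = γ 0)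
    (ha : a < 0) (hb : 0 < b) :
    IsMIntegralCurveOn (I := 𝓘(ℝ, E)) (fun s => if s ≤ 0 then δ s else γ s) X (Ioo a b) := by
  have h1 : IsMIntegralCurveOn (I := 𝓘(ℝ, E)) (fun s => if s ≤ 0 then δ s else γ s) X (Ioc a 0) :=
    hδ.congr fun s hs => if_pos hs.2
  have h2 : IsMIntegralCurveOn (I := 𝓘(ℝ, E))
      (fun s => if s ≤ 0 then δ s else γ s) X (Ico 0 b) := by
    refine hγ.congr fun s hs => ?_
    rcases hs.1.eq_or_lt with rfl | h
    · simp [h0]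
    · exact if_neg (not_le.2 h)
  rw [← Ioc_union_Ico_eq_Ioo ha hb]
  intro r hr
  rcases lt_trichotomy r 0 with h | rfl | h
  · exact (h1 r ⟨by rcases hr with hr | hr; exacts [hr.1, absurd hr.1 (not_le.2 h)],
      h.le⟩).mono_of_mem_nhdsWithin
      (Filter.mem_of_superset (inter_mem_nhdsWithin _ (Iio_mem_nhds h)) (by
        rintro s ⟨hs | hs, hs'⟩
        · exact hs
        · exact absurd hs.1 (not_le.2 hs')))
  · exact (h1 0 ⟨ha, le_rfl⟩).union (h2 0 ⟨le_rfl, hb⟩)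
  · exact (h2 r ⟨h.le, by
      rcases hr with hr | hr; exacts [absurd hr.2 (not_le.2 h), hr.2]⟩).mono_of_mem_nhdsWithin
      (Filter.mem_of_superset (inter_mem_nhdsWithin _ (Ioi_mem_nhds h)) (by
        rintro s ⟨hs | hs, hs'⟩
        · exact absurd hs.2 (not_le.2 hs')
        · exact hs))

end Curves

/-! ### Flows on manifolds and their continuation along a trajectory. -/

section Flows

variable {E : Type*} [NormedAddCommGroup E] [NormedSpace ℝ E]
  {M : Type*} [TopologicalSpace M] [ChartedSpace E M]

/-- `Φ` is a smooth flow of `X` for the times in `(a, b)` and the initial values in `W`. -/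
structure IsFlowOn (X : (x : M) → TangentSpace 𝓘(ℝ, E) x) (Φ : ℝ × M → M) (a b : ℝ)
    (W : Set M) : Prop where
  isOpen : IsOpen W
  lt_zero : a < 0
  zero_lt : 0 < b
  contMDiffOn : ContMDiffOn (𝓘(ℝ, ℝ).prod 𝓘(ℝ, E)) 𝓘(ℝ, E) ∞ Φ (Ioo a b ×ˢ W)
  zero : ∀ x ∈ W, Φ (0, x) = x
  curve : ∀ x ∈ W, IsMIntegralCurveOn (I := 𝓘(ℝ, E)) (fun s => Φ (s, x)) X (Ioo a b)

variable {X : (x : M) → TangentSpace 𝓘(ℝ, E) x} {Φ Ψ : ℝ × M → M} {a b c ε : ℝ} {W W' : Set M}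

theorem IsFlowOn.mono (h : IsFlowOn X Φ a b W) {a' b' : ℝ} (ha : a ≤ a') (ha' : a' < 0)
    (hb : b' ≤ b) (hb' : 0 < b') (hW' : IsOpen W') (hW : W' ⊆ W) : IsFlowOn X Φ a' b' W' where
  isOpen := hW'
  lt_zero := ha'
  zero_lt := hb'
  contMDiffOn := h.contMDiffOn.mono (prod_mono (Ioo_subset_Ioo ha hb) hW)
  zero x hx := h.zero x (hW hx)
  curve x hx := (h.curve x (hW hx)).mono (Ioo_subset_Ioo ha hb)

theorem IsFlowOn.contMDiffAt (h : IsFlowOn X Φ a b W) {s : ℝ} {x : M} (hs : s ∈ Ioo a b)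
    (hx : x ∈ W) : ContMDiffAt (𝓘(ℝ, ℝ).prod 𝓘(ℝ, E)) 𝓘(ℝ, E) ∞ Φ (s, x) :=
  h.contMDiffOn.contMDiffAt ((isOpen_Ioo.prod h.isOpen).mem_nhds ⟨hs, hx⟩)

theorem IsFlowOn.zero_mem (h : IsFlowOn X Φ a b W) : (0 : ℝ) ∈ Ioo a b := ⟨h.lt_zero, h.zero_lt⟩

theorem IsFlowOn.contMDiffAt_right (h : IsFlowOn X Φ a b W) {s : ℝ} {x : M} (hs : s ∈ Ioo a b)
    (hx : x ∈ W) : ContMDiffAt 𝓘(ℝ, E) 𝓘(ℝ, E) ∞ (fun z => Φ (s, z)) x :=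
  (h.contMDiffAt hs hx).comp x (contMDiffAt_const.prodMk contMDiffAt_id)

/-- The curve through a point, shifted in time. -/
theorem IsFlowOn.curve_sub (h : IsFlowOn X Φ a b W) {x : M} (hx : x ∈ W) (c : ℝ) :
    IsMIntegralCurveOn (I := 𝓘(ℝ, E)) (fun s => Φ (s - c, x)) X (Ioo (a + c) (b + c)) := by
  have h1 := (h.curve x hx).comp_add (-c)
  refine (h1.mono fun s hs => ?_)
  simp only [mem_ofPred_eq, mem_Ioo] at hs ⊢
  constructor <;> linarith [hs.1, hs.2]

variable [IsManifold 𝓘(ℝ, E) ∞ M]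

theorem exists_isFlowOn [FiniteDimensional ℝ E]
    (hX : ContMDiff 𝓘(ℝ, E) 𝓘(ℝ, E).tangent ∞ (fun x => (⟨x, X x⟩ : TangentBundle 𝓘(ℝ, E) M)))
    (x₀ : M) : ∃ ε > 0, ∃ W, x₀ ∈ W ∧ ∃ Φ, IsFlowOn X Φ (-ε) ε W := by
  have := FiniteDimensional.complete ℝ E
  set c := extChartAt 𝓘(ℝ, E) x₀ with hc
  obtain ⟨ε, hε, F, h1, h2, h3⟩ := exists_smooth_localFlow_of_contDiffOn
    (isOpen_extChartAt_target (I := 𝓘(ℝ, E)) x₀) (contDiffOn_fieldInChart hX x₀)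
    (mem_extChartAt_target x₀)
  set W := c.source ∩ c ⁻¹' Metric.ball (c x₀) ε with hW
  have hWo : IsOpen W :=
    (continuousOn_extChartAt x₀).isOpen_inter_preimage (isOpen_extChartAt_source x₀)
      Metric.isOpen_ball
  refine ⟨ε, hε, W, ⟨mem_extChartAt_source x₀, Metric.mem_ball_self hε⟩,
    fun p => c.symm (F (p.1, c p.2)), hWo, neg_lt_zero.2 hε, hε, ?_, ?_, ?_⟩
  · have hF : ContMDiffOn 𝓘(ℝ, ℝ × E) 𝓘(ℝ, E) ∞ F (Ioo (-ε) ε ×ˢ Metric.ball (c x₀) ε) :=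
      h1.contMDiffOn
    have hp : ContMDiffOn (𝓘(ℝ, ℝ).prod 𝓘(ℝ, E)) 𝓘(ℝ, ℝ × E) ∞ (fun p : ℝ × M => (p.1, c p.2))
        (Ioo (-ε) ε ×ˢ W) := by
      refine contMDiffOn_fst.prodMk_space ?_
      have := contMDiffOn_extChartAt (I := 𝓘(ℝ, E)) (n := ∞) (x := x₀)
      exact this.comp contMDiffOn_snd fun p hp => by simpa [hc] using hp.2.1
    refine (contMDiffOn_extChartAt_symm x₀).comp
      (hF.comp hp fun p hp => ⟨hp.1, hp.2.2⟩) fun p hp => ?_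
    exact (h3 _ hp.2.2 _ hp.1).1
  · intro x hx
    simp only [h2 _ hx.2]
    exact c.left_inv hx.1
  · intro x hx t ht
    obtain ⟨h4, h5⟩ := h3 _ hx.2 t ht
    have h6 := (mdifferentiableAt_extChartAt_symm h4).hasMFDerivAt
    have h7 : HasMFDerivAt 𝓘(ℝ, ℝ) 𝓘(ℝ, E) (fun s => F (s, c x)) t
        ((1 : ℝ →L[ℝ] ℝ).smulRight (fieldInChart (E := E) 𝓘(ℝ, E) X x₀ (F (t, c x)))) :=
      h5.hasFDerivAt.hasMFDerivAt
    refine ((h6.comp t h7).congr_mfderiv ?_).hasMFDerivWithinAt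
    have key := mfderiv_extChartAt_symm_fieldInChart (X := X) h4
    refine ContinuousLinearMap.ext fun (r : ℝ) => ?_
    exact ((mfderiv 𝓘(ℝ, E) 𝓘(ℝ, E) c.symm (F (t, c x))).map_smul r _).trans
      (congrArg (fun v => r • v) key)

variable [T2Space M]

theorem eqOn_Ioo_of_isMIntegralCurveOn
    (hX : ContMDiff 𝓘(ℝ, E) 𝓘(ℝ, E).tangent ∞ (fun x => (⟨x, X x⟩ : TangentBundle 𝓘(ℝ, E) M)))
    {γ δ : ℝ → M} (hγ : IsMIntegralCurveOn (I := 𝓘(ℝ, E)) γ X (Ioo a b))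
    (hδ : IsMIntegralCurveOn (I := 𝓘(ℝ, E)) δ X (Ioo a b)) (hc : c ∈ Ioo a b) (h0 : γ c = δ c) :
    EqOn γ δ (Ioo a b) := by
  have := isManifold_one (E := E) (M := M)
  exact isMIntegralCurveOn_Ioo_eqOn_of_contMDiff_boundaryless (t₀ := c) hc
    (hX.of_le (by simp)) hγ hδ h0

/-- Follow `Φ` up to time `c` and then `Ψ` from the point reached. By uniqueness of integral curves
the two descriptions agree for times near `c`, so the concatenation is smooth there. -/
theorem IsFlowOn.extend
    (hX : ContMDiff 𝓘(ℝ, E) 𝓘(ℝ, E).tangent ∞ (fun x => (⟨x, X x⟩ : TangentBundle 𝓘(ℝ, E) M)))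
    (hΦ : IsFlowOn X Φ a b W) (hΨ : IsFlowOn X Ψ (-ε) ε W') (hc0 : 0 ≤ c) (hcb : c < b) {x₀ : M}
    (hx₀ : x₀ ∈ W) (hx₀' : Φ (c, x₀) ∈ W') :
    ∃ V, x₀ ∈ V ∧ ∃ Φ', IsFlowOn X Φ' a (c + ε) V := by
  have hε := hΨ.zero_lt
  have hcm : c ∈ Ioo a b := ⟨hΦ.lt_zero.trans_le hc0, hcb⟩
  have hΦc : ContMDiffOn 𝓘(ℝ, E) 𝓘(ℝ, E) ∞ (fun z => Φ (c, z)) W := fun x hx =>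
    (hΦ.contMDiffAt_right hcm hx).contMDiffWithinAt
  set V := W ∩ (fun z => Φ (c, z)) ⁻¹' W' with hV
  have hVo : IsOpen V := hΦc.continuousOn.isOpen_inter_preimage hΦ.isOpen hΨ.isOpen
  -- Both descriptions are available for times within `η` of `c`.
  obtain ⟨η, hη0, hη⟩ : ∃ η > 0, η ≤ ε ∧ η ≤ b - c ∧ η ≤ c - a :=
    ⟨min ε (min (b - c) (c - a)), lt_min hε (lt_min (by linarith) (by linarith [hcm.1])),
      min_le_left _ _, (min_le_right _ _).trans (min_le_left _ _),
      (min_le_right _ _).trans (min_le_right _ _)⟩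
  obtain ⟨hη1, hη2, hη3⟩ := hη
  set Φ' : ℝ × M → M := fun p => if p.1 < c then Φ p else Ψ (p.1 - c, Φ (c, p.2)) with hΦ'
  have hΨc : ∀ x ∈ V, IsMIntegralCurveOn (I := 𝓘(ℝ, E)) (fun s => Ψ (s - c, Φ (c, x))) X
      (Ioo (c - ε) (c + ε)) := fun x hx =>
    (hΨ.curve_sub hx.2 c).mono (Ioo_subset_Ioo (by linarith) (by linarith))
  have hagree : ∀ x ∈ V, ∀ s ∈ Ioo (c - η) (c + η), Φ (s, x) = Ψ (s - c, Φ (c, x)) := by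
    intro x hx
    refine eqOn_Ioo_of_isMIntegralCurveOn hX (c := c)
      ((hΦ.curve x hx.1).mono (Ioo_subset_Ioo (by linarith) (by linarith)))
      ((hΨc x hx).mono (Ioo_subset_Ioo (by linarith) (by linarith)))
      ⟨by linarith, by linarith⟩ ?_
    simp only [sub_self]
    exact (hΨ.zero _ hx.2).symm
  have hl : ∀ x ∈ V, ∀ s ∈ Ioo a (c + η), Φ' (s, x) = Φ (s, x) := by
    intro x hx s hs
    by_cases h : s < c
    · simp [hΦ', h]
    · simp only [hΦ', h, if_false]
      exact (hagree x hx s ⟨by linarith [not_lt.1 h], hs.2⟩).symm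
  have hr : ∀ x ∈ V, ∀ s ∈ Ioo (c - η) (c + ε), Φ' (s, x) = Ψ (s - c, Φ (c, x)) := by
    intro x hx s hs
    by_cases h : s < c
    · simp only [hΦ', h, if_true]
      exact hagree x hx s ⟨hs.1, by linarith⟩
    · simp [hΦ', h]
  refine ⟨V, ⟨hx₀, hx₀'⟩, Φ', hVo, hΦ.lt_zero, by linarith, ?_, ?_, ?_⟩
  · rintro ⟨s, x⟩ ⟨hs, hx⟩
    refine ContMDiffAt.contMDiffWithinAt ?_
    by_cases h : s < c + η
    · refine (hΦ.contMDiffAt ⟨hs.1, by linarith⟩ hx.1).congr_of_eventuallyEq ?_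
      filter_upwards [(isOpen_Ioo.prod hVo).mem_nhds ⟨⟨hs.1, h⟩, hx⟩] with p hp
      exact hl p.2 hp.2 p.1 hp.1
    · have hs' : s ∈ Ioo (c - η) (c + ε) := ⟨by linarith [not_lt.1 h], hs.2⟩
      have h1 : ContMDiffAt (𝓘(ℝ, ℝ).prod 𝓘(ℝ, E)) (𝓘(ℝ, ℝ).prod 𝓘(ℝ, E)) ∞
          (fun p : ℝ × M => (p.1 - c, Φ (c, p.2))) (s, x) := by
        refine ContMDiffAt.prodMk ?_ ?_
        · exact (contDiff_id.sub contDiff_const).contMDiff.contMDiffAt.comp (s, x) contMDiffAt_fst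
        · exact (hΦ.contMDiffAt_right hcm hx.1).comp (s, x) contMDiffAt_snd
      have h2 : ContMDiffAt (𝓘(ℝ, ℝ).prod 𝓘(ℝ, E)) 𝓘(ℝ, E) ∞ Ψ (s - c, Φ (c, x)) :=
        hΨ.contMDiffAt ⟨by linarith [hs'.1], by linarith [hs'.2]⟩ hx.2
      refine (h2.comp (s, x) h1).congr_of_eventuallyEq ?_
      filter_upwards [(isOpen_Ioo.prod hVo).mem_nhds ⟨hs', hx⟩] with p hp
      exact hr p.2 hp.2 p.1 hp.1
  · intro x hx
    rw [hl x hx 0 ⟨hΦ.lt_zero, by linarith⟩, hΦ.zero x hx.1]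
  · intro x hx
    rw [isMIntegralCurveOn_iff_isMIntegralCurveAt isOpen_Ioo]
    intro s hs
    by_cases h : s < c + η
    · refine IsMIntegralCurveOn.isMIntegralCurveAt (s := Ioo a (c + η)) ?_
        (isOpen_Ioo.mem_nhds ⟨hs.1, h⟩)
      exact ((hΦ.curve x hx.1).mono (Ioo_subset_Ioo le_rfl (by linarith))).congr (hl x hx)
    · refine IsMIntegralCurveOn.isMIntegralCurveAt (s := Ioo (c - η) (c + ε)) ?_
        (isOpen_Ioo.mem_nhds ⟨by linarith [not_lt.1 h], hs.2⟩)
      exact ((hΨc x hx).mono (Ioo_subset_Ioo (by linarith) le_rfl)).congr (hr x hx)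

variable [FiniteDimensional ℝ E]

/-- Uniqueness on open intervals suffices: a local flow prolongs both curves to negative times by
the same curve, and the endpoint `b` follows by continuity. -/
theorem eqOn_Icc_of_isMIntegralCurveOn
    (hX : ContMDiff 𝓘(ℝ, E) 𝓘(ℝ, E).tangent ∞ (fun x => (⟨x, X x⟩ : TangentBundle 𝓘(ℝ, E) M)))
    {γ δ : ℝ → M} (hγ : IsMIntegralCurveOn (I := 𝓘(ℝ, E)) γ X (Icc 0 b))
    (hδ : IsMIntegralCurveOn (I := 𝓘(ℝ, E)) δ X (Icc 0 b)) (h0 : γ 0 = δ 0) :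
    EqOn γ δ (Icc 0 b) := by
  rcases lt_or_ge 0 b with hb | hb
  swap
  · intro s hs
    obtain rfl : s = 0 := le_antisymm (hs.2.trans hb) hs.1
    exact h0
  have := isManifold_one (E := E) (M := M)
  obtain ⟨ε, hε, W, hW, Φ, hΦ⟩ := exists_isFlowOn hX (γ 0)
  have hε' : -ε < 0 := neg_lt_zero.2 hε
  have h1 := (hΦ.curve _ hW).mono (Ioc_subset_Ioo_right hε : Ioc (-ε) 0 ⊆ _)
  have h2 := h1.glue (hγ.mono Ico_subset_Icc_self) (hΦ.zero _ hW) hε' hb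
  have h3 := h1.glue (hδ.mono Ico_subset_Icc_self) ((hΦ.zero _ hW).trans h0) hε' hb
  have h4 := isMIntegralCurveOn_Ioo_eqOn_of_contMDiff_boundaryless (t₀ := 0) ⟨hε', hb⟩
    (hX.of_le (by simp)) h2 h3 (by simp)
  refine EqOn.of_subset_closure (s := Ico 0 b) (fun s hs => ?_) hγ.continuousOn hδ.continuousOn
    Ico_subset_Icc_self (by rw [closure_Ico hb.ne])
  have h5 := h4 ⟨hε'.trans_le hs.1, hs.2⟩
  rcases hs.1.eq_or_lt with rfl | h
  · exact h0
  · simpa [not_le.2 h] using h5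

/-- Along an integral curve on a compact interval there is a smooth flow. -/
theorem exists_isFlowOn_of_curve
    (hX : ContMDiff 𝓘(ℝ, E) 𝓘(ℝ, E).tangent ∞ (fun x => (⟨x, X x⟩ : TangentBundle 𝓘(ℝ, E) M)))
    {γ : ℝ → M} (hb : 0 ≤ b) (hγ : IsMIntegralCurveOn (I := 𝓘(ℝ, E)) γ X (Icc 0 b)) :
    ∃ ε > 0, ∃ W, γ 0 ∈ W ∧ ∃ Φ, IsFlowOn X Φ (-ε) (b + ε) W := by
  -- The property `P` passes in both directions between nearby times of `[0, b]`, so it spreads from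
  -- `0` to `b` by connectedness.
  let P : ℝ → Prop := fun c => ∃ ε > 0, ∃ W, γ 0 ∈ W ∧ ∃ Φ, IsFlowOn X Φ (-ε) (c + ε) W
  have hP0 : P 0 := by
    obtain ⟨ε, hε, W, hW, Φ, h⟩ := exists_isFlowOn hX (γ 0)
    exact ⟨ε, hε, W, hW, Φ, by simpa using h⟩
  have hstep : ∀ z ∈ Icc 0 b, ∀ᶠ y in 𝓝[Icc 0 b] z, (P z → P y) ∧ (P y → P z) := by
    intro z hz
    obtain ⟨ε, hε, W', hW', Ψ, hΨ⟩ := exists_isFlowOn hX (γ z)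
    have h1 : ∀ᶠ y in 𝓝[Icc 0 b] z, γ y ∈ W' :=
      (hγ.continuousOn z hz) (hΨ.isOpen.mem_nhds hW')
    have h2 : ∀ᶠ y in 𝓝[Icc 0 b] z, |y - z| < ε := by
      refine nhdsWithin_le_nhds ?_
      filter_upwards [Metric.ball_mem_nhds z hε] with y hy
      simpa [Real.dist_eq] using hy
    have hgen : ∀ y ∈ Icc 0 b, ∀ y' : ℝ, 0 ≤ y' → γ y ∈ W' → |y - y'| < ε → P y → P y' := by
      rintro y hy y' hy' hyW hyy ⟨r, hr, W, hW, Φ, hΦ⟩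
      have hcur : Φ (y, γ 0) = γ y := by
        refine eqOn_Icc_of_isMIntegralCurveOn hX (b := y)
          ((hΦ.curve _ hW).mono fun s hs => ⟨by linarith [hs.1], by linarith [hs.2]⟩)
          (hγ.mono (Icc_subset_Icc le_rfl hy.2)) (hΦ.zero _ hW) ⟨hy.1, le_rfl⟩
      obtain ⟨V, hV, Φ', hΦ'⟩ := hΦ.extend hX hΨ hy.1 (by linarith : y < y + r) hW
        (by rwa [hcur])
      have h3 := (abs_lt.1 hyy).1
      have hm : 0 < min r (y + ε - y') := lt_min hr (by linarith)
      exact ⟨min r (y + ε - y'), hm, V, hV, Φ', hΦ'.mono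
        (neg_le_neg (min_le_left _ _)) (neg_lt_zero.2 hm)
        (by linarith [min_le_right r (y + ε - y')]) (by linarith) hΦ'.isOpen Subset.rfl⟩
    filter_upwards [h1, h2, self_mem_nhdsWithin] with y hy1 hy2 hy3
    exact ⟨hgen z hz y hy3.1 hW' (by rwa [abs_sub_comm]), hgen y hy3 z hz.1 hy1 hy2⟩
  exact isPreconnected_Icc.induction₂' (fun x y => P x → P y) hstep
    (fun _ _ _ _ _ _ h h' hp => h' (h hp)) ⟨le_rfl, hb⟩ ⟨hb, le_rfl⟩ hP0

end Flows

/-! ### The variational equation and the Lie derivative along a flow. -/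

section LieDerivative

variable {E : Type*} [NormedAddCommGroup E] [NormedSpace ℝ E]
  {E' : Type*} [NormedAddCommGroup E'] [NormedSpace ℝ E'] {k : ℕ}

theorem two_le_infty : (2 : WithTop ℕ∞) ≤ ∞ := by
  exact WithTop.coe_le_coe.2 (le_top : (2 : ℕ∞) ≤ ⊤)

/-- The variational equation: the space derivative of a flow satisfies the linearized equation. -/
theorem hasDerivAt_fderiv_flow {F : ℝ × E' → E} {Y : E → E} {s₀ : ℝ} {u : E'}
    (hF : ContDiffAt ℝ ∞ F (s₀, u))
    (hY : DifferentiableAt ℝ Y (F (s₀, u)))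
    (hFY : ∀ᶠ p in 𝓝 (s₀, u), HasDerivAt (fun s => F (s, p.2)) (Y (F p)) p.1) :
    HasDerivAt (fun s => fderiv ℝ (fun z => F (s, z)) u)
      (fderiv ℝ Y (F (s₀, u)) ∘L fderiv ℝ (fun z => F (s₀, z)) u) s₀ := by
  have hdiff : ∀ᶠ p in 𝓝 (s₀, u), DifferentiableAt ℝ F p :=
    ((hF.of_le (m := 1) (mod_cast le_top)).eventually (by decide)).mono
      fun p hp => hp.differentiableAt (by simp)
  have hslice : ∀ p : ℝ × E', DifferentiableAt ℝ F p →
      fderiv ℝ (fun z => F (p.1, z)) p.2 = fderiv ℝ F p ∘L .inr ℝ ℝ E' := fun p hp =>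
    (hp.hasFDerivAt.comp p.2 (hasFDerivAt_prodMk_right p.1 p.2)).fderiv
  have hev : ∀ᶠ s in 𝓝 s₀, fderiv ℝ (fun z => F (s, z)) u =
      fderiv ℝ F (s, u) ∘L .inr ℝ ℝ E' := by
    have hc : ContinuousAt (fun s : ℝ => (s, u)) s₀ := by fun_prop
    filter_upwards [hc.eventually hdiff] with s hs using hslice (s, u) hs
  have hDF : DifferentiableAt ℝ (fderiv ℝ F) (s₀, u) :=
    (hF.fderiv_right (m := 1) (by rw [one_add_one_eq_two]; exact two_le_infty)).differentiableAt
      (by simp)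
  have h1 : HasDerivAt (fun s => fderiv ℝ F (s, u))
      (fderiv ℝ (fderiv ℝ F) (s₀, u) (1, 0)) s₀ :=
    hDF.hasFDerivAt.comp_hasDerivAt s₀ ((hasDerivAt_id s₀).prodMk (hasDerivAt_const s₀ u))
  have h2 : HasDerivAt (fun s => fderiv ℝ F (s, u) ∘L .inr ℝ ℝ E')
      (fderiv ℝ (fderiv ℝ F) (s₀, u) (1, 0) ∘L .inr ℝ ℝ E') s₀ := by
    simpa using h1.clm_comp (hasDerivAt_const s₀ (ContinuousLinearMap.inr ℝ ℝ E'))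
  refine (h2.congr_of_eventuallyEq hev).congr_deriv ?_
  -- The time derivative of `F` is `Y ∘ F`, whose space derivative is `DY ∘ DF`. Symmetry of the
  -- second derivative lets the two differentiations be exchanged.
  have hsymm : IsSymmSndFDerivAt ℝ F (s₀, u) := hF.isSymmSndFDerivAt (by
    simp only [minSmoothness_of_isRCLikeNormedField]
    exact two_le_infty)
  have htime : (fun p => fderiv ℝ F p (1, 0)) =ᶠ[𝓝 (s₀, u)] fun p => Y (F p) := by
    filter_upwards [hdiff, hFY] with p hp hp'
    have h := hp.hasFDerivAt.comp_hasDerivAt p.1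
      ((hasDerivAt_id p.1).prodMk (hasDerivAt_const p.1 p.2))
    exact h.unique hp'
  ext z
  have h3 : HasFDerivAt (fun p => fderiv ℝ F p (1, 0))
      ((ContinuousLinearMap.apply ℝ E ((1 : ℝ), (0 : E'))) ∘L fderiv ℝ (fderiv ℝ F) (s₀, u))
      (s₀, u) :=
    (ContinuousLinearMap.apply ℝ E ((1 : ℝ), (0 : E'))).hasFDerivAt.comp _ hDF.hasFDerivAt
  have h4 : HasFDerivAt (fun p => Y (F p)) (fderiv ℝ Y (F (s₀, u)) ∘L fderiv ℝ F (s₀, u)) (s₀, u) :=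
    hY.hasFDerivAt.comp (s₀, u) hdiff.self_of_nhds.hasFDerivAt
  have h5 := (h3.congr_of_eventuallyEq htime.symm).unique h4
  have h6 := congrArg (fun A => A ((0 : ℝ), z)) h5
  simp only [ContinuousLinearMap.comp_apply, ContinuousLinearMap.apply_apply] at h6
  rw [hslice (s₀, u) hdiff.self_of_nhds]
  simp only [ContinuousLinearMap.comp_apply, ContinuousLinearMap.inr_apply]
  rw [← h6, hsymm.eq]

/-- Product rule: moving the base point gives the first term of `lieDerivCoord`, and the variational
equation for each of the `k` arguments gives the sum. -/
theorem hasDerivAt_comp_flow {F : ℝ × E' → E} {Y : E → E} {α : E → E [⋀^Fin k]→L[ℝ] ℝ} {s₀ : ℝ}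
    {u : E'} (hF : ContDiffAt ℝ ∞ F (s₀, u)) (hY : DifferentiableAt ℝ Y (F (s₀, u)))
    (hα : DifferentiableAt ℝ α (F (s₀, u)))
    (hFY : ∀ᶠ p in 𝓝 (s₀, u), HasDerivAt (fun s => F (s, p.2)) (Y (F p)) p.1) (v : Fin k → E') :
    HasDerivAt (fun s => α (F (s, u)) (fun i => fderiv ℝ (fun z => F (s, z)) u (v i)))
      (lieDerivCoord Y α (F (s₀, u)) (fun i => fderiv ℝ (fun z => F (s₀, z)) u (v i))) s₀ := by
  have h1 := hasDerivAt_fderiv_flow hF hY hFY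
  have h2 : HasDerivAt (fun s => α (F (s, u))) (fderiv ℝ α (F (s₀, u)) (Y (F (s₀, u)))) s₀ :=
    hα.hasFDerivAt.comp_hasDerivAt s₀ hFY.self_of_nhds
  have h3 := h2.hasFDerivAt.continuousAlternatingMapCompContinuousLinearMap h1.hasFDerivAt
  have h4 := ((ContinuousAlternatingMap.apply ℝ E' ℝ v).hasFDerivAt.comp s₀ h3).hasDerivAt
  refine h4.congr_deriv ?_
  rw [lieDerivCoord_apply]
  simp only [ContinuousLinearMap.comp_apply, add_apply, ContinuousAlternatingMap.apply_apply,
    ContinuousAlternatingMap.add_apply, ContinuousLinearMap.toSpanSingleton_apply, one_smul,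
    ContinuousAlternatingMap.fderivCompContinuousLinearMap_apply]
  refine congrArg₂ (· + ·) rfl (Finset.sum_congr rfl fun i _ => congrArg _ (funext fun j => ?_))
  rcases eq_or_ne j i with rfl | h
  · simp
  · simp [h]

end LieDerivative

/-! ### Maps, forms and pullbacks in charts. -/

section MapInCharts

variable {E : Type*} [NormedAddCommGroup E] [NormedSpace ℝ E]
  {M : Type*} [TopologicalSpace M] [ChartedSpace E M]
  {E' : Type*} [NormedAddCommGroup E'] [NormedSpace ℝ E']
  {N : Type*} [TopologicalSpace N] [ChartedSpace E' N]

/-- The expression of a map between manifolds in the preferred charts around `x` and `p`. -/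
noncomputable def mapInCharts (f : N → M) (x : N) (p : M) : E' → E :=
  extChartAt 𝓘(ℝ, E) p ∘ f ∘ (extChartAt 𝓘(ℝ, E') x).symm

theorem mapInCharts_apply {f : N → M} {x₀ x : N} {p : M}
    (hx : x ∈ (extChartAt 𝓘(ℝ, E') x₀).source) :
    mapInCharts (E := E) (E' := E') f x₀ p (extChartAt 𝓘(ℝ, E') x₀ x) =
      extChartAt 𝓘(ℝ, E) p (f x) := by
  simp only [mapInCharts, Function.comp_apply, (extChartAt 𝓘(ℝ, E') x₀).left_inv hx]

end MapInCharts

section FormsInCharts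

variable {E : Type*} [NormedAddCommGroup E] [NormedSpace ℝ E]
  {M : Type*} [TopologicalSpace M] [ChartedSpace E M] [IsManifold 𝓘(ℝ, E) ∞ M]
  {E' : Type*} [NormedAddCommGroup E'] [NormedSpace ℝ E']
  {N : Type*} [TopologicalSpace N] [ChartedSpace E' N] [IsManifold 𝓘(ℝ, E') ∞ N]
  {k : ℕ}

/-- The chart and its inverse have mutually inverse differentials. As the tangent space depends on
the base point, `key` transports the identity along `y = x`. -/
theorem formInChart_apply_mfderiv (α : Form 𝓘(ℝ, E) M k) {p x : M}
    (hx : x ∈ (extChartAt 𝓘(ℝ, E) p).source) (w : Fin k → TangentSpace 𝓘(ℝ, E) x) :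
    formInChart (E := E) 𝓘(ℝ, E) α p (extChartAt 𝓘(ℝ, E) p x)
      (fun i => mfderiv 𝓘(ℝ, E) 𝓘(ℝ, E) (extChartAt 𝓘(ℝ, E) p) x (w i)) = α x w := by
  have hu := (extChartAt 𝓘(ℝ, E) p).map_source hx
  have h := mfderiv_extChartAt_symm_comp hu
  have hl := (extChartAt 𝓘(ℝ, E) p).left_inv hx
  have key : ∀ y : M, y = x → ∀ A : E →L[ℝ] TangentSpace 𝓘(ℝ, E) y,
      (A ∘L mfderiv 𝓘(ℝ, E) 𝓘(ℝ, E) (extChartAt 𝓘(ℝ, E) p) x : E →L[ℝ] E) =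
        ContinuousLinearMap.id ℝ E →
      α y (fun i => A (mfderiv 𝓘(ℝ, E) 𝓘(ℝ, E) (extChartAt 𝓘(ℝ, E) p) x (w i))) = α x w := by
    rintro y rfl A hA
    exact congrArg (α y) (funext fun i => congrArg (fun B : E →L[ℝ] E => B (w i)) hA)
  rw [hl] at h
  exact key _ hl _ h

theorem fderiv_mapInCharts {f : N → M} {x₀ x : N} {p : M}
    (hx : x ∈ (extChartAt 𝓘(ℝ, E') x₀).source)
    (hf : MDifferentiableAt 𝓘(ℝ, E') 𝓘(ℝ, E) f x) (hfx : f x ∈ (extChartAt 𝓘(ℝ, E) p).source)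
    (v : TangentSpace 𝓘(ℝ, E') x) :
    fderiv ℝ (mapInCharts (E := E) (E' := E') f x₀ p) (extChartAt 𝓘(ℝ, E') x₀ x)
      (mfderiv 𝓘(ℝ, E') 𝓘(ℝ, E') (extChartAt 𝓘(ℝ, E') x₀) x v) =
    mfderiv 𝓘(ℝ, E) 𝓘(ℝ, E) (extChartAt 𝓘(ℝ, E) p) (f x) (mfderiv 𝓘(ℝ, E') 𝓘(ℝ, E) f x v) := by
  have hu := (extChartAt 𝓘(ℝ, E') x₀).map_source hx
  have hl := (extChartAt 𝓘(ℝ, E') x₀).left_inv hx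
  have hd : DifferentiableAt ℝ (mapInCharts (E := E) (E' := E') f x₀ p)
      (extChartAt 𝓘(ℝ, E') x₀ x) := by
    rw [← mdifferentiableAt_iff_differentiableAt]
    refine MDifferentiableAt.comp (I' := 𝓘(ℝ, E)) _ ?_
      (MDifferentiableAt.comp (I' := 𝓘(ℝ, E')) _ ?_ (mdifferentiableAt_extChartAt_symm hu))
    · simp only [Function.comp_apply, hl]
      exact mdifferentiableAt_extChartAt' hfx
    · rwa [hl]
  have heq : mapInCharts (E := E) (E' := E') f x₀ p ∘ extChartAt 𝓘(ℝ, E') x₀ =ᶠ[𝓝 x]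
      extChartAt 𝓘(ℝ, E) p ∘ f := by
    filter_upwards [extChartAt_source_mem_nhds' (I := 𝓘(ℝ, E')) hx] with y hy
    exact mapInCharts_apply hy
  have h1 : HasMFDerivAt 𝓘(ℝ, E') 𝓘(ℝ, E)
      (mapInCharts (E := E) (E' := E') f x₀ p ∘ extChartAt 𝓘(ℝ, E') x₀) x _ :=
    hd.hasFDerivAt.hasMFDerivAt.comp x (mdifferentiableAt_extChartAt' hx).hasMFDerivAt
  have h2 : HasMFDerivAt 𝓘(ℝ, E') 𝓘(ℝ, E) (extChartAt 𝓘(ℝ, E) p ∘ f) x _ :=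
    (mdifferentiableAt_extChartAt' hfx).hasMFDerivAt.comp x hf.hasMFDerivAt
  exact congrArg (fun A : E' →L[ℝ] E => A v)
    (hasMFDerivAt_unique h1 (h2.congr_of_eventuallyEq heq))

/-- A pullback, evaluated in charts. -/
theorem pullback_apply_inChart {f : N → M} (α : Form 𝓘(ℝ, E) M k) {x₀ x : N} {p : M}
    (hx : x ∈ (extChartAt 𝓘(ℝ, E') x₀).source)
    (hf : MDifferentiableAt 𝓘(ℝ, E') 𝓘(ℝ, E) f x) (hfx : f x ∈ (extChartAt 𝓘(ℝ, E) p).source)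
    (v : Fin k → TangentSpace 𝓘(ℝ, E') x) :
    pullback 𝓘(ℝ, E) 𝓘(ℝ, E') f α x v =
      formInChart (E := E) 𝓘(ℝ, E) α p
        (mapInCharts (E := E) (E' := E') f x₀ p (extChartAt 𝓘(ℝ, E') x₀ x))
        (fun i => fderiv ℝ (mapInCharts (E := E) (E' := E') f x₀ p) (extChartAt 𝓘(ℝ, E') x₀ x)
          (mfderiv 𝓘(ℝ, E') 𝓘(ℝ, E') (extChartAt 𝓘(ℝ, E') x₀) x (v i))) := by
  rw [mapInCharts_apply hx]
  simp only [fderiv_mapInCharts hx hf hfx]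
  exact (formInChart_apply_mfderiv α hfx _).symm

theorem contDiffAt_mapInCharts {f : N → M} {x₀ x : N} {p : M}
    (hx : x ∈ (extChartAt 𝓘(ℝ, E') x₀).source)
    (hf : ContMDiffAt 𝓘(ℝ, E') 𝓘(ℝ, E) ∞ f x) (hfx : f x ∈ (extChartAt 𝓘(ℝ, E) p).source) :
    ContDiffAt ℝ ∞ (mapInCharts (E := E) (E' := E') f x₀ p) (extChartAt 𝓘(ℝ, E') x₀ x) := by
  have hu := (extChartAt 𝓘(ℝ, E') x₀).map_source hx
  have hl := (extChartAt 𝓘(ℝ, E') x₀).left_inv hx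
  rw [← contMDiffAt_iff_contDiffAt]
  have h1 : ContMDiffAt 𝓘(ℝ, E') 𝓘(ℝ, E') ∞ (extChartAt 𝓘(ℝ, E') x₀).symm
      (extChartAt 𝓘(ℝ, E') x₀ x) :=
    (contMDiffOn_extChartAt_symm x₀).contMDiffAt ((isOpen_extChartAt_target x₀).mem_nhds hu)
  have h2 : ContMDiffAt 𝓘(ℝ, E') 𝓘(ℝ, E) ∞ (f ∘ (extChartAt 𝓘(ℝ, E') x₀).symm)
      (extChartAt 𝓘(ℝ, E') x₀ x) :=
    ContMDiffAt.comp _ (by rwa [hl]) h1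
  refine ContMDiffAt.comp (I' := 𝓘(ℝ, E)) _ ?_ h2
  simp only [Function.comp_apply, hl]
  exact contMDiffAt_extChartAt' (by simpa using hfx)

end FormsInCharts

/-! ### The derivative of the pullback along a flow. -/

section FlowPullback

variable {E : Type*} [NormedAddCommGroup E] [NormedSpace ℝ E]
  {M : Type*} [TopologicalSpace M] [ChartedSpace E M] [IsManifold 𝓘(ℝ, E) ∞ M]
  {X : (x : M) → TangentSpace 𝓘(ℝ, E) x} {Φ : ℝ × M → M} {a b : ℝ} {W : Set M} {k : ℕ}

/-- This is `d/ds Φ_s^* α = Φ_s^* L_X α`. The chart centre `p` is left free so that one chart can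
later serve for all points near a limit point. -/
theorem IsFlowOn.hasDerivAt_pullback [CompleteSpace E]
    (hX : ContMDiff 𝓘(ℝ, E) 𝓘(ℝ, E).tangent ∞ (fun x => (⟨x, X x⟩ : TangentBundle 𝓘(ℝ, E) M)))
    (hΦ : IsFlowOn X Φ a b W) {α : Form 𝓘(ℝ, E) M k} (hα : IsSmoothForm 𝓘(ℝ, E) α) {s₀ : ℝ}
    (hs₀ : s₀ ∈ Ioo a b) {x p : M} (hx : x ∈ W)
    (hp : Φ (s₀, x) ∈ (extChartAt 𝓘(ℝ, E) p).source) (v : Fin k → TangentSpace 𝓘(ℝ, E) x) :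
    HasDerivAt (fun s => pullback 𝓘(ℝ, E) 𝓘(ℝ, E) (fun z => Φ (s, z)) α x v)
      (lieDerivCoord (fieldInChart (E := E) 𝓘(ℝ, E) X p) (formInChart (E := E) 𝓘(ℝ, E) α p)
        (extChartAt 𝓘(ℝ, E) p (Φ (s₀, x)))
        (fun i => mfderiv 𝓘(ℝ, E) 𝓘(ℝ, E) (extChartAt 𝓘(ℝ, E) p) (Φ (s₀, x))
          (mfderiv 𝓘(ℝ, E) 𝓘(ℝ, E) (fun z => Φ (s₀, z)) x (v i)))) s₀ := by
  set u : E := extChartAt 𝓘(ℝ, E) x x with hu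
  have hxs := mem_extChartAt_source (I := 𝓘(ℝ, E)) x
  set F : ℝ × E → E := fun q => mapInCharts (E := E) (E' := E) (fun z => Φ (q.1, z)) x p q.2 with hF
  have hut : u ∈ (extChartAt 𝓘(ℝ, E) x).target := mem_extChartAt_target x
  have hsymm : ContMDiffAt 𝓘(ℝ, E) 𝓘(ℝ, E) ∞ (extChartAt 𝓘(ℝ, E) x).symm u :=
    (contMDiffOn_extChartAt_symm x).contMDiffAt ((isOpen_extChartAt_target x).mem_nhds hut)
  have hl : (extChartAt 𝓘(ℝ, E) x).symm u = x := (extChartAt 𝓘(ℝ, E) x).left_inv hxs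
  have hfst : ContMDiffAt 𝓘(ℝ, ℝ × E) 𝓘(ℝ, ℝ) ∞ (Prod.fst : ℝ × E → ℝ) (s₀, u) :=
    contDiffAt_fst.contMDiffAt
  have hsnd : ContMDiffAt 𝓘(ℝ, ℝ × E) 𝓘(ℝ, E) ∞ (Prod.snd : ℝ × E → E) (s₀, u) :=
    contDiffAt_snd.contMDiffAt
  have hpair : ContMDiffAt 𝓘(ℝ, ℝ × E) (𝓘(ℝ, ℝ).prod 𝓘(ℝ, E)) ∞
      (fun q : ℝ × E => (q.1, (extChartAt 𝓘(ℝ, E) x).symm q.2)) (s₀, u) :=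
    hfst.prodMk (ContMDiffAt.comp (s₀, u) hsymm hsnd)
  have hΦF : ContMDiffAt 𝓘(ℝ, ℝ × E) 𝓘(ℝ, E) ∞
      (fun q : ℝ × E => Φ (q.1, (extChartAt 𝓘(ℝ, E) x).symm q.2)) (s₀, u) :=
    ContMDiffAt.comp (s₀, u) (by simpa only [hl] using hΦ.contMDiffAt hs₀ hx) hpair
  have hFs : ContDiffAt ℝ ∞ F (s₀, u) := by
    rw [← contMDiffAt_iff_contDiffAt]
    refine ContMDiffAt.comp (I' := 𝓘(ℝ, E)) (s₀, u) (contMDiffAt_extChartAt' ?_) hΦF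
    change Φ (s₀, (extChartAt 𝓘(ℝ, E) x).symm u) ∈ _
    rw [extChartAt_source] at hp
    rwa [hl]
  have hF0 : ∀ s, F (s, u) = extChartAt 𝓘(ℝ, E) p (Φ (s, x)) := fun s => mapInCharts_apply hxs
  have hFt : F (s₀, u) ∈ (extChartAt 𝓘(ℝ, E) p).target := by
    rw [hF0]; exact (extChartAt 𝓘(ℝ, E) p).map_source hp
  have hto := (isOpen_extChartAt_target (I := 𝓘(ℝ, E)) p).mem_nhds hFt
  have hev : ∀ᶠ q in 𝓝 (s₀, u), q.1 ∈ Ioo a b ∧ (extChartAt 𝓘(ℝ, E) x).symm q.2 ∈ W ∧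
      Φ (q.1, (extChartAt 𝓘(ℝ, E) x).symm q.2) ∈ (extChartAt 𝓘(ℝ, E) p).source := by
    refine (continuousAt_fst.eventually (isOpen_Ioo.mem_nhds hs₀)).and
      (Filter.Eventually.and ?_ ?_)
    · exact (hpair.continuousAt.snd).eventually (hΦ.isOpen.mem_nhds (by simpa only [hl] using hx))
    · exact hΦF.continuousAt.eventually ((isOpen_extChartAt_source p).mem_nhds
        (by simpa only [hl] using hp))
  have hFY : ∀ᶠ q in 𝓝 (s₀, u), HasDerivAt (fun s => F (s, q.2))
      (fieldInChart (E := E) 𝓘(ℝ, E) X p (F q)) q.1 := by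
    filter_upwards [hev] with q hq
    have h1 := (hΦ.curve _ hq.2.1 q.1 hq.1).hasMFDerivAt (isOpen_Ioo.mem_nhds hq.1)
    have h2 := (mdifferentiableAt_extChartAt' hq.2.2).hasMFDerivAt.comp q.1 h1
    have h3 : HasFDerivAt (F := E) (fun s => F (s, q.2)) (_ : ℝ →L[ℝ] E) q.1 := h2.hasFDerivAt
    have h4 := h3.hasDerivAt
    refine h4.congr_deriv ?_
    refine Eq.trans ?_ (mfderiv_extChartAt_apply (X := X) hq.2.2)
    exact congrArg (mfderiv 𝓘(ℝ, E) 𝓘(ℝ, E) (extChartAt 𝓘(ℝ, E) p)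
      (Φ (q.1, (extChartAt 𝓘(ℝ, E) x).symm q.2))) (one_smul ℝ _)
  have hmd : ∀ s ∈ Ioo a b, MDifferentiableAt 𝓘(ℝ, E) 𝓘(ℝ, E) (fun z => Φ (s, z)) x :=
    fun s hs => (hΦ.contMDiffAt_right hs hx).mdifferentiableAt (by simp)
  have key := hasDerivAt_comp_flow (α := formInChart (E := E) 𝓘(ℝ, E) α p) hFs
    (((contDiffOn_fieldInChart hX p).contDiffAt hto).differentiableAt (by simp))
    (((hα p).contDiffAt hto).differentiableAt (by simp)) hFY
    (fun i => mfderiv 𝓘(ℝ, E) 𝓘(ℝ, E) (extChartAt 𝓘(ℝ, E) x) x (v i))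
  have heq : (fun s => pullback 𝓘(ℝ, E) 𝓘(ℝ, E) (fun z => Φ (s, z)) α x v) =ᶠ[𝓝 s₀] fun s =>
      formInChart (E := E) 𝓘(ℝ, E) α p (F (s, u)) (fun i => fderiv ℝ (fun z => F (s, z)) u
        (mfderiv 𝓘(ℝ, E) 𝓘(ℝ, E) (extChartAt 𝓘(ℝ, E) x) x (v i))) := by
    have hc : ContinuousAt (fun s : ℝ => (s, u)) s₀ := by fun_prop
    filter_upwards [hc.eventually hev] with s hs
    rw [hl] at hs
    exact pullback_apply_inChart α hxs (hmd s hs.1) hs.2.2 v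
  refine (key.congr_of_eventuallyEq heq).congr_deriv ?_
  rw [hF0]
  congr 1
  funext i
  exact fderiv_mapInCharts hxs (hmd s₀ hs₀) hp (v i)

end FlowPullback

/-! ### Continuity of pullbacks and of interior products. -/

section FormContinuity

variable {E : Type*} [NormedAddCommGroup E] [NormedSpace ℝ E]
  {M : Type*} [TopologicalSpace M] [ChartedSpace E M] [IsManifold 𝓘(ℝ, E) ∞ M]
  {E' : Type*} [NormedAddCommGroup E'] [NormedSpace ℝ E']
  {N : Type*} [TopologicalSpace N] [ChartedSpace E' N] [IsManifold 𝓘(ℝ, E') ∞ N]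
  {k : ℕ}

/-- Two forms that are continuous at a point and agree on a set accumulating there agree there. -/
theorem eq_of_mem_closure {α β : Form 𝓘(ℝ, E) M k} {x₀ : M} {T : Set M}
    (hα : ContinuousAt (formInChart (E := E) 𝓘(ℝ, E) α x₀) (extChartAt 𝓘(ℝ, E) x₀ x₀))
    (hβ : ContinuousAt (formInChart (E := E) 𝓘(ℝ, E) β x₀) (extChartAt 𝓘(ℝ, E) x₀ x₀))
    (hT : ∀ x ∈ T, α x = β x) (hx₀ : x₀ ∈ closure T) : α x₀ = β x₀ := by
  have hc := continuousAt_extChartAt (I := 𝓘(ℝ, E)) x₀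
  have hf : ∃ᶠ x in 𝓝 x₀, formInChart (E := E) 𝓘(ℝ, E) α x₀ (extChartAt 𝓘(ℝ, E) x₀ x) =
      formInChart (E := E) 𝓘(ℝ, E) β x₀ (extChartAt 𝓘(ℝ, E) x₀ x) := by
    refine ((mem_closure_iff_frequently.1 hx₀).and_eventually
      (extChartAt_source_mem_nhds (I := 𝓘(ℝ, E)) x₀)).mono fun x hx => ?_
    have h := hT x hx.1
    simp only [formInChart, pullback]
    rw [(extChartAt 𝓘(ℝ, E) x₀).left_inv hx.2, h]
  have h := tendsto_nhds_unique_of_frequently_eq (ContinuousAt.comp (x := x₀) hα hc)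
    (ContinuousAt.comp (x := x₀) hβ hc) hf
  ext w
  have hx := mem_extChartAt_source (I := 𝓘(ℝ, E)) x₀
  exact (formInChart_apply_mfderiv α hx w).symm.trans
    ((congrArg (fun β : E [⋀^Fin k]→L[ℝ] ℝ => β _) h).trans (formInChart_apply_mfderiv β hx w))

theorem eventually_mdifferentiableAt {f : N → M} {x₀ : N}
    (hf : ContMDiffAt 𝓘(ℝ, E') 𝓘(ℝ, E) ∞ f x₀) :
    ∀ᶠ x in 𝓝 x₀, MDifferentiableAt 𝓘(ℝ, E') 𝓘(ℝ, E) f x := by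
  have := isManifold_one (E := E) (M := M)
  have := isManifold_one (E := E') (M := N)
  exact ((contMDiffAt_iff_contMDiffAt_nhds (n := 1) (by simp)).1 (hf.of_le (by simp))).mono
    fun x hx => hx.mdifferentiableAt (by simp)

/-- In charts the pullback is `α ∘ F` composed with `DF`, and both are differentiable at the point.
Continuity is all that the density arguments need. -/
theorem IsSmoothForm.continuousAt_pullback {α : Form 𝓘(ℝ, E) M k} (hα : IsSmoothForm 𝓘(ℝ, E) α)
    {f : N → M} {x₀ : N} (hf : ContMDiffAt 𝓘(ℝ, E') 𝓘(ℝ, E) ∞ f x₀) :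
    ContinuousAt (formInChart (E := E') 𝓘(ℝ, E') (pullback 𝓘(ℝ, E) 𝓘(ℝ, E') f α) x₀)
      (extChartAt 𝓘(ℝ, E') x₀ x₀) := by
  set u := extChartAt 𝓘(ℝ, E') x₀ x₀
  have hu : u ∈ (extChartAt 𝓘(ℝ, E') x₀).target := mem_extChartAt_target x₀
  have hx := mem_extChartAt_source (I := 𝓘(ℝ, E')) x₀
  have hp := mem_extChartAt_source (I := 𝓘(ℝ, E)) (f x₀)
  have hl : (extChartAt 𝓘(ℝ, E') x₀).symm u = x₀ := (extChartAt 𝓘(ℝ, E') x₀).left_inv hx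
  set F := mapInCharts (E := E) (E' := E') f x₀ (f x₀)
  have hF : ContDiffAt ℝ ∞ F u := contDiffAt_mapInCharts hx hf hp
  have hFu : F u ∈ (extChartAt 𝓘(ℝ, E) (f x₀)).target := by
    rw [show F u = _ from mapInCharts_apply hx]
    exact mem_extChartAt_target _
  have h1 : DifferentiableAt ℝ (fun v => formInChart (E := E) 𝓘(ℝ, E) α (f x₀) (F v)) u :=
    ((((hα (f x₀)).contDiffAt ((isOpen_extChartAt_target _).mem_nhds hFu)).comp u hF)
      ).differentiableAt (by simp)
  have h2 : DifferentiableAt ℝ (fderiv ℝ F) u :=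
    (hF.fderiv_right (m := 1) (by rw [one_add_one_eq_two]; exact two_le_infty)).differentiableAt
      (by simp)
  refine (h1.continuousAlternatingMapCompContinuousLinearMap h2).continuousAt.congr ?_
  have hev := (eventually_mdifferentiableAt hf).and
    (hf.continuousAt.eventually (extChartAt_source_mem_nhds (I := 𝓘(ℝ, E)) (f x₀)))
  have hsc : ContinuousAt (extChartAt 𝓘(ℝ, E') x₀).symm u := continuousAt_extChartAt_symm x₀
  rw [← hl] at hev
  filter_upwards [hsc.eventually hev, (isOpen_extChartAt_target x₀).mem_nhds hu] with v hv hvt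
  have hvs := (extChartAt 𝓘(ℝ, E') x₀).map_target hvt
  have hr := (extChartAt 𝓘(ℝ, E') x₀).right_inv hvt
  ext w
  rw [hl] at hv
  have key := pullback_apply_inChart α hvs hv.1 hv.2
    (fun i => mfderiv 𝓘(ℝ, E') 𝓘(ℝ, E') (extChartAt 𝓘(ℝ, E') x₀).symm v (w i))
  rw [hr] at key
  refine Eq.trans ?_ key.symm
  refine congrArg (fun m : Fin k → E' => formInChart (E := E) 𝓘(ℝ, E) α (f x₀) (F v)
    (fun i => fderiv ℝ F v (m i))) (funext fun i => ?_)
  exact (congrArg (fun A : E' →L[ℝ] E' => A (w i)) (mfderiv_extChartAt_comp_symm hvt)).symm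

theorem IsSmoothForm.interiorProduct [CompleteSpace E] {X : (x : M) → TangentSpace 𝓘(ℝ, E) x}
    (hX : ContMDiff 𝓘(ℝ, E) 𝓘(ℝ, E).tangent ∞ (fun x => (⟨x, X x⟩ : TangentBundle 𝓘(ℝ, E) M)))
    {α : Form 𝓘(ℝ, E) M (k + 1)} (hα : IsSmoothForm 𝓘(ℝ, E) α) :
    IsSmoothForm 𝓘(ℝ, E) (interiorProduct 𝓘(ℝ, E) X α) := by
  intro p
  have hL : ContDiff ℝ ∞ (fun β : E [⋀^Fin (k + 1)]→L[ℝ] ℝ => β.curryLeft) :=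
    LinearIsometry.contDiff (𝕜 := ℝ) (E := E [⋀^Fin (k + 1)]→L[ℝ] ℝ)
      (F := E →L[ℝ] E [⋀^Fin k]→L[ℝ] ℝ) ContinuousAlternatingMap.curryLeftLI
  have h : ContDiffOn ℝ ∞ (fun u => (formInChart (E := E) 𝓘(ℝ, E) α p u).curryLeft
      (fieldInChart (E := E) 𝓘(ℝ, E) X p u)) (extChartAt 𝓘(ℝ, E) p).target :=
    ContDiffOn.clm_apply (hL.comp_contDiffOn (hα p)) (contDiffOn_fieldInChart hX p)
  refine h.congr fun u hu => ?_
  ext w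
  have h1 := mfderiv_extChartAt_symm_fieldInChart (X := X) hu
  refine congrArg (α ((extChartAt 𝓘(ℝ, E) p).symm u)) (funext fun i => ?_)
  refine Fin.cases ?_ (fun j => rfl) i
  exact h1.symm

end FormContinuity

/-! ### Invariance under a flow and vanishing Lie derivative. -/

section Divergence

variable {E : Type*} [NormedAddCommGroup E] [NormedSpace ℝ E] {k : ℕ}

theorem continuousOn_lieDerivCoord {Y : E → E} {α : E → E [⋀^Fin k]→L[ℝ] ℝ} {Ω : Set E}
    (hΩ : IsOpen Ω) (hY : ContDiffOn ℝ ∞ Y Ω) (hα : ContDiffOn ℝ ∞ α Ω) (v : Fin k → E) :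
    ContinuousOn (fun u => lieDerivCoord Y α u v) Ω := by
  simp only [lieDerivCoord_apply]
  have h1 : ContinuousOn (fderiv ℝ α) Ω := hα.continuousOn_fderiv_of_isOpen hΩ (by simp)
  have h2 : ContinuousOn (fderiv ℝ Y) Ω := hY.continuousOn_fderiv_of_isOpen hΩ (by simp)
  refine ContinuousOn.add ?_ (continuousOn_finsetSum _ fun i _ => ?_)
  · exact (h1.clm_apply hY.continuousOn).eval continuousOn_const
  · refine hα.continuousOn.eval ?_
    refine continuousOn_pi.2 fun j => ?_
    rcases eq_or_ne j i with rfl | h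
    · simpa using h2.clm_apply continuousOn_const
    · simpa [h] using continuousOn_const

variable {M : Type*} [TopologicalSpace M] [ChartedSpace E M] [IsManifold 𝓘(ℝ, E) ∞ M]
  {X : (x : M) → TangentSpace 𝓘(ℝ, E) x} {Φ : ℝ × M → M} {a b : ℝ} {W : Set M}

/-- A form with vanishing Lie derivative is invariant under the flow. -/
theorem IsFlowOn.pullback_eq [CompleteSpace E]
    (hX : ContMDiff 𝓘(ℝ, E) 𝓘(ℝ, E).tangent ∞ (fun x => (⟨x, X x⟩ : TangentBundle 𝓘(ℝ, E) M)))
    (hΦ : IsFlowOn X Φ a b W) {α : Form 𝓘(ℝ, E) M k} (hα : IsSmoothForm 𝓘(ℝ, E) α)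
    (hL : ∀ x, lieDeriv 𝓘(ℝ, E) X α x = 0) {s : ℝ} (hs : s ∈ Ioo a b) {x : M} (hx : x ∈ W) :
    pullback 𝓘(ℝ, E) 𝓘(ℝ, E) (fun z => Φ (s, z)) α x = α x := by
  have hid : (fun z => Φ (0, z)) =ᶠ[𝓝 x] id :=
    Filter.eventually_of_mem (hΦ.isOpen.mem_nhds hx) fun z hz => hΦ.zero z hz
  have h0 : pullback 𝓘(ℝ, E) 𝓘(ℝ, E) (fun z => Φ (0, z)) α x = α x := by
    simp only [pullback, hid.mfderiv_eq, mfderiv_id]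
    rw [hΦ.zero x hx]
    ext v
    rfl
  rw [← h0]
  ext v
  have hd : ∀ r ∈ Ioo a b, HasDerivAt
      (fun s => pullback 𝓘(ℝ, E) 𝓘(ℝ, E) (fun z => Φ (s, z)) α x v) 0 r := by
    intro r hr
    refine (hΦ.hasDerivAt_pullback hX hα hr hx (mem_extChartAt_source _) v).congr_deriv ?_
    exact congrArg (fun β => β (fun i => mfderiv 𝓘(ℝ, E) 𝓘(ℝ, E) (fun z => Φ (r, z)) x (v i)))
      (hL (Φ (r, x)))
  exact isOpen_Ioo.is_const_of_deriv_eq_zero isPreconnected_Ioo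
    (fun r hr => (hd r hr).differentiableAt.differentiableWithinAt) (fun r hr => (hd r hr).deriv)
    hs hΦ.zero_mem

/-- A form that is invariant under the flow for small positive times has vanishing Lie
derivative. -/
theorem IsFlowOn.lieDerivCoord_eq_zero [CompleteSpace E]
    (hX : ContMDiff 𝓘(ℝ, E) 𝓘(ℝ, E).tangent ∞ (fun x => (⟨x, X x⟩ : TangentBundle 𝓘(ℝ, E) M)))
    (hΦ : IsFlowOn X Φ a b W) {α : Form 𝓘(ℝ, E) M k} (hα : IsSmoothForm 𝓘(ℝ, E) α) {x p : M}
    (hx : x ∈ W)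
    (hinv : ∀ᶠ s in 𝓝[>] (0 : ℝ), pullback 𝓘(ℝ, E) 𝓘(ℝ, E) (fun z => Φ (s, z)) α x = α x)
    (hp : x ∈ (extChartAt 𝓘(ℝ, E) p).source) :
    lieDerivCoord (fieldInChart (E := E) 𝓘(ℝ, E) X p) (formInChart (E := E) 𝓘(ℝ, E) α p)
      (extChartAt 𝓘(ℝ, E) p x) = 0 := by
  have hid : (fun z => Φ (0, z)) =ᶠ[𝓝 x] id :=
    Filter.eventually_of_mem (hΦ.isOpen.mem_nhds hx) fun z hz => hΦ.zero z hz
  have h0 : pullback 𝓘(ℝ, E) 𝓘(ℝ, E) (fun z => Φ (0, z)) α x = α x := by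
    simp only [pullback, hid.mfderiv_eq, mfderiv_id]
    rw [hΦ.zero x hx]
    ext v
    rfl
  have hu := (extChartAt 𝓘(ℝ, E) p).map_source hp
  ext w
  let w' : Fin k → TangentSpace 𝓘(ℝ, E) x := fun i =>
    mfderiv 𝓘(ℝ, E) 𝓘(ℝ, E) (extChartAt 𝓘(ℝ, E) p).symm (extChartAt 𝓘(ℝ, E) p x) (w i)
  have h1 := hΦ.hasDerivAt_pullback hX hα hΦ.zero_mem hx (p := p) (by rwa [hΦ.zero x hx])
    w'
  -- Invariance is given for positive times only; since the two-sided derivative exists, comparing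
  -- derivatives from the right is enough.
  have h2 : HasDerivWithinAt (fun s => pullback 𝓘(ℝ, E) 𝓘(ℝ, E) (fun z => Φ (s, z)) α x
      w') 0 (Ioi 0) 0 := by
    refine (hasDerivWithinAt_const (0 : ℝ) (Ioi 0) (α x w')).congr_of_eventuallyEq
      (hinv.mono fun s hs => ?_) ?_
    · exact congrArg (fun β : E [⋀^Fin k]→L[ℝ] ℝ => β w') hs
    · exact congrArg (fun β : E [⋀^Fin k]→L[ℝ] ℝ => β w') h0
  have h3 := (uniqueDiffWithinAt_Ioi (0 : ℝ)).eq_deriv _ h1.hasDerivWithinAt h2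
  rw [hid.mfderiv_eq, mfderiv_id, hΦ.zero x hx] at h3
  refine Eq.trans (congrArg _ (funext fun i => ?_)) h3
  have h4 := mfderiv_extChartAt_comp_symm hu
  rw [(extChartAt 𝓘(ℝ, E) p).left_inv hp] at h4
  exact (congrArg (fun A : E →L[ℝ] E => A (w i)) h4).symm

/-- The definition of `lieDeriv` uses a different chart at each point. Vanishing on `T` is thus
assumed in the single chart around `p`, where the coefficients are continuous. -/
theorem lieDeriv_eq_zero_of_mem_closure [CompleteSpace E]
    (hX : ContMDiff 𝓘(ℝ, E) 𝓘(ℝ, E).tangent ∞ (fun x => (⟨x, X x⟩ : TangentBundle 𝓘(ℝ, E) M)))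
    {α : Form 𝓘(ℝ, E) M k} (hα : IsSmoothForm 𝓘(ℝ, E) α) {p : M} {T : Set M}
    (hT : ∀ x ∈ T, x ∈ (extChartAt 𝓘(ℝ, E) p).source →
      lieDerivCoord (fieldInChart (E := E) 𝓘(ℝ, E) X p)
      (formInChart (E := E) 𝓘(ℝ, E) α p) (extChartAt 𝓘(ℝ, E) p x) = 0) (hp : p ∈ closure T) :
    lieDeriv 𝓘(ℝ, E) X α p = 0 := by
  have key : lieDerivCoord (fieldInChart (E := E) 𝓘(ℝ, E) X p)
      (formInChart (E := E) 𝓘(ℝ, E) α p) (extChartAt 𝓘(ℝ, E) p p) = 0 := by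
    ext v
    have hc := ((continuousOn_lieDerivCoord (isOpen_extChartAt_target p)
      (contDiffOn_fieldInChart hX p) (hα p) v).continuousAt
      ((isOpen_extChartAt_target p).mem_nhds (mem_extChartAt_target p))).comp (x := p)
      (continuousAt_extChartAt p)
    refine tendsto_nhds_unique_of_frequently_eq hc (tendsto_const_nhds (x := 0)) ?_
    refine ((mem_closure_iff_frequently.1 hp).and_eventually
      (extChartAt_source_mem_nhds (I := 𝓘(ℝ, E)) p)).mono fun x hx => ?_
    exact congrArg (fun β : E [⋀^Fin k]→L[ℝ] ℝ => β v) (hT x hx.1 hx.2)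
  ext v
  exact congrArg (fun β : E [⋀^Fin k]→L[ℝ] ℝ => β fun i =>
    mfderiv 𝓘(ℝ, E) 𝓘(ℝ, E) (extChartAt 𝓘(ℝ, E) p) p (v i)) key

end Divergence

/-! ### Differentials of flows with variable time, and the group law. -/

section FlowDerivatives

variable {E : Type*} [NormedAddCommGroup E] [NormedSpace ℝ E]
  {M : Type*} [TopologicalSpace M] [ChartedSpace E M]
  {X : (x : M) → TangentSpace 𝓘(ℝ, E) x} {Φ Ψ : ℝ × M → M} {a b a' b' : ℝ} {W W' : Set M}

theorem IsFlowOn.hasMFDerivAt_left (hΦ : IsFlowOn X Φ a b W) {s : ℝ} (hs : s ∈ Ioo a b) {x : M}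
    (hx : x ∈ W) : HasMFDerivAt 𝓘(ℝ, ℝ) 𝓘(ℝ, E) (fun r => Φ (r, x)) s
      ((1 : ℝ →L[ℝ] ℝ).smulRight (X (Φ (s, x)))) :=
  (hΦ.curve x hx s hs).hasMFDerivAt (isOpen_Ioo.mem_nhds hs)

theorem IsFlowOn.mfderiv_apply (hΦ : IsFlowOn X Φ a b W) {s : ℝ} (hs : s ∈ Ioo a b) {x : M}
    (hx : x ∈ W) (r : ℝ) (v : TangentSpace 𝓘(ℝ, E) x) :
    mfderiv (𝓘(ℝ, ℝ).prod 𝓘(ℝ, E)) 𝓘(ℝ, E) Φ (s, x) ((r, v) : ℝ × E) =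
      r • X (Φ (s, x)) + mfderiv 𝓘(ℝ, E) 𝓘(ℝ, E) (fun z => Φ (s, z)) x v := by
  have h := mfderiv_prod_eq_add_apply (v := ((r, v) : ℝ × E))
    ((hΦ.contMDiffAt hs hx).mdifferentiableAt (by simp))
  refine h.trans (congrArg (· + _) ?_)
  exact congrArg (fun A : ℝ →L[ℝ] E => A r) (hΦ.hasMFDerivAt_left hs hx).mfderiv

variable {F : Type*} [NormedAddCommGroup F] [NormedSpace ℝ F]
  {N : Type*} [TopologicalSpace N] [ChartedSpace F N]

/-- The differential of a real function on a manifold. -/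
noncomputable def differential (g : N → ℝ) (x : N) : TangentSpace 𝓘(ℝ, F) x →L[ℝ] ℝ :=
  mfderiv 𝓘(ℝ, F) 𝓘(ℝ, ℝ) g x

/-- Impacts produce flow maps whose time depends on the point. By the chain rule, the variation of
the time only contributes a multiple of `X`. -/
theorem IsFlowOn.mfderiv_comp (hΦ : IsFlowOn X Φ a b W) {g : N → ℝ} {q : N → M} {x : N}
    (hg : MDifferentiableAt 𝓘(ℝ, F) 𝓘(ℝ, ℝ) g x) (hq : MDifferentiableAt 𝓘(ℝ, F) 𝓘(ℝ, E) q x)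
    (hgx : g x ∈ Ioo a b) (hqx : q x ∈ W) (v : TangentSpace 𝓘(ℝ, F) x) :
    mfderiv 𝓘(ℝ, F) 𝓘(ℝ, E) (fun z => Φ (g z, q z)) x v =
      differential (F := F) g x v • X (Φ (g x, q x)) +
        mfderiv 𝓘(ℝ, E) 𝓘(ℝ, E) (fun z => Φ (g x, z)) (q x) (mfderiv 𝓘(ℝ, F) 𝓘(ℝ, E) q x v) := by
  have h1 := hg.hasMFDerivAt.prodMk hq.hasMFDerivAt
  have h2 := (HasMFDerivAt.comp (g := Φ) x
    ((hΦ.contMDiffAt hgx hqx).mdifferentiableAt (by simp)).hasMFDerivAt h1).mfderiv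
  exact (congrArg (fun A : F →L[ℝ] E => A v) h2).trans (hΦ.mfderiv_apply hgx hqx _ _)

variable [IsManifold 𝓘(ℝ, E) ∞ M] [T2Space M]

/-- The group law of the flow. -/
theorem IsFlowOn.add
    (hX : ContMDiff 𝓘(ℝ, E) 𝓘(ℝ, E).tangent ∞ (fun x => (⟨x, X x⟩ : TangentBundle 𝓘(ℝ, E) M)))
    (hΨ : IsFlowOn X Ψ a' b' W') (hΦ : IsFlowOn X Φ a b W) {r s : ℝ} {x : M}
    (hs : s ∈ Ioo a b) (hx : x ∈ W) (hsx : Φ (s, x) ∈ W') (hr : r ∈ Ioo a' b')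
    (hrs : r + s ∈ Ioo a b) : Ψ (r, Φ (s, x)) = Φ (r + s, x) := by
  have h1 := hΨ.curve _ hsx
  have h2 := hΦ.curve_sub hx (-s)
  simp only [sub_neg_eq_add] at h2
  refine eqOn_Ioo_of_isMIntegralCurveOn hX (c := 0) (a := max a' (a + -s)) (b := min b' (b + -s))
    (h1.mono (Ioo_subset_Ioo (le_max_left _ _) (min_le_left _ _)))
    (h2.mono (Ioo_subset_Ioo (le_max_right _ _) (min_le_right _ _))) ?_ ?_ ?_
  · exact ⟨max_lt hΨ.lt_zero (by linarith [hs.1]), lt_min hΨ.zero_lt (by linarith [hs.2])⟩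
  · simp only [zero_add]
    exact hΨ.zero _ hsx
  · exact ⟨max_lt hr.1 (by linarith [hrs.1]), lt_min hr.2 (by linarith [hrs.2])⟩

/-- The flow preserves its vector field. -/
theorem IsFlowOn.mfderiv_field
    (hX : ContMDiff 𝓘(ℝ, E) 𝓘(ℝ, E).tangent ∞ (fun x => (⟨x, X x⟩ : TangentBundle 𝓘(ℝ, E) M)))
    (hΦ : IsFlowOn X Φ a b W) {s : ℝ} {x : M} (hs : s ∈ Ioo a b) (hx : x ∈ W) :
    mfderiv 𝓘(ℝ, E) 𝓘(ℝ, E) (fun z => Φ (s, z)) x (X x) = X (Φ (s, x)) := by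
  have h0 := hΦ.zero x hx
  have h1 := hΦ.hasMFDerivAt_left hΦ.zero_mem hx
  have h2 : MDifferentiableAt 𝓘(ℝ, E) 𝓘(ℝ, E) (fun z => Φ (s, z)) (Φ (0, x)) := by
    rw [h0]
    exact (hΦ.contMDiffAt_right hs hx).mdifferentiableAt (by simp)
  -- The two sides of `Φ_s ∘ Φ_r = Φ_{s + r}` are differentiated in `r` at `0`.
  have h3 := HasMFDerivAt.comp (g := fun z => Φ (s, z)) 0 h2.hasMFDerivAt h1
  have h4 : HasMFDerivAt 𝓘(ℝ, ℝ) 𝓘(ℝ, E) (fun r => Φ (s + r, x)) 0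
      ((1 : ℝ →L[ℝ] ℝ).smulRight (X (Φ (s + 0, x)))) := by
    have h5 := hΦ.hasMFDerivAt_left (s := s + 0) (by rwa [add_zero]) hx
    have h6 : HasMFDerivAt 𝓘(ℝ, ℝ) 𝓘(ℝ, ℝ) (fun r => s + r) 0 (ContinuousLinearMap.id ℝ ℝ) :=
      ((hasFDerivAt_id (0 : ℝ)).const_add s).hasMFDerivAt
    exact HasMFDerivAt.comp (g := fun r => Φ (r, x)) 0 h5 h6
  have hev : (fun z => Φ (s, z)) ∘ (fun r => Φ (r, x)) =ᶠ[𝓝 0] fun r => Φ (s + r, x) := by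
    have hc : ContinuousAt (fun r => Φ (r, x)) 0 := h1.continuousAt
    have hW : ∀ᶠ r in 𝓝 (0 : ℝ), Φ (r, x) ∈ W :=
      hc.eventually (hΦ.isOpen.mem_nhds (by simpa only [h0] using hx))
    have hs' : ∀ᶠ r in 𝓝 (0 : ℝ), s + r ∈ Ioo a b := by
      have hc' : ContinuousAt (fun r => s + r) 0 := by fun_prop
      exact hc'.eventually (isOpen_Ioo.mem_nhds (by simpa only [add_zero] using hs))
    filter_upwards [hW, hs', isOpen_Ioo.mem_nhds hΦ.zero_mem] with r h1 h2 h3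
    exact hΦ.add hX hΦ h3 hx h1 hs h2
  have h8 := hasMFDerivAt_unique h3 (h4.congr_of_eventuallyEq hev)
  have h9 := congrArg (fun A : ℝ →L[ℝ] E => A 1) h8
  have h10 : mfderiv 𝓘(ℝ, E) 𝓘(ℝ, E) (fun z => Φ (s, z)) (Φ (0, x)) (X (Φ (0, x))) =
      X (Φ (s + 0, x)) := by
    refine Eq.trans ?_ (h9.trans (one_smul ℝ _))
    exact congrArg (mfderiv 𝓘(ℝ, E) 𝓘(ℝ, E) (fun z => Φ (s, z)) (Φ (0, x))) (one_smul ℝ _).symm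
  rwa [h0, add_zero] at h10

end FlowDerivatives

/-! ### Transversality and alternating forms of top degree. -/

section LinearAlgebra

variable {E E' : Type*} [AddCommGroup E] [Module ℝ E] [AddCommGroup E'] [Module ℝ E']

/-- The two subspaces span, which gives surjectivity; injectivity follows by counting dimensions. -/
theorem bijective_of_isCompl [FiniteDimensional ℝ E] [FiniteDimensional ℝ E'] (b : E' →ₗ[ℝ] E)
    (X : E) (hd : Module.finrank ℝ E = Module.finrank ℝ E' + 1)
    (h : IsCompl (LinearMap.range b) (Submodule.span ℝ {X})) :
    Function.Bijective (fun q : E' × ℝ => b q.1 + q.2 • X) := by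
  let T : E' × ℝ →ₗ[ℝ] E := b.coprod (LinearMap.toSpanSingleton ℝ E X)
  have hs : Function.Surjective T := by
    rw [← LinearMap.range_eq_top, LinearMap.range_coprod, LinearMap.range_toSpanSingleton]
    exact h.sup_eq_top
  have hd' : Module.finrank ℝ (E' × ℝ) = Module.finrank ℝ E := by simp [hd]
  exact ⟨(LinearMap.injective_iff_surjective_of_finrank_eq_finrank hd').2 hs, hs⟩

/-- An alternating form of top degree on `E' × ℝ` is determined by its contraction with the
second factor. -/
theorem alternatingMap_ext_prod {n : ℕ} [FiniteDimensional ℝ E'] (hd : Module.finrank ℝ E' = n)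
    {f g : (E' × ℝ) [⋀^Fin (n + 1)]→ₗ[ℝ] ℝ}
    (h : ∀ w : Fin n → E', f (Matrix.vecCons (0, 1) fun i => (w i, 0)) =
      g (Matrix.vecCons (0, 1) fun i => (w i, 0))) : f = g := by
  let e := Module.finBasisOfFinrankEq ℝ E' hd
  have hli : LinearIndependent ℝ
      (Fin.cons (0, 1) fun i => (e i, 0) : Fin (n + 1) → E' × ℝ) := by
    rw [linearIndependent_finCons]
    refine ⟨e.linearIndependent.map' (LinearMap.inl ℝ E' ℝ)
      (LinearMap.ker_eq_bot.2 LinearMap.inl_injective), ?_⟩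
    intro hm
    have hle : Submodule.span ℝ (range fun i => ((e i, 0) : E' × ℝ)) ≤
        LinearMap.ker (LinearMap.snd ℝ E' ℝ) := by
      rw [Submodule.span_le]
      rintro _ ⟨i, rfl⟩
      simp
    simpa using hle hm
  let B := basisOfLinearIndependentOfCardEqFinrank hli (by simp [hd])
  have hB : ⇑B = Fin.cons (0, 1) fun i => (e i, 0) :=
    coe_basisOfLinearIndependentOfCardEqFinrank _ _
  rw [f.eq_smul_basis_det B, g.eq_smul_basis_det B, hB]
  congr 1
  exact h e

end LinearAlgebra

/-! ### Flow boxes at the impact surface. -/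

section Sections

variable {E : Type*} [NormedAddCommGroup E] [NormedSpace ℝ E]
  {M : Type*} [TopologicalSpace M] [ChartedSpace E M]
  {E' : Type*} [NormedAddCommGroup E'] [NormedSpace ℝ E']
  {S : Set M} [ChartedSpace E' S]

/-- The vector field `X` is transverse to the hypersurface `S`: the tangent space of `M` at each
point of `S` is the direct sum of the tangent space of `S` and of the line spanned by `X`. -/
def IsTransverse (E' : Type*) [NormedAddCommGroup E'] [NormedSpace ℝ E'] (S : Set M)
    [ChartedSpace E' S] (X : (x : M) → TangentSpace 𝓘(ℝ, E) x) : Prop :=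
  ∀ y : S, Function.Bijective (fun q : E' × ℝ =>
    (mfderiv 𝓘(ℝ, E') 𝓘(ℝ, E) (Subtype.val : S → M) y q.1 + q.2 • X y :
      TangentSpace 𝓘(ℝ, E) (y : M)))

variable [IsManifold 𝓘(ℝ, E) ∞ M] [IsManifold 𝓘(ℝ, E') ∞ S]
  {X : (x : M) → TangentSpace 𝓘(ℝ, E) x} {Φ : ℝ × M → M} {a b : ℝ} {W : Set M}

/-- The flow, starting on the hypersurface `S`, in charts. -/
noncomputable def sectionInCharts (E E' : Type*) [NormedAddCommGroup E] [NormedSpace ℝ E]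
    [NormedAddCommGroup E'] [NormedSpace ℝ E'] [ChartedSpace E M] [ChartedSpace E' S]
    (Φ : ℝ × M → M) (y : S) (q : E' × ℝ) : E :=
  extChartAt 𝓘(ℝ, E) (y : M) (Φ (q.2, ((extChartAt 𝓘(ℝ, E') y).symm q.1 : S)))

theorem contDiffAt_sectionInCharts
    (hι : ContMDiff 𝓘(ℝ, E') 𝓘(ℝ, E) ∞ (Subtype.val : S → M))
    (hΦ : IsFlowOn X Φ a b W) {y : S} {q : E' × ℝ}
    (hq : q.1 ∈ (extChartAt 𝓘(ℝ, E') y).target) (hs : q.2 ∈ Ioo a b)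
    (hW : ((extChartAt 𝓘(ℝ, E') y).symm q.1 : M) ∈ W)
    (hc : Φ (q.2, ((extChartAt 𝓘(ℝ, E') y).symm q.1 : S)) ∈ (extChartAt 𝓘(ℝ, E) (y : M)).source) :
    ContDiffAt ℝ ∞ (sectionInCharts E E' Φ y) q := by
  rw [← contMDiffAt_iff_contDiffAt]
  have h1 : ContMDiffAt 𝓘(ℝ, E' × ℝ) 𝓘(ℝ, E') ∞
      (fun q : E' × ℝ => (extChartAt 𝓘(ℝ, E') y).symm q.1) q :=
    ContMDiffAt.comp q ((contMDiffOn_extChartAt_symm y).contMDiffAt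
      ((isOpen_extChartAt_target y).mem_nhds hq))
      (show ContMDiffAt 𝓘(ℝ, E' × ℝ) 𝓘(ℝ, E') ∞ (Prod.fst : E' × ℝ → E') q from
        contDiffAt_fst.contMDiffAt)
  have h2 : ContMDiffAt 𝓘(ℝ, E' × ℝ) 𝓘(ℝ, ℝ) ∞ (Prod.snd : E' × ℝ → ℝ) q :=
    contDiffAt_snd.contMDiffAt
  have h3 : ContMDiffAt 𝓘(ℝ, E' × ℝ) 𝓘(ℝ, E) ∞
      (fun q : E' × ℝ => Φ (q.2, ((extChartAt 𝓘(ℝ, E') y).symm q.1 : S))) q :=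
    ContMDiffAt.comp (g := Φ) q (hΦ.contMDiffAt hs hW) (h2.prodMk (hι.contMDiffAt.comp q h1))
  exact ContMDiffAt.comp (I' := 𝓘(ℝ, E)) q
    (contMDiffAt_extChartAt' (by rwa [extChartAt_source] at hc)) h3

/-- Up to the differentials of the charts, the derivative is `(w, r) ↦ ι'w + r X(y)`, which is
bijective by transversality. -/
theorem exists_hasFDerivAt_sectionInCharts [FiniteDimensional ℝ E] [FiniteDimensional ℝ E']
    (hι : ContMDiff 𝓘(ℝ, E') 𝓘(ℝ, E) ∞ (Subtype.val : S → M)) (ht : IsTransverse E' S X)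
    (hΦ : IsFlowOn X Φ a b W) {y : S} (hy : (y : M) ∈ W) :
    ∃ L : (E' × ℝ) ≃L[ℝ] E, HasFDerivAt (sectionInCharts E E' Φ y) (L : E' × ℝ →L[ℝ] E)
      (extChartAt 𝓘(ℝ, E') y y, 0) := by
  set u := extChartAt 𝓘(ℝ, E') y y with hu
  have hut : u ∈ (extChartAt 𝓘(ℝ, E') y).target := mem_extChartAt_target y
  have hyl : (extChartAt 𝓘(ℝ, E') y).symm u = y := extChartAt_to_inv y
  have hcs := mem_extChartAt_source (I := 𝓘(ℝ, E)) (y : M)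
  have hΦ0 : Φ (0, ((extChartAt 𝓘(ℝ, E') y).symm u : S)) = y := by rw [hyl]; exact hΦ.zero _ hy
  set Dc := mfderiv 𝓘(ℝ, E) 𝓘(ℝ, E) (extChartAt 𝓘(ℝ, E) (y : M)) (y : M) with hDc
  set Dι := mfderiv 𝓘(ℝ, E') 𝓘(ℝ, E) (Subtype.val : S → M) y with hDι
  set De := mfderiv 𝓘(ℝ, E') 𝓘(ℝ, E') (extChartAt 𝓘(ℝ, E') y).symm u with hDe
  have hd : DifferentiableAt ℝ (sectionInCharts E E' Φ y) (u, 0) :=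
    (contDiffAt_sectionInCharts hι hΦ (q := (u, 0)) hut hΦ.zero_mem (by rwa [hyl])
      (by rw [hΦ0]; exact hcs)).differentiableAt (by simp)
  have hG := hd.hasFDerivAt
  set G' := fderiv ℝ (sectionInCharts E E' Φ y) (u, 0) with hG'
  have hcd : HasMFDerivAt 𝓘(ℝ, E) 𝓘(ℝ, E) (extChartAt 𝓘(ℝ, E) (y : M)) (y : M) Dc :=
    (mdifferentiableAt_extChartAt' hcs).hasMFDerivAt
  have hfst : ∀ w : E', G' (w, 0) = (Dc (Dι (De w) : TangentSpace 𝓘(ℝ, E) (y : M)) : E) := by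
    intro w
    have h1 : HasFDerivAt (fun v => sectionInCharts E E' Φ y (v, 0)) (G' ∘L .inl ℝ E' ℝ) u :=
      HasFDerivAt.comp (g := sectionInCharts E E' Φ y) u hG (hasFDerivAt_prodMk_left u 0)
    have h2 : HasMFDerivAt 𝓘(ℝ, E') 𝓘(ℝ, E') (extChartAt 𝓘(ℝ, E') y).symm u De :=
      (mdifferentiableAt_extChartAt_symm hut).hasMFDerivAt
    have h3 : HasMFDerivAt 𝓘(ℝ, E') 𝓘(ℝ, E) (Subtype.val : S → M)
        ((extChartAt 𝓘(ℝ, E') y).symm u) Dι := by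
      rw [hyl]
      exact (hι.mdifferentiableAt (by simp)).hasMFDerivAt
    have h4 := HasMFDerivAt.comp u h3 h2
    have h5 : HasMFDerivAt 𝓘(ℝ, E) 𝓘(ℝ, E) (extChartAt 𝓘(ℝ, E) (y : M))
        ((Subtype.val ∘ (extChartAt 𝓘(ℝ, E') y).symm) u) Dc := by
      rw [Function.comp_apply, hyl]
      exact hcd
    have h6 := HasMFDerivAt.comp u h5 h4
    have h7 : (fun v => sectionInCharts E E' Φ y (v, 0)) =ᶠ[𝓝 u]
        extChartAt 𝓘(ℝ, E) (y : M) ∘ (Subtype.val ∘ (extChartAt 𝓘(ℝ, E') y).symm) := by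
      have hc : ContinuousAt (Subtype.val ∘ (extChartAt 𝓘(ℝ, E') y).symm) u := h4.continuousAt
      have hW : ∀ᶠ v in 𝓝 u, (Subtype.val ∘ (extChartAt 𝓘(ℝ, E') y).symm) v ∈ W :=
        hc.eventually (hΦ.isOpen.mem_nhds (by simpa only [Function.comp_apply, hyl] using hy))
      filter_upwards [hW] with v hv
      exact congrArg _ (hΦ.zero _ hv)
    exact congrArg (fun A : E' →L[ℝ] E => A w)
      (hasMFDerivAt_unique h1.hasMFDerivAt (h6.congr_of_eventuallyEq h7))
  have hsnd : ∀ r : ℝ, G' (0, r) = r • (Dc (X y) : E) := by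
    intro r
    have h1 : HasFDerivAt (fun s => sectionInCharts E E' Φ y (u, s)) (G' ∘L .inr ℝ E' ℝ) 0 :=
      HasFDerivAt.comp (g := sectionInCharts E E' Φ y) 0 hG (hasFDerivAt_prodMk_right u 0)
    have h2 := hΦ.hasMFDerivAt_left hΦ.zero_mem hy
    have h3 : HasMFDerivAt 𝓘(ℝ, E) 𝓘(ℝ, E) (extChartAt 𝓘(ℝ, E) (y : M)) (Φ (0, (y : M))) Dc := by
      rw [hΦ.zero _ hy]
      exact hcd
    have h4 := HasMFDerivAt.comp (g := extChartAt 𝓘(ℝ, E) (y : M)) 0 h3 h2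
    have h5 : (fun s => sectionInCharts E E' Φ y (u, s)) =
        extChartAt 𝓘(ℝ, E) (y : M) ∘ fun s => Φ (s, (y : M)) := by
      funext s
      simp only [sectionInCharts, hyl, Function.comp_apply]
    have h6 := congrArg (fun A : ℝ →L[ℝ] E => A r)
      (hasMFDerivAt_unique h1.hasMFDerivAt (h5 ▸ h4))
    refine h6.trans ?_
    refine Eq.trans ?_ (Dc.map_smul r (X y))
    have key : ∀ z : M, z = y → (Dc (r • X z : E) : E) = Dc (r • X (y : M)) := by
      rintro z rfl
      rfl
    exact key _ (hΦ.zero _ hy)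
  have hG2 : ∀ q : E' × ℝ,
      G' q = Dc ((Dι (De q.1) : TangentSpace 𝓘(ℝ, E) (y : M)) + q.2 • X y) := by
    rintro ⟨w, r⟩
    have h1 : ((w, r) : E' × ℝ) = (w, 0) + (0, r) := by simp
    have h2 : G' (w, r) = G' (w, 0) + G' (0, r) := by rw [h1, map_add]
    rw [h2, hfst, hsnd]
    exact ((Dc.map_add _ _).trans (congrArg _ (Dc.map_smul r (X y)))).symm
  have hDcb : Function.Bijective Dc := by
    have h1 := isInvertible_mfderiv_extChartAt (I := 𝓘(ℝ, E)) hcs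
    exact h1.bijective
  have hDeb : Function.Bijective De := (isInvertible_mfderiv_extChartAt_symm hut).bijective
  have hb : Function.Bijective G' := by
    have h1 : (G' : E' × ℝ → E) = Dc ∘ (fun q : E' × ℝ => Dι q.1 + q.2 • X y) ∘
        (Prod.map De id) := funext hG2
    rw [h1]
    exact hDcb.comp ((ht y).comp (hDeb.prodMap Function.bijective_id))
  have := FiniteDimensional.complete ℝ E
  have := FiniteDimensional.complete ℝ E'
  refine ⟨ContinuousLinearEquiv.ofBijective G' (LinearMap.ker_eq_bot.2 hb.1)
    (LinearMap.range_eq_top.2 hb.2), ?_⟩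
  rw [ContinuousLinearEquiv.coe_ofBijective]
  exact hG

/-- The flow box at a point of the hypersurface `S`: `z = Φ (h z, p z)` with `p z ∈ S`. -/
theorem exists_flowBox [T2Space M] [FiniteDimensional ℝ E] [FiniteDimensional ℝ E']
    (hX : ContMDiff 𝓘(ℝ, E) 𝓘(ℝ, E).tangent ∞ (fun x => (⟨x, X x⟩ : TangentBundle 𝓘(ℝ, E) M)))
    (hι : ContMDiff 𝓘(ℝ, E') 𝓘(ℝ, E) ∞ (Subtype.val : S → M)) (ht : IsTransverse E' S X)
    (hΦ : IsFlowOn X Φ a b W) {y : S} (hy : (y : M) ∈ W) :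
    ∃ (h : M → ℝ) (p : M → S), h y = 0 ∧ p y = y ∧
      (∀ᶠ z in 𝓝 (y : M), ContMDiffAt 𝓘(ℝ, E) 𝓘(ℝ, ℝ) ∞ h z ∧ ContMDiffAt 𝓘(ℝ, E) 𝓘(ℝ, E') ∞ p z ∧
        Φ (-h z, z) = p z) ∧
      ∀ᶠ q in 𝓝 ((0 : ℝ), (y : M)), Φ q ∈ S → q.1 = -h q.2 := by
  obtain ⟨L, hL⟩ := exists_hasFDerivAt_sectionInCharts hι ht hΦ hy
  have := FiniteDimensional.complete ℝ E
  have := FiniteDimensional.complete ℝ E'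
  set c := extChartAt 𝓘(ℝ, E) (y : M) with hc
  set e := extChartAt 𝓘(ℝ, E') y with he
  set G := sectionInCharts E E' Φ y with hG
  set q₀ : E' × ℝ := (e y, 0) with hq₀
  have hey : e.symm (e y) = y := extChartAt_to_inv y
  have hΦ0 : Φ (0, (y : M)) = y := hΦ.zero _ hy
  have hG0 : G q₀ = c y := by simp only [hG, sectionInCharts, hq₀, ← he, ← hc, hey, hΦ0]
  have hsrcev : ∀ᶠ q in 𝓝 q₀, q.1 ∈ e.target ∧ q.2 ∈ Ioo a b ∧ (e.symm q.1 : M) ∈ W ∧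
      Φ (q.2, (e.symm q.1 : S)) ∈ c.source := by
    have hq1 : ContinuousAt (fun q : E' × ℝ => q.1) q₀ := continuousAt_fst
    have hes : ContinuousAt e.symm (e y) := continuousAt_extChartAt_symm y
    have h1 : ContinuousAt (fun q : E' × ℝ => (e.symm q.1 : M)) q₀ :=
      continuous_subtype_val.continuousAt.comp (ContinuousAt.comp (x := q₀) hes hq1)
    have h2 : ContinuousAt (fun q : E' × ℝ => Φ (q.2, (e.symm q.1 : S))) q₀ := by
      refine ContinuousAt.comp (g := Φ) ?_ (continuousAt_snd.prodMk h1)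
      simp only [hq₀, hey]
      exact (hΦ.contMDiffAt hΦ.zero_mem hy).continuousAt
    refine (hq1.eventually ((isOpen_extChartAt_target y).mem_nhds (mem_extChartAt_target y))).and
      ((continuousAt_snd.eventually (isOpen_Ioo.mem_nhds hΦ.zero_mem)).and
      ((h1.eventually (hΦ.isOpen.mem_nhds (by simpa only [hq₀, hey] using hy))).and
      (h2.eventually ((isOpen_extChartAt_source (y : M)).mem_nhds ?_))))
    simp only [hq₀, hey, hΦ0]
    exact mem_extChartAt_source (y : M)
  have hGs : ∀ᶠ q in 𝓝 q₀, ContDiffAt ℝ ∞ G q := hsrcev.mono fun q hq =>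
    contDiffAt_sectionInCharts hι hΦ hq.1 hq.2.1 hq.2.2.1 hq.2.2.2
  have hGd := hGs.self_of_nhds
  set R := hGd.toOpenPartialHomeomorph G hL (by simp) with hR
  have hRs : q₀ ∈ R.source := hGd.mem_toOpenPartialHomeomorph_source hL (by simp)
  have hRt : c y ∈ R.target := hG0 ▸ hGd.image_mem_toOpenPartialHomeomorph_target hL (by simp)
  have hRG : ∀ q, R q = G q := fun q => rfl
  have hR0 : R.symm (c y) = q₀ := by rw [← hG0, ← hRG]; exact R.left_inv hRs
  have hRc : ContinuousAt R.symm (c y) := R.symm.continuousAt hRt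
  -- The derivative of `G` stays invertible near `q₀`, so the local inverse is smooth of order `∞`
  -- on a neighbourhood and not only at one point.
  have hRsm : ∀ᶠ u in 𝓝 (c y), ContDiffAt ℝ ∞ R.symm u := by
    have h1 : ∀ᶠ q in 𝓝 q₀, ∃ L' : (E' × ℝ) ≃L[ℝ] E, (L' : E' × ℝ →L[ℝ] E) = fderiv ℝ G q := by
      have h2 : ContinuousAt (fderiv ℝ G) q₀ :=
        (hGd.fderiv_right (m := 0) (by simp)).continuousAt
      refine h2.eventually (p := fun A => A ∈ range
        (fun L' : (E' × ℝ) ≃L[ℝ] E => (L' : E' × ℝ →L[ℝ] E))) ?_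
      rw [hL.fderiv]
      exact ContinuousLinearEquiv.nhds L
    have h2 := hRc.eventually (by rw [hR0]; exact h1.and hGs)
    filter_upwards [h2, R.open_target.mem_nhds hRt] with u hu hut
    obtain ⟨⟨L', hL'⟩, hu2⟩ := hu
    refine R.contDiffAt_symm hut (f₀' := L') ?_ hu2
    rw [hL']
    exact (hu2.differentiableAt (by simp)).hasFDerivAt
  have hcy : ContinuousAt c y := continuousAt_extChartAt (y : M)
  have hK : ContinuousAt (fun z => R.symm (c z)) (y : M) := ContinuousAt.comp hRc hcy
  -- Flow time and foot point are the two components of the local inverse of `(w, s) ↦ Φ (s, e.symm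
  -- w)`.
  refine ⟨fun z => (R.symm (c z)).2, fun z => e.symm (R.symm (c z)).1, ?_, ?_, ?_, ?_⟩
  · simp only [hR0, hq₀]
  · simp only [hR0, hq₀, hey]
  · have h1 := hK.eventually (by simpa only [hR0] using hsrcev)
    have h2 : ∀ᶠ z in 𝓝 (y : M), -(R.symm (c z)).2 ∈ Ioo a b := by
      refine hK.snd.neg.eventually (isOpen_Ioo.mem_nhds ?_)
      simpa only [Pi.neg_apply, hR0, hq₀, neg_zero] using hΦ.zero_mem
    filter_upwards [h1, h2, hcy.eventually hRsm, hcy.eventually (R.open_target.mem_nhds hRt),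
      (isOpen_extChartAt_source (I := 𝓘(ℝ, E)) (y : M)).mem_nhds (mem_extChartAt_source (y : M)),
      hΦ.isOpen.mem_nhds hy] with z hz hz2 hz3 hz4 hz5 hz6
    have hKz : ContMDiffAt 𝓘(ℝ, E) 𝓘(ℝ, E' × ℝ) ∞ (fun z => R.symm (c z)) z :=
      ContMDiffAt.comp (g := R.symm) z hz3.contMDiffAt
        (contMDiffAt_extChartAt' (by rwa [extChartAt_source] at hz5))
    refine ⟨?_, ?_, ?_⟩
    · exact ContMDiffAt.comp (g := Prod.snd) z
        (show ContMDiffAt 𝓘(ℝ, E' × ℝ) 𝓘(ℝ, ℝ) ∞ (Prod.snd : E' × ℝ → ℝ) _ from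
          contDiffAt_snd.contMDiffAt) hKz
    · exact ContMDiffAt.comp (g := e.symm) z ((contMDiffOn_extChartAt_symm y).contMDiffAt
        ((isOpen_extChartAt_target y).mem_nhds hz.1)) (ContMDiffAt.comp (g := Prod.fst) z
        (show ContMDiffAt 𝓘(ℝ, E' × ℝ) 𝓘(ℝ, E') ∞ (Prod.fst : E' × ℝ → E') _ from
          contDiffAt_fst.contMDiffAt) hKz)
    · have h3 : Φ ((R.symm (c z)).2, (e.symm (R.symm (c z)).1 : S)) = z := by
        refine c.injOn hz.2.2.2 hz5 ?_
        exact R.right_inv hz4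
      have h4 := hΦ.add hX hΦ hz.2.1 hz.2.2.1 (by rw [h3]; exact hz6) hz2
        (by rw [neg_add_cancel]; exact hΦ.zero_mem)
      rw [h3, neg_add_cancel, hΦ.zero _ hz.2.2.1] at h4
      exact h4
  · have hSev : ∀ᶠ q in 𝓝 ((0 : ℝ), y), q.2 ∈ e.source ∧ (e q.2, q.1) ∈ R.source := by
      have h1 : ContinuousAt e y := continuousAt_extChartAt y
      have h2 : ContinuousAt (fun q : ℝ × S => (e q.2, q.1)) ((0 : ℝ), y) :=
        (ContinuousAt.comp (g := e) (x := ((0 : ℝ), y)) h1 continuousAt_snd).prodMk continuousAt_fst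
      exact (continuousAt_snd.eventually ((isOpen_extChartAt_source y).mem_nhds
        (mem_extChartAt_source y))).and (h2.eventually (R.open_source.mem_nhds hRs))
    -- As `S` carries the subspace topology, every point of `S` close to `y` in `M` lies in the
    -- domain of the local inverse. This gives uniqueness of the hitting time among all points of
    -- `S` near `y`.
    have hind : Topology.IsInducing (Prod.map id Subtype.val : ℝ × S → ℝ × M) :=
      Topology.IsInducing.id.prodMap Topology.IsInducing.subtypeVal
    rw [hind.nhds_eq_comap, Filter.eventually_comap] at hSev
    simp only [Prod.map_apply, id_eq] at hSev
    have hΦc : ContinuousAt Φ ((0 : ℝ), (y : M)) := (hΦ.contMDiffAt hΦ.zero_mem hy).continuousAt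
    have h3 : ContinuousAt (fun q : ℝ × M => (-q.1, Φ q)) ((0 : ℝ), (y : M)) :=
      continuousAt_fst.neg.prodMk hΦc
    have h4 := h3.eventually (by simpa only [neg_zero, hΦ0] using hSev)
    have h5 : ∀ᶠ q in 𝓝 ((0 : ℝ), (y : M)), Φ q ∈ W :=
      hΦc.eventually (hΦ.isOpen.mem_nhds (by rwa [hΦ0]))
    have h6 : ∀ᶠ q in 𝓝 ((0 : ℝ), (y : M)), q.1 ∈ Ioo a b ∧ -q.1 ∈ Ioo a b ∧ q.2 ∈ W := by
      refine (continuousAt_fst.eventually (isOpen_Ioo.mem_nhds hΦ.zero_mem)).and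
        ((continuousAt_fst.neg.eventually (isOpen_Ioo.mem_nhds ?_)).and
        (continuousAt_snd.eventually (hΦ.isOpen.mem_nhds hy)))
      simpa only [Pi.neg_apply, neg_zero] using hΦ.zero_mem
    filter_upwards [h4, h5, h6] with q hq hqW hq6 hqS
    obtain ⟨h7, h8⟩ := hq (-q.1, ⟨Φ q, hqS⟩) rfl
    have h9 : Φ (-q.1, Φ q) = q.2 := by
      have h10 := hΦ.add hX hΦ hq6.1 hq6.2.2 hqW hq6.2.1
        (by rw [neg_add_cancel]; exact hΦ.zero_mem)
      rwa [neg_add_cancel, hΦ.zero _ hq6.2.2] at h10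
    have h11 : R (e ⟨Φ q, hqS⟩, -q.1) = c q.2 := by
      rw [hRG]
      simp only [hG, sectionInCharts, ← he, ← hc, e.left_inv h7, h9]
    have h12 : R.symm (c q.2) = (e ⟨Φ q, hqS⟩, -q.1) := by
      rw [← h11]
      exact R.left_inv h8
    simp only [h12, neg_neg]

end Sections

/-! ### Points of continuity of semicontinuous functions. -/

section Semicontinuity

/-- An upper semicontinuous function on an open subset of a Baire space has points of continuity. -/
theorem exists_continuousAt_of_eventually_lt {Y : Type*} [TopologicalSpace Y] [BaireSpace Y]
    {V : Set Y} (hV : IsOpen V) (hne : V.Nonempty) {τ : Y → ℝ}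
    (hτ : ∀ x ∈ V, ∀ r, τ x < r → ∀ᶠ x' in 𝓝 x, τ x' < r) : ∃ x ∈ V, ContinuousAt τ x := by
  set A : ℚ → Set Y := fun r => {x ∈ V | τ x < r} with hA
  have hAo : ∀ r, IsOpen (A r) := fun r => isOpen_iff_mem_nhds.2 fun x hx =>
    Filter.inter_mem (hV.mem_nhds hx.1) (hτ x hx.1 r hx.2)
  -- Lower semicontinuity at a point of `V` can fail only on the frontier of some `A r`, and the
  -- frontier of an open set is closed with empty interior.
  have hd : Dense (⋂ r, (frontier (A r))ᶜ) := dense_iInter_of_isOpen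
    (fun r => isClosed_frontier.isOpen_compl) fun r => by
      rw [← interior_eq_empty_iff_dense_compl]
      rw [← frontier_compl]
      exact interior_frontier (hAo r).isClosed_compl
  obtain ⟨x, hxV, hx⟩ := hd.inter_open_nonempty V hV hne
  refine ⟨x, hxV, ?_⟩
  rw [ContinuousAt, tendsto_order]
  refine ⟨fun l hl => ?_, fun r hr => hτ x hxV r hr⟩
  obtain ⟨r, hlr, hrx⟩ := exists_rat_btwn hl
  have h1 : x ∉ closure (A r) := fun h => mem_iInter.1 hx r
    ⟨h, fun h' => absurd (interior_subset h').2 (not_lt.2 hrx.le)⟩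
  filter_upwards [isClosed_closure.isOpen_compl.mem_nhds h1, hV.mem_nhds hxV] with z hz hzV
  by_contra h
  exact hz (subset_closure ⟨hzV, (not_lt.1 h).trans_lt hlr⟩)

end Semicontinuity

/-! ### The linear algebra of the energy condition. -/

section Contraction

variable {E E' : Type*} [NormedAddCommGroup E] [NormedSpace ℝ E] [NormedAddCommGroup E']
  [NormedSpace ℝ E']

/-- Pulling `α` and `β` back to `E' × ℝ` gives forms of top degree. Such forms agree as soon as
their contractions with `(0, 1)` agree on `E'`. -/
theorem contraction_eq_iff {n : ℕ} [FiniteDimensional ℝ E'] (hd : Module.finrank ℝ E' = n)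
    {α β : E [⋀^Fin (n + 1)]→L[ℝ] ℝ} {f g : E' →L[ℝ] E} {X Y : E} :
    (∀ w : Fin n → E', α (Matrix.vecCons X fun i => f (w i)) =
      β (Matrix.vecCons Y fun i => g (w i))) ↔
    ∀ q : Fin (n + 1) → E' × ℝ, α (fun i => f (q i).1 + (q i).2 • X) =
      β (fun i => g (q i).1 + (q i).2 • Y) := by
  have key : ∀ (f : E' →L[ℝ] E) (X : E) (w : Fin n → E'),
      (fun i => f ((Matrix.vecCons ((0 : E'), (1 : ℝ)) fun i => (w i, 0)) i).1 +
        ((Matrix.vecCons ((0 : E'), (1 : ℝ)) fun i => (w i, 0)) i).2 • X) =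
      Matrix.vecCons X fun i => f (w i) := fun f X w => by
    funext i
    refine Fin.cases ?_ (fun j => ?_) i <;> simp
  refine ⟨fun h => ?_, fun h w => ?_⟩
  · have := alternatingMap_ext_prod hd
      (f := α.toAlternatingMap.compLinearMap
        ((f : E' →ₗ[ℝ] E).coprod (LinearMap.toSpanSingleton ℝ E X)))
      (g := β.toAlternatingMap.compLinearMap
        ((g : E' →ₗ[ℝ] E).coprod (LinearMap.toSpanSingleton ℝ E Y))) fun w => by
        refine Eq.trans (congrArg α (key f X w)) ((h w).trans (congrArg β (key g Y w)).symm)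
    exact fun q => congrArg (fun A => A q) this
  · have := h (Matrix.vecCons (0, 1) fun i => (w i, 0))
    rwa [key, key] at this

end Contraction

/-! ### Hitting times and hitting points along a flow. -/

section Sections

variable {E : Type*} [NormedAddCommGroup E] [NormedSpace ℝ E]
  {M : Type*} [TopologicalSpace M] [ChartedSpace E M]
  {E' : Type*} [NormedAddCommGroup E'] [NormedSpace ℝ E']
  {S : Set M} [ChartedSpace E' S]

/-- The map `p` and the time `s₀ - h` describe how the trajectories of the flow `Φ` that start near
`z₀` hit the hypersurface `S` at times near `s₀`. -/
structure IsSectionAt (E E' : Type*) [NormedAddCommGroup E] [NormedSpace ℝ E]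
    [NormedAddCommGroup E'] [NormedSpace ℝ E'] [ChartedSpace E M] [ChartedSpace E' S]
    (Φ : ℝ × M → M) (s₀ : ℝ) (z₀ : M) (h : M → ℝ) (p : M → S) : Prop where
  zero : h z₀ = 0
  smooth_time : ∀ᶠ z in 𝓝 z₀, ContMDiffAt 𝓘(ℝ, E) 𝓘(ℝ, ℝ) ∞ h z
  smooth_point : ∀ᶠ z in 𝓝 z₀, ContMDiffAt 𝓘(ℝ, E) 𝓘(ℝ, E') ∞ p z
  hit : ∀ᶠ z in 𝓝 z₀, Φ (s₀ - h z, z) = p z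
  unique : ∀ᶠ q in 𝓝 (s₀, z₀), Φ q ∈ S → q.1 = s₀ - h q.2

variable {X : (x : M) → TangentSpace 𝓘(ℝ, E) x} {Φ : ℝ × M → M} {a b s₀ : ℝ} {W : Set M} {z₀ : M}
  {h : M → ℝ} {p : M → S}

theorem IsSectionAt.apply_eq (hs : IsSectionAt E E' Φ s₀ z₀ h p) : Φ (s₀, z₀) = p z₀ := by
  have := hs.hit.self_of_nhds
  rwa [hs.zero, sub_zero] at this

/-- Differentiate `Φ (s₀ - h z, z) = p z` and solve for the differential of `Φ (s₀, ·)`. -/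
theorem IsSectionAt.mfderiv_eq (hs : IsSectionAt E E' Φ s₀ z₀ h p)
    (hι : ContMDiff 𝓘(ℝ, E') 𝓘(ℝ, E) ∞ (Subtype.val : S → M))
    (hΦ : IsFlowOn X Φ a b W) (hs₀ : s₀ ∈ Ioo a b) (hz₀ : z₀ ∈ W) (v : TangentSpace 𝓘(ℝ, E) z₀) :
    (mfderiv 𝓘(ℝ, E) 𝓘(ℝ, E) (fun z => Φ (s₀, z)) z₀ v : E) =
      ((mfderiv 𝓘(ℝ, E') 𝓘(ℝ, E) (Subtype.val : S → M) (p z₀)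
        (mfderiv 𝓘(ℝ, E) 𝓘(ℝ, E') p z₀ v) + differential (F := E) h z₀ v • X (p z₀) :
        TangentSpace 𝓘(ℝ, E) (p z₀ : M)) : E) := by
  have hh := hs.smooth_time.self_of_nhds.mdifferentiableAt (by simp : (∞ : WithTop ℕ∞) ≠ 0)
  have hp := hs.smooth_point.self_of_nhds.mdifferentiableAt (by simp : (∞ : WithTop ℕ∞) ≠ 0)
  have hg : HasMFDerivAt 𝓘(ℝ, E) 𝓘(ℝ, ℝ) (fun z => s₀ - h z) z₀ (-differential (F := E) h z₀) := by
    have h1 : HasMFDerivAt 𝓘(ℝ, ℝ) 𝓘(ℝ, ℝ) (fun r : ℝ => s₀ - r) (h z₀)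
        (-ContinuousLinearMap.id ℝ ℝ) := ((hasFDerivAt_id (h z₀)).const_sub s₀).hasMFDerivAt
    refine (HasMFDerivAt.comp z₀ h1 hh.hasMFDerivAt).congr_mfderiv ?_
    ext v
    rfl
  have h1 := hΦ.mfderiv_comp (F := E) (g := fun z => s₀ - h z) (q := id) (x := z₀)
    hg.mdifferentiableAt mdifferentiableAt_id (by simpa only [hs.zero, sub_zero] using hs₀) hz₀ v
  have h2 : (fun z => Φ (s₀ - h z, id z)) =ᶠ[𝓝 z₀] Subtype.val ∘ p := hs.hit
  rw [h2.mfderiv_eq, mfderiv_comp z₀ (hι.mdifferentiableAt (by simp)) hp] at h1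
  have h3 : differential (F := E) (fun z => s₀ - h z) z₀ v = -differential (F := E) h z₀ v :=
    congrArg (fun A : E →L[ℝ] ℝ => A v) hg.mfderiv
  rw [h3, mfderiv_id] at h1
  have h4 : ∀ r : ℝ, r = s₀ → ∀ z : M, z = p z₀ →
      mfderiv 𝓘(ℝ, E') 𝓘(ℝ, E) (Subtype.val : S → M) (p z₀) (mfderiv 𝓘(ℝ, E) 𝓘(ℝ, E') p z₀ v) =
      @HAdd.hAdd E E E _ ((-differential (F := E) h z₀ v) • X z)
        (mfderiv 𝓘(ℝ, E) 𝓘(ℝ, E) (fun z => Φ (r, z)) z₀ v) →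
      (mfderiv 𝓘(ℝ, E) 𝓘(ℝ, E) (fun z => Φ (s₀, z)) z₀ v : E) =
      ((mfderiv 𝓘(ℝ, E') 𝓘(ℝ, E) (Subtype.val : S → M) (p z₀)
        (mfderiv 𝓘(ℝ, E) 𝓘(ℝ, E') p z₀ v) + differential (F := E) h z₀ v • X (p z₀) :
        TangentSpace 𝓘(ℝ, E) (p z₀ : M)) : E) := by
    rintro r rfl z rfl h5
    set A : E := mfderiv 𝓘(ℝ, E') 𝓘(ℝ, E) (Subtype.val : S → M) (p z₀)
      (mfderiv 𝓘(ℝ, E) 𝓘(ℝ, E') p z₀ v)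
    set Y : E := X (p z₀)
    change _ = A + differential (F := E) h z₀ v • Y
    change A = -differential (F := E) h z₀ v • Y + _ at h5
    rw [h5, neg_smul]
    abel
  exact h4 (s₀ - h z₀) (by rw [hs.zero, sub_zero]) _ hs.hit.self_of_nhds h1

variable [IsManifold 𝓘(ℝ, E) ∞ M] [T2Space M]

/-- Along a section, the differentials of the time and of the point are the ones of a projection. -/
theorem IsSectionAt.differential_field
    (hX : ContMDiff 𝓘(ℝ, E) 𝓘(ℝ, E).tangent ∞ (fun x => (⟨x, X x⟩ : TangentBundle 𝓘(ℝ, E) M)))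
    (hs : IsSectionAt E E' Φ s₀ z₀ h p)
    (hι : ContMDiff 𝓘(ℝ, E') 𝓘(ℝ, E) ∞ (Subtype.val : S → M)) (ht : IsTransverse E' S X)
    (hΦ : IsFlowOn X Φ a b W) (hs₀ : s₀ ∈ Ioo a b) (hz₀ : z₀ ∈ W) :
    mfderiv 𝓘(ℝ, E) 𝓘(ℝ, E') p z₀ (X z₀) = 0 ∧ differential (F := E) h z₀ (X z₀) = 1 := by
  have h1 := hs.mfderiv_eq hι hΦ hs₀ hz₀ (X z₀)
  have h2 := hΦ.mfderiv_field hX hs₀ hz₀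
  have key : ∀ z : M, z = p z₀ → (X z : E) = X (p z₀ : M) := by
    rintro z rfl
    rfl
  have h3 := (h1.symm.trans h2).trans (key _ hs.apply_eq)
  -- Both pairs are coordinates of `X (p z₀)` in the splitting into the tangent space of `S` and the
  -- line of `X`.
  have h4 := (ht (p z₀)).1 (a₁ := (mfderiv 𝓘(ℝ, E) 𝓘(ℝ, E') p z₀ (X z₀),
    differential (F := E) h z₀ (X z₀))) (a₂ := (0, 1)) (by
      refine h3.trans ?_
      have h5 := (mfderiv 𝓘(ℝ, E') 𝓘(ℝ, E) (Subtype.val : S → M) (p z₀)).map_zero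
      have h6 : @HAdd.hAdd E E E _
          (mfderiv 𝓘(ℝ, E') 𝓘(ℝ, E) (Subtype.val : S → M) (p z₀) 0) ((1 : ℝ) • X (p z₀)) =
          X (p z₀) := by
        rw [one_smul]
        exact (congrArg (fun z : E => @HAdd.hAdd E E E _ z (X (p z₀))) h5).trans (zero_add _)
      exact h6.symm)
  exact ⟨congrArg Prod.fst h4, congrArg Prod.snd h4⟩

/-- The flow box at the point `Φ (s₀, z₀)` of `S` is transported back by `Φ (s₀, ·)`; the group law
turns its flow times into times near `s₀`. -/
theorem exists_isSectionAt [IsManifold 𝓘(ℝ, E') ∞ S] [FiniteDimensional ℝ E]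
    [FiniteDimensional ℝ E']
    (hX : ContMDiff 𝓘(ℝ, E) 𝓘(ℝ, E).tangent ∞ (fun x => (⟨x, X x⟩ : TangentBundle 𝓘(ℝ, E) M)))
    (hι : ContMDiff 𝓘(ℝ, E') 𝓘(ℝ, E) ∞ (Subtype.val : S → M)) (ht : IsTransverse E' S X)
    (hΦ : IsFlowOn X Φ a b W) (hs₀ : s₀ ∈ Ioo a b) (hz₀ : z₀ ∈ W) (hS : Φ (s₀, z₀) ∈ S) :
    ∃ (h : M → ℝ) (p : M → S), IsSectionAt E E' Φ s₀ z₀ h p := by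
  obtain ⟨ε, hε, W', hW', Ψ, hΨ⟩ := exists_isFlowOn hX (Φ (s₀, z₀))
  obtain ⟨h, p, h0, -, hhp, hu⟩ := exists_flowBox hX hι ht hΨ (y := ⟨Φ (s₀, z₀), hS⟩) hW'
  simp only at h0 hhp hu
  have hc : ContinuousAt Φ (s₀, z₀) := (hΦ.contMDiffAt hs₀ hz₀).continuousAt
  have hcr : ContinuousAt (fun z => Φ (s₀, z)) z₀ := (hΦ.contMDiffAt_right hs₀ hz₀).continuousAt
  have hev : ∀ᶠ z in 𝓝 z₀, z ∈ W ∧ Φ (s₀, z) ∈ W' :=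
    Filter.Eventually.and (hΦ.isOpen.mem_nhds hz₀) (hcr.eventually (hΨ.isOpen.mem_nhds hW'))
  have hhp' := hcr.eventually hhp
  have hadd : ∀ z ∈ W, Φ (s₀, z) ∈ W' → ∀ r ∈ Ioo (-ε) ε, r + s₀ ∈ Ioo a b →
      Ψ (r, Φ (s₀, z)) = Φ (r + s₀, z) := fun z hz hz' r hr hr' =>
    hΨ.add hX hΦ hs₀ hz hz' hr hr'
  refine ⟨fun z => h (Φ (s₀, z)), fun z => p (Φ (s₀, z)), h0, ?_, ?_, ?_, ?_⟩
  · filter_upwards [hev, hhp'] with z hz hz'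
    exact ContMDiffAt.comp (g := h) z hz'.1 (hΦ.contMDiffAt_right hs₀ hz.1)
  · filter_upwards [hev, hhp'] with z hz hz'
    exact ContMDiffAt.comp (g := p) z hz'.2.1 (hΦ.contMDiffAt_right hs₀ hz.1)
  · have hhc : ContinuousAt (fun z => h (Φ (s₀, z))) z₀ :=
      ContinuousAt.comp (g := h) (x := z₀) hhp.self_of_nhds.1.continuousAt hcr
    have h1 : ∀ᶠ z in 𝓝 z₀, -h (Φ (s₀, z)) ∈ Ioo (-ε) ε :=
      hhc.neg.eventually (isOpen_Ioo.mem_nhds (by simpa [h0] using hε))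
    have h2 : ∀ᶠ z in 𝓝 z₀, -h (Φ (s₀, z)) + s₀ ∈ Ioo a b :=
      (hhc.neg.add_const s₀).eventually (isOpen_Ioo.mem_nhds (by simpa [h0] using hs₀))
    filter_upwards [hev, hhp', h1, h2] with z hz hz' hz1 hz2
    rw [← hz'.2.2, hadd z hz.1 hz.2 _ hz1 hz2, neg_add_eq_sub]
  · have h1 : ContinuousAt (fun q : ℝ × M => (q.1 - s₀, Φ (s₀, q.2))) (s₀, z₀) :=
      (continuousAt_fst.sub continuousAt_const).prodMk
        (ContinuousAt.comp (g := fun z => Φ (s₀, z)) (x := (s₀, z₀)) hcr continuousAt_snd)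
    have h2 := h1.eventually (by simpa only [sub_self] using hu)
    have h3 : ∀ᶠ q in 𝓝 (s₀, z₀), q.1 - s₀ ∈ Ioo (-ε) ε :=
      h1.fst.eventually (isOpen_Ioo.mem_nhds (by simpa using hε))
    filter_upwards [h2, h3, continuousAt_fst.eventually (isOpen_Ioo.mem_nhds hs₀),
      continuousAt_snd.eventually hev] with q hq hq3 hq4 hq5 hqS
    have h4 := hadd q.2 hq5.1 hq5.2 _ hq3 (by simpa using hq4)
    rw [sub_add_cancel] at h4
    have h5 := hq (by rw [h4]; exact hqS)
    linarith

end Sections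

/-! ### Trajectories of the hybrid system, impact counts and persistence of hits. -/

namespace HybridSystem

variable {n : ℕ} {M : Type*} [TopologicalSpace M] [ChartedSpace (EuclideanSpace ℝ (Fin (n + 1))) M]
  [IsManifold (𝓡 (n + 1)) ∞ M]
  {S : Set M} [ChartedSpace (EuclideanSpace ℝ (Fin n)) S]
  {𝓗 : HybridSystem n M S}

/-- The point `z` is reached from `x` in time `t` along the continuous dynamics, without meeting `S`
before the time `t`. -/
def Glide (𝓗 : HybridSystem n M S) (t : ℝ) (x z : M) : Prop :=
  0 ≤ t ∧ ∃ γ : ℝ → M, IsMIntegralCurveOn (I := 𝓡 (n + 1)) γ 𝓗.X (Icc 0 t) ∧ γ 0 = x ∧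
    (∀ s ∈ Ico 0 t, γ s ∉ S) ∧ γ t = z

/-- The integral curve through `x` is in `S` at the time `t`. -/
def Hits (𝓗 : HybridSystem n M S) (x : M) (t : ℝ) : Prop :=
  ∃ γ : ℝ → M, IsMIntegralCurveOn (I := 𝓡 (n + 1)) γ 𝓗.X (Icc 0 t) ∧ γ 0 = x ∧ γ t ∈ S

/-- The hybrid flow with a prescribed number of impacts. -/
def FlowCount (𝓗 : HybridSystem n M S) : ℕ → ℝ → M → M → Prop
  | 0, t, x, z => 𝓗.Glide t x z
  | k + 1, t, x, z => ∃ (t₁ : ℝ) (y : S), 𝓗.Glide t₁ x y ∧ t₁ < t ∧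
      FlowCount 𝓗 k (t - t₁) (𝓗.reset y) z

theorem Glide.flow {t : ℝ} {x z : M} (h : 𝓗.Glide t x z) : 𝓗.Flow t x z := by
  obtain ⟨ht, γ, hγ, h0, hS, rfl⟩ := h
  exact .glide ht hγ h0 hS

theorem Glide.flow_impact {t₁ t₂ : ℝ} {x z : M} {y : S} (h : 𝓗.Glide t₁ x y) (ht₂ : 0 < t₂)
    (hz : 𝓗.Flow t₂ (𝓗.reset y) z) : 𝓗.Flow (t₁ + t₂) x z := by
  obtain ⟨ht, γ, hγ, h0, hS, hy⟩ := h
  exact .impact ht ht₂ hγ h0 hS hy hz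

theorem Flow.exists_flowCount {t : ℝ} {x z : M} (h : 𝓗.Flow t x z) : ∃ k, 𝓗.FlowCount k t x z := by
  induction h with
  | glide ht hγ h0 hS => exact ⟨0, ht, _, hγ, h0, hS, rfl⟩
  | @impact t₁ t₂ x z γ y ht₁ ht₂ hγ h0 hS hy hz ih =>
    obtain ⟨k, hk⟩ := ih
    refine ⟨k + 1, t₁, y, ⟨ht₁, γ, hγ, h0, hS, hy⟩, by linarith, ?_⟩
    rwa [add_sub_cancel_left]

theorem Glide.hits {t : ℝ} {x z : M} (h : 𝓗.Glide t x z) (hz : z ∈ S) : 𝓗.Hits x t := by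
  obtain ⟨-, γ, hγ, h0, -, rfl⟩ := h
  exact ⟨γ, hγ, h0, hz⟩

theorem reset_notMem (y : S) : 𝓗.reset y ∉ S := fun h =>
  (𝓗.disjoint_reset ▸ ⟨h, mem_range_self y⟩ : 𝓗.reset y ∈ (∅ : Set M))

theorem IsSmooth.isTransverse (h𝓗 : 𝓗.IsSmooth) :
    IsTransverse (EuclideanSpace ℝ (Fin n)) S 𝓗.X := fun y =>
  bijective_of_isCompl (E := EuclideanSpace ℝ (Fin (n + 1))) (E' := EuclideanSpace ℝ (Fin n))
    _ _ (by simp) (h𝓗.transverse y)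

theorem Glide.pos {t : ℝ} {x : M} {y : S} (h : 𝓗.Glide t x y) (hx : x ∉ S) : 0 < t := by
  obtain ⟨ht, γ, hγ, h0, hS, hy⟩ := h
  rcases ht.eq_or_lt with rfl | ht
  · exact absurd (h0 ▸ hy ▸ y.2) hx
  · exact ht

theorem _root_.Hybrid.IsFlowOn.hits {Φ : ℝ × M → M} {a b : ℝ} {W : Set M}
    (hΦ : IsFlowOn 𝓗.X Φ a b W) {s : ℝ} {x : M} (hs : s ∈ Ioo a b) (hx : x ∈ W)
    (hS : Φ (s, x) ∈ S) : 𝓗.Hits x s :=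
  ⟨fun r => Φ (r, x), (hΦ.curve x hx).mono fun _ hr =>
    ⟨hΦ.lt_zero.trans_le hr.1, hr.2.trans_lt hs.2⟩, hΦ.zero x hx, hS⟩

variable [T2Space M]

theorem Glide.eq_of_curve {s t : ℝ} {x z : M} (h : 𝓗.Glide t x z) {γ : ℝ → M}
    (hγ : IsMIntegralCurveOn (I := 𝓡 (n + 1)) γ 𝓗.X (Icc 0 s)) (h0 : γ 0 = x) (hts : t ≤ s) :
    γ t = z := by
  obtain ⟨ht, δ, hδ, hδ0, -, rfl⟩ := h
  exact eqOn_Icc_of_isMIntegralCurveOn 𝓗.smooth_X (hγ.mono (Icc_subset_Icc le_rfl hts)) hδ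
    (h0.trans hδ0.symm) ⟨ht, le_rfl⟩

theorem Glide.le_of_hits {s t : ℝ} {x z : M} (h : 𝓗.Glide t x z) (hs : 𝓗.Hits x s) (h0s : 0 ≤ s) :
    t ≤ s := by
  obtain ⟨ht, δ, hδ, hδ0, hS, -⟩ := h
  obtain ⟨γ, hγ, h0, hγS⟩ := hs
  by_contra! hst
  refine hS s ⟨h0s, hst⟩ ?_
  rwa [eqOn_Icc_of_isMIntegralCurveOn 𝓗.smooth_X (hδ.mono (Icc_subset_Icc le_rfl hst.le)) hγ
    (hδ0.trans h0.symm) ⟨h0s, le_rfl⟩]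

theorem Glide.unique {s t : ℝ} {x : M} {y z : S} (h : 𝓗.Glide t x y) (h' : 𝓗.Glide s x z) :
    t = s ∧ y = z := by
  have hts : t = s := le_antisymm (h.le_of_hits (h'.hits z.2) h'.1) (h'.le_of_hits (h.hits y.2) h.1)
  subst hts
  obtain ⟨-, γ, hγ, h0, -, hz⟩ := h'
  exact ⟨rfl, Subtype.ext ((h.eq_of_curve hγ h0 le_rfl).symm.trans hz)⟩

/-- A flow along a trajectory. -/
theorem exists_isFlowOn_of_integralCurve {t : ℝ} (ht : 0 ≤ t) {γ : ℝ → M}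
    (hγ : IsMIntegralCurveOn (I := 𝓡 (n + 1)) γ 𝓗.X (Icc 0 t)) :
    ∃ ε > 0, ∃ W, γ 0 ∈ W ∧ ∃ Φ, IsFlowOn 𝓗.X Φ (-ε) (t + ε) W ∧ Φ (t, γ 0) = γ t := by
  obtain ⟨ε, hε, W, hW, Φ, hΦ⟩ := exists_isFlowOn_of_curve 𝓗.smooth_X ht hγ
  refine ⟨ε, hε, W, hW, Φ, hΦ, ?_⟩
  exact eqOn_Icc_of_isMIntegralCurveOn 𝓗.smooth_X
    ((hΦ.curve _ hW).mono (Icc_subset_Ioo (by linarith) (by linarith))) hγ (hΦ.zero _ hW)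
    ⟨ht, le_rfl⟩

theorem _root_.Hybrid.IsFlowOn.eq_of_glide {Φ : ℝ × M → M} {a b : ℝ} {W : Set M}
    (hΦ : IsFlowOn 𝓗.X Φ a b W) {s : ℝ} {x z : M} (h : 𝓗.Glide s x z) (hs : s < b) (hx : x ∈ W) :
    Φ (s, x) = z :=
  h.eq_of_curve ((hΦ.curve x hx).mono fun _ hr => ⟨hΦ.lt_zero.trans_le hr.1, hr.2.trans_lt hs⟩)
    (hΦ.zero x hx) le_rfl

variable [IsManifold (𝓡 n) ∞ S]

/-- Hits persist. -/
theorem Hits.eventually (h𝓗 : 𝓗.IsSmooth) {x : M} {s : ℝ} (hx : 𝓗.Hits x s) (hs : 0 ≤ s) {a b : ℝ}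
    (hab : s ∈ Ioo a b) : ∀ᶠ z in 𝓝 x, ∃ s' ∈ Ioo a b, 𝓗.Hits z s' := by
  obtain ⟨γ, hγ, rfl, hS⟩ := hx
  obtain ⟨ε, hε, W, hW, Φ, hΦ, hΦs⟩ := exists_isFlowOn_of_integralCurve hs hγ
  have hsm : s ∈ Ioo (-ε) (s + ε) := ⟨by linarith, by linarith⟩
  obtain ⟨h, p, hp⟩ := exists_isSectionAt (E' := EuclideanSpace ℝ (Fin n)) 𝓗.smooth_X
    𝓗.isSmoothEmbedding.contMDiff h𝓗.isTransverse hΦ hsm hW (by rwa [hΦs])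
  have hc : ContinuousAt (fun z => s - h z) (γ 0) :=
    continuousAt_const.sub hp.smooth_time.self_of_nhds.continuousAt
  have h1 : ∀ᶠ z in 𝓝 (γ 0), s - h z ∈ Ioo (-ε) (s + ε) ∩ Ioo a b :=
    hc.eventually ((isOpen_Ioo.inter isOpen_Ioo).mem_nhds
      (by simpa only [hp.zero, sub_zero] using ⟨hsm, hab⟩))
  filter_upwards [h1, hΦ.isOpen.mem_nhds hW, hp.hit] with z hz hzW hz'
  exact ⟨s - h z, hz.2, hΦ.hits hz.1 hzW (by rw [hz']; exact (p z).2)⟩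

/-- A parametrized family of hits: where the hitting time is continuous, time and point of the first
hit are given by a section. -/
theorem exists_section_of_glide (h𝓗 : 𝓗.IsSmooth) {q : M → M} {τ : M → ℝ} {y : M → S} {x₀ : M}
    (hq : ContinuousAt q x₀) (hτ : ContinuousAt τ x₀)
    (hg : ∀ᶠ x in 𝓝 x₀, 𝓗.Glide (τ x) (q x) (y x)) :
    ∃ ε > 0, ∃ W, q x₀ ∈ W ∧ ∃ Φ, IsFlowOn 𝓗.X Φ (-ε) (τ x₀ + ε) W ∧ ∃ h p,
      IsSectionAt (EuclideanSpace ℝ (Fin (n + 1))) (EuclideanSpace ℝ (Fin n)) Φ (τ x₀) (q x₀) h p ∧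
      (∀ᶠ x in 𝓝 x₀, τ x = τ x₀ - h (q x)) ∧ ∀ᶠ x in 𝓝 x₀, y x = p (q x) := by
  obtain ⟨hτ0, γ, hγ, h0, -, hy⟩ := hg.self_of_nhds
  obtain ⟨ε, hε, W, hW, Φ, hΦ, hΦs⟩ := exists_isFlowOn_of_integralCurve hτ0 hγ
  rw [h0] at hW hΦs
  obtain ⟨h, p, hp⟩ := exists_isSectionAt (E' := EuclideanSpace ℝ (Fin n)) 𝓗.smooth_X
    𝓗.isSmoothEmbedding.contMDiff h𝓗.isTransverse (s₀ := τ x₀) hΦ ⟨by linarith, by linarith⟩ hW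
    (by rw [hΦs, hy]; exact (y x₀).2)
  have h1 : ∀ᶠ x in 𝓝 x₀, τ x = τ x₀ - h (q x) ∧ Φ (τ x, q x) = y x := by
    filter_upwards [hg, (hτ.prodMk hq).eventually hp.unique,
      hτ.eventually (gt_mem_nhds (by linarith : τ x₀ < τ x₀ + ε)),
      hq.eventually (hΦ.isOpen.mem_nhds hW)] with x hx hx1 hx2 hx3
    have h2 := hΦ.eq_of_glide hx hx2 hx3
    exact ⟨hx1 (by rw [h2]; exact (y x).2), h2⟩
  refine ⟨ε, hε, W, hW, Φ, hΦ, h, p, hp, h1.mono fun x hx => hx.1, ?_⟩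
  filter_upwards [h1, hq.eventually hp.hit] with x hx hx'
  rw [← hx.1, hx.2] at hx'
  exact Subtype.ext hx'

end HybridSystem

/-! ### Families of states that preserve the form. -/

namespace HybridSystem

variable {n : ℕ} {M : Type*} [TopologicalSpace M] [ChartedSpace (EuclideanSpace ℝ (Fin (n + 1))) M]
  [IsManifold (𝓡 (n + 1)) ∞ M]
  {S : Set M} [ChartedSpace (EuclideanSpace ℝ (Fin n)) S]
  {𝓗 : HybridSystem n M S} {μ : Form (𝓡 (n + 1)) M (n + 1)}

theorem differential_const_sub {M : Type*} [TopologicalSpace M]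
    [ChartedSpace (EuclideanSpace ℝ (Fin (n + 1))) M] {f : M → ℝ} {x : M}
    (hf : MDifferentiableAt (𝓡 (n + 1)) 𝓘(ℝ, ℝ) f x)
    (c : ℝ) : MDifferentiableAt (𝓡 (n + 1)) 𝓘(ℝ, ℝ) (fun z => c - f z) x ∧
      differential (F := EuclideanSpace ℝ (Fin (n + 1))) (fun z => c - f z) x =
        -differential (F := EuclideanSpace ℝ (Fin (n + 1))) f x := by
  have hg : HasMFDerivAt (𝓡 (n + 1)) 𝓘(ℝ, ℝ) (fun z => c - f z) x
      (-differential (F := EuclideanSpace ℝ (Fin (n + 1))) f x) := by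
    have h1 : HasMFDerivAt 𝓘(ℝ, ℝ) 𝓘(ℝ, ℝ) (fun r : ℝ => c - r) (f x)
        (-ContinuousLinearMap.id ℝ ℝ) := ((hasFDerivAt_id (f x)).const_sub c).hasMFDerivAt
    refine (HasMFDerivAt.comp x h1 hf.hasMFDerivAt).congr_mfderiv ?_
    ext v
    rfl
  exact ⟨hg.mdifferentiableAt, hg.mfderiv⟩

/-- The energy condition at `y` says that `(w, r) ↦ Δ'w + r X` and `(w, r) ↦ ι'w + r X` pull `μ`
back to the same form on `T_y S × ℝ`. -/
theorem energy_iff (y : S) :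
    𝓗.resetForm (interiorProduct (𝓡 (n + 1)) 𝓗.X μ) y =
      restrictForm (interiorProduct (𝓡 (n + 1)) 𝓗.X μ) y ↔
    ∀ v : Fin (n + 1) → EuclideanSpace ℝ (Fin n) × ℝ,
      μ (𝓗.reset y) (fun i => mfderiv (𝓡 n) (𝓡 (n + 1)) 𝓗.reset y (v i).1 +
        (v i).2 • 𝓗.X (𝓗.reset y)) =
      μ y (fun i => mfderiv (𝓡 n) (𝓡 (n + 1)) (Subtype.val : S → M) y (v i).1 +
        (v i).2 • 𝓗.X y) := by
  refine Iff.trans ⟨fun h w => congrArg (fun β => β w) h, fun h => ContinuousAlternatingMap.ext h⟩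
    (contraction_eq_iff (E := EuclideanSpace ℝ (Fin (n + 1))) (E' := EuclideanSpace ℝ (Fin n))
      (by simp) (α := μ (𝓗.reset y)) (β := μ y) (f := mfderiv (𝓡 n) (𝓡 (n + 1)) 𝓗.reset y)
      (g := mfderiv (𝓡 n) (𝓡 (n + 1)) (Subtype.val : S → M) y) (X := 𝓗.X (𝓗.reset y))
      (Y := 𝓗.X y))

/-- The pullback of the form under the flow up to the impact, if the energy condition holds. -/
theorem pullback_section {Φ : ℝ × M → M} {a b s₀ : ℝ} {W : Set M} {z₀ : M} {h : M → ℝ} {p : M → S}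
    (hE : 𝓗.EnergyCondition μ) (hΦ : IsFlowOn 𝓗.X Φ a b W) (hs₀ : s₀ ∈ Ioo a b) (hz₀ : z₀ ∈ W)
    (hs : IsSectionAt (EuclideanSpace ℝ (Fin (n + 1))) (EuclideanSpace ℝ (Fin n)) Φ s₀ z₀ h p)
    (v : Fin (n + 1) → TangentSpace (𝓡 (n + 1)) z₀) :
    μ (𝓗.reset (p z₀)) (fun i => mfderiv (𝓡 n) (𝓡 (n + 1)) 𝓗.reset (p z₀)
      (mfderiv (𝓡 (n + 1)) (𝓡 n) p z₀ (v i)) +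
      differential (F := EuclideanSpace ℝ (Fin (n + 1))) h z₀ (v i) • 𝓗.X (𝓗.reset (p z₀))) =
    pullback (𝓡 (n + 1)) (𝓡 (n + 1)) (fun z => Φ (s₀, z)) μ z₀ v := by
  have h1 := (energy_iff (p z₀)).1 (congrFun hE (p z₀)) fun i =>
    (mfderiv (𝓡 (n + 1)) (𝓡 n) p z₀ (v i),
      differential (F := EuclideanSpace ℝ (Fin (n + 1))) h z₀ (v i))
  refine h1.trans ?_
  have key : ∀ z : M, z = p z₀ → ∀ w : Fin (n + 1) → EuclideanSpace ℝ (Fin (n + 1)),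
      μ (p z₀) w = μ z w := by
    rintro z rfl w
    rfl
  refine Eq.trans ?_ (key _ hs.apply_eq _)
  exact congrArg (μ (p z₀)) (funext fun i =>
    (hs.mfderiv_eq 𝓗.isSmoothEmbedding.contMDiff hΦ hs₀ hz₀ (v i)).symm)

/-- `q` is the state, at the time `T`, of a family of trajectories of the hybrid flow. Every flow
`x ↦ Φ (t - T x, q x)` preserves the form `μ` at `x`. -/
structure IsState (𝓗 : HybridSystem n M S) (μ : Form (𝓡 (n + 1)) M (n + 1)) (T : M → ℝ) (q : M → M)
    (x : M) : Prop where
  smooth_time : ContMDiffAt (𝓡 (n + 1)) 𝓘(ℝ, ℝ) ∞ T x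
  smooth_point : ContMDiffAt (𝓡 (n + 1)) (𝓡 (n + 1)) ∞ q x
  notMem : q x ∉ S
  form : ∀ v : Fin (n + 1) → TangentSpace (𝓡 (n + 1)) x,
    μ (q x) (fun i => mfderiv (𝓡 (n + 1)) (𝓡 (n + 1)) q x (v i) -
      differential (F := EuclideanSpace ℝ (Fin (n + 1))) T x (v i) • 𝓗.X (q x)) = μ x v

theorem isState_id {x : M} (hx : x ∉ S) : 𝓗.IsState μ (fun _ => 0) id x where
  smooth_time := contMDiffAt_const
  smooth_point := contMDiffAt_id
  notMem := hx
  form v := by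
    refine congrArg (μ x) (funext fun i => ?_)
    simp only [differential, mfderiv_const, mfderiv_id]
    refine (congrArg (fun z : EuclideanSpace ℝ (Fin (n + 1)) => @HSub.hSub
      (EuclideanSpace ℝ (Fin (n + 1))) _ _ _ (v i) z) (zero_smul ℝ (𝓗.X x))).trans (sub_zero _)

variable [T2Space M]

/-- The flow of a state preserves the form. -/
theorem IsState.pullback_eq (hμ : IsSmoothForm (𝓡 (n + 1)) μ)
    (hL : ∀ x, lieDeriv (𝓡 (n + 1)) 𝓗.X μ x = 0) {T : M → ℝ} {q : M → M} {x₀ : M}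
    (hs : 𝓗.IsState μ T q x₀) {t : ℝ} {f : M → M}
    (hf : ∀ᶠ x in 𝓝 x₀, 𝓗.Glide (t - T x) (q x) (f x)) :
    pullback (𝓡 (n + 1)) (𝓡 (n + 1)) f μ x₀ = μ x₀ := by
  obtain ⟨ht, γ, hγ, h0, -, -⟩ := hf.self_of_nhds
  obtain ⟨ε, hε, W, hW, Φ, hΦ, -⟩ := exists_isFlowOn_of_integralCurve ht hγ
  rw [h0] at hW
  have hTd := hs.smooth_time.mdifferentiableAt (by simp : (∞ : WithTop ℕ∞) ≠ 0)
  have hqd := hs.smooth_point.mdifferentiableAt (by simp : (∞ : WithTop ℕ∞) ≠ 0)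
  have hs₀ : t - T x₀ ∈ Ioo (-ε) (t - T x₀ + ε) := ⟨by linarith, by linarith⟩
  have hfe : f =ᶠ[𝓝 x₀] fun x => Φ (t - T x, q x) := by
    have h1 : ContinuousAt (fun x => t - T x) x₀ := continuousAt_const.sub hTd.continuousAt
    filter_upwards [hf, h1.eventually (isOpen_Ioo.mem_nhds hs₀),
      hqd.continuousAt.eventually (hΦ.isOpen.mem_nhds hW)] with x hx hx1 hx2
    exact (hΦ.eq_of_glide hx hx1.2 hx2).symm
  obtain ⟨h1, h2⟩ := differential_const_sub hTd t
  have h3 := hΦ.mfderiv_comp h1 hqd hs₀ hW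
  have h4 := hΦ.pullback_eq 𝓗.smooth_X hμ hL hs₀ hW
  have h5 : pullback (𝓡 (n + 1)) (𝓡 (n + 1)) f μ x₀ =
      pullback (𝓡 (n + 1)) (𝓡 (n + 1)) (fun x => Φ (t - T x, q x)) μ x₀ := by
    simp only [pullback, hfe.mfderiv_eq]
    rw [hfe.self_of_nhds]
  rw [h5]
  ext v
  rw [← hs.form v, ← h4]
  refine congrArg (μ (Φ (t - T x₀, q x₀))) (funext fun i => ?_)
  refine (h3 (v i)).trans ?_
  rw [h2]
  -- The flow carries `X` to `X`, so the differential of `f` is that of the flow map applied to `dq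
  -- - dT • X`, the combination in `IsState.form`.
  have h6 := hΦ.mfderiv_field 𝓗.smooth_X hs₀ hW
  rw [map_sub, map_smul]
  refine Eq.trans ?_ (congrArg (fun z =>
    _ - differential (F := EuclideanSpace ℝ (Fin (n + 1))) T x₀ (v i) • z) h6).symm
  have h7 : ∀ (c : ℝ) (A B : EuclideanSpace ℝ (Fin (n + 1))), -c • A + B = B - c • A :=
    fun c A B => by rw [neg_smul, neg_add_eq_sub]
  exact h7 _ _ _

variable [IsManifold (𝓡 n) ∞ S]

/-- An impact turns a state into a state. -/
theorem IsState.impact (h𝓗 : 𝓗.IsSmooth) (hμ : IsSmoothForm (𝓡 (n + 1)) μ)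
    (hL : ∀ x, lieDeriv (𝓡 (n + 1)) 𝓗.X μ x = 0) (hE : 𝓗.EnergyCondition μ) {T τ : M → ℝ}
    {q : M → M} {y : M → S} {x₀ : M} (hs : 𝓗.IsState μ T q x₀) (hτ : ContinuousAt τ x₀)
    (hg : ∀ᶠ x in 𝓝 x₀, 𝓗.Glide (τ x) (q x) (y x)) :
    𝓗.IsState μ (fun x => T x + τ x) (fun x => 𝓗.reset (y x)) x₀ := by
  obtain ⟨ε, hε, W, hW, Φ, hΦ, h, p, hp, hτe, hye⟩ :=
    exists_section_of_glide h𝓗 hs.smooth_point.continuousAt hτ hg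
  have hτ0 : 0 ≤ τ x₀ := hg.self_of_nhds.1
  have hs₀ : τ x₀ ∈ Ioo (-ε) (τ x₀ + ε) := ⟨by linarith, by linarith⟩
  have hhs := hp.smooth_time.self_of_nhds
  have hps := hp.smooth_point.self_of_nhds
  have hhd := hhs.mdifferentiableAt (by simp : (∞ : WithTop ℕ∞) ≠ 0)
  have hpd := hps.mdifferentiableAt (by simp : (∞ : WithTop ℕ∞) ≠ 0)
  have hTd := hs.smooth_time.mdifferentiableAt (by simp : (∞ : WithTop ℕ∞) ≠ 0)
  have hqd := hs.smooth_point.mdifferentiableAt (by simp : (∞ : WithTop ℕ∞) ≠ 0)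
  have hrd := (𝓗.smooth_reset.contMDiffAt (x := p (q x₀))).mdifferentiableAt
    (by simp : (∞ : WithTop ℕ∞) ≠ 0)
  have hTe : (fun x => T x + τ x) =ᶠ[𝓝 x₀] fun x => T x + (τ x₀ - h (q x)) :=
    hτe.mono fun x hx => congrArg (T x + ·) hx
  have hqe : (fun x => 𝓗.reset (y x)) =ᶠ[𝓝 x₀] 𝓗.reset ∘ p ∘ q :=
    hye.mono fun x hx => congrArg 𝓗.reset hx
  have hhq : ContMDiffAt (𝓡 (n + 1)) 𝓘(ℝ, ℝ) ∞ (fun x => h (q x)) x₀ :=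
    ContMDiffAt.comp (g := h) x₀ hhs hs.smooth_point
  refine ⟨?_, ?_, reset_notMem _, fun v => ?_⟩
  · exact (hs.smooth_time.add (contMDiffAt_const.sub hhq)).congr_of_eventuallyEq hTe
  · exact ((𝓗.smooth_reset.contMDiffAt.comp x₀ (ContMDiffAt.comp (g := p) x₀ hps
      hs.smooth_point))).congr_of_eventuallyEq hqe
  have hyx : y x₀ = p (q x₀) := hye.self_of_nhds
  have hdT : differential (F := EuclideanSpace ℝ (Fin (n + 1))) (fun x => T x + τ x) x₀ =
      differential (F := EuclideanSpace ℝ (Fin (n + 1))) T x₀ -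
      (differential (F := EuclideanSpace ℝ (Fin (n + 1))) h (q x₀)).comp
        (mfderiv (𝓡 (n + 1)) (𝓡 (n + 1)) q x₀) := by
    obtain ⟨h1, h2⟩ := differential_const_sub (hhq.mdifferentiableAt (by simp)) (τ x₀)
    have h3 : HasMFDerivAt (𝓡 (n + 1)) 𝓘(ℝ, ℝ) (fun x => τ x₀ - h (q x)) x₀
      (differential (F := EuclideanSpace ℝ (Fin (n + 1))) (fun x => τ x₀ - h (q x)) x₀) :=
      h1.hasMFDerivAt
    have h4 := (hTd.hasMFDerivAt.add h3).congr_of_eventuallyEq hTe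
    refine h4.mfderiv.trans ?_
    rw [h2, sub_eq_add_neg]
    have h5 := mfderiv_comp (g := h) x₀ hhd hqd
    exact congrArg (fun A : EuclideanSpace ℝ (Fin (n + 1)) →L[ℝ] ℝ =>
      @HAdd.hAdd (EuclideanSpace ℝ (Fin (n + 1)) →L[ℝ] ℝ) _ _ _
        (differential (F := EuclideanSpace ℝ (Fin (n + 1))) T x₀) (-A)) h5
  have hdq : mfderiv (𝓡 (n + 1)) (𝓡 (n + 1)) (fun x => 𝓗.reset (y x)) x₀ =
      (mfderiv (𝓡 n) (𝓡 (n + 1)) 𝓗.reset (p (q x₀)) ∘L mfderiv (𝓡 (n + 1)) (𝓡 n) p (q x₀)) ∘L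
        mfderiv (𝓡 (n + 1)) (𝓡 (n + 1)) q x₀ := by
    rw [hqe.mfderiv_eq, mfderiv_comp (g := 𝓗.reset) x₀ hrd (hpd.comp x₀ hqd),
      mfderiv_comp (g := p) x₀ hpd hqd]
    rfl
  obtain ⟨hpX, hhX⟩ := hp.differential_field 𝓗.smooth_X 𝓗.isSmoothEmbedding.contMDiff
    h𝓗.isTransverse hΦ hs₀ hW
  -- The arguments are `u = dq v - dT(v) X`. As `dp X = 0` and `dh X = 1`, the vector `Δ' dp u +
  -- dh(u) X` is the corresponding combination for the state after the impact, whose time is `T + τ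
  -- x₀ - h ∘ q` near `x₀`.
  have h1 := pullback_section hE hΦ hs₀ hW hp (fun i => mfderiv (𝓡 (n + 1)) (𝓡 (n + 1)) q x₀ (v i) -
      differential (F := EuclideanSpace ℝ (Fin (n + 1))) T x₀ (v i) • 𝓗.X (q x₀))
  rw [hΦ.pullback_eq 𝓗.smooth_X hμ hL hs₀ hW, hs.form v] at h1
  rw [← h1, hdT, hdq, hyx]
  refine congrArg (μ (𝓗.reset (p (q x₀)))) (funext fun i => ?_)
  simp only [map_sub, map_smul, hpX, hhX, smul_zero, sub_zero, smul_eq_mul, mul_one]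
  have h7 : ∀ (A Y : EuclideanSpace ℝ (Fin (n + 1))) (c d : ℝ),
      A - (c - d) • Y = A + (d - c) • Y := fun A Y c d => by
    rw [sub_eq_add_neg, ← neg_smul, neg_sub]
  exact h7 _ _ _ _

end HybridSystem

/-! ### The two conditions imply invariance. -/

theorem IsSmoothForm.continuousAt {E : Type*} [NormedAddCommGroup E] [NormedSpace ℝ E]
    {M : Type*} [TopologicalSpace M] [ChartedSpace E M] {k : ℕ} {α : Form 𝓘(ℝ, E) M k}
    (hα : IsSmoothForm 𝓘(ℝ, E) α) (x₀ : M) :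
    ContinuousAt (formInChart (E := E) 𝓘(ℝ, E) α x₀) (extChartAt 𝓘(ℝ, E) x₀ x₀) :=
  ((hα x₀).contDiffAt ((isOpen_extChartAt_target x₀).mem_nhds
    (mem_extChartAt_target x₀))).continuousAt

namespace HybridSystem

variable {n : ℕ} {M : Type*} [TopologicalSpace M] [ChartedSpace (EuclideanSpace ℝ (Fin (n + 1))) M]
  [IsManifold (𝓡 (n + 1)) ∞ M]
  {S : Set M} [ChartedSpace (EuclideanSpace ℝ (Fin n)) S]
  {𝓗 : HybridSystem n M S} {μ : Form (𝓡 (n + 1)) M (n + 1)} [T2Space M] [IsManifold (𝓡 n) ∞ S]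

/-- First hitting times are upper semicontinuous. -/
theorem eventually_glide_lt (h𝓗 : 𝓗.IsSmooth) {q : M → M} {τ : M → ℝ} {y : M → S} {x₀ : M}
    (hq : ContinuousAt q x₀) (hqS : q x₀ ∉ S) (hg : ∀ᶠ x in 𝓝 x₀, 𝓗.Glide (τ x) (q x) (y x)) {r : ℝ}
    (hr : τ x₀ < r) : ∀ᶠ x in 𝓝 x₀, τ x < r := by
  have hg0 := hg.self_of_nhds
  have h1 := (hg0.hits (y x₀).2).eventually h𝓗 hg0.1 (a := 0) (b := r) ⟨hg0.pos hqS, hr⟩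
  filter_upwards [hg, hq.eventually h1] with x hx hx'
  obtain ⟨s, hs, hxs⟩ := hx'
  exact (hx.le_of_hits hxs hs.1.le).trans_lt hs.2

/-- A family of trajectories that reach the impact surface at a continuous time does so near every
point of the family. -/
theorem eventually_continuousAt (h𝓗 : 𝓗.IsSmooth) {V : Set M} (hV : IsOpen V)
    {q : M → M} {τ : M → ℝ}
    {y : M → S} {x₀ : M} (hx₀ : x₀ ∈ V) (hq : ∀ x ∈ V, ContinuousAt q x) (hτ : ContinuousAt τ x₀)
    (hg : ∀ x ∈ V, 𝓗.Glide (τ x) (q x) (y x)) : ∀ᶠ x in 𝓝 x₀, ContinuousAt τ x := by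
  obtain ⟨ε, hε, W, hW, Φ, hΦ, h, p, hp, hτe, -⟩ := exists_section_of_glide h𝓗 (hq x₀ hx₀) hτ
    (Filter.eventually_of_mem (hV.mem_nhds hx₀) hg)
  filter_upwards [hτe.eventually_nhds, (hq x₀ hx₀).eventually hp.smooth_time, hV.mem_nhds hx₀]
    with x hx hx' hxV
  have h1 : ContinuousAt (fun x => τ x₀ - h (q x)) x :=
    continuousAt_const.sub (ContinuousAt.comp (g := h) hx'.continuousAt (hq x hxV))
  exact h1.congr (hx.mono fun z hz => hz.symm)

/-- Either all trajectories of a family stay off the impact surface, or all trajectories of an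
open subfamily have an impact. -/
theorem exists_impact (h𝓗 : 𝓗.IsSmooth) {t : ℝ} {f : M → M} {W : Set M} {T : M → ℝ} {q : M → M}
    (hW : IsOpen W) (hT : ∀ x ∈ W, ContinuousAt T x) (hq : ∀ x ∈ W, ContinuousAt q x)
    (hqS : ∀ x ∈ W, q x ∉ S) (hf : ∀ x ∈ W, ∃ j, 𝓗.FlowCount j (t - T x) (q x) (f x))
    (hng : ∃ x ∈ W, ¬ 𝓗.Glide (t - T x) (q x) (f x)) :
    ∃ V ⊆ W, IsOpen V ∧ V.Nonempty ∧ ∃ (τ : M → ℝ) (y : M → S), ∀ x ∈ V,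
      𝓗.Glide (τ x) (q x) (y x) ∧ ∀ k, 𝓗.FlowCount k (t - T x) (q x) (f x) →
        ∃ j, k = j + 1 ∧ 𝓗.FlowCount j (t - (T x + τ x)) (𝓗.reset (y x)) (f x) := by
  obtain ⟨x₀, hx₀, hx₀g⟩ := hng
  obtain ⟨j, hj⟩ := hf x₀ hx₀
  rcases j with _ | j
  · exact absurd hj hx₀g
  obtain ⟨t₁, y₁, hg₁, ht₁, -⟩ := hj
  have := Nonempty.intro y₁
  obtain ⟨r, hr₁, hr₂⟩ := exists_between ht₁
  have h1 : ∀ᶠ x in 𝓝 x₀, ∃ s ∈ Ioo 0 r, 𝓗.Hits (q x) s := (hq x₀ hx₀).eventually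
    ((hg₁.hits y₁.2).eventually h𝓗 hg₁.1 ⟨hg₁.pos (hqS x₀ hx₀), hr₁⟩)
  have h2 : ∀ᶠ x in 𝓝 x₀, r < t - T x :=
    (continuousAt_const.sub (hT x₀ hx₀)).eventually (lt_mem_nhds hr₂)
  obtain ⟨V, hV, hVo, hxV⟩ := eventually_nhds_iff.1 ((h1.and h2).and (hW.mem_nhds hx₀))
  have key : ∀ x ∈ V, ∀ k, 𝓗.FlowCount k (t - T x) (q x) (f x) →
      ∃ j, k = j + 1 ∧ ∃ (t₁ : ℝ) (y : S),
      𝓗.Glide t₁ (q x) y ∧ 𝓗.FlowCount j (t - T x - t₁) (𝓗.reset y) (f x) := by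
    intro x hx k hk
    obtain ⟨⟨⟨s, hs, hxs⟩, hr⟩, -⟩ := hV x hx
    rcases k with _ | k
    -- Without an impact the trajectory would avoid `S` up to the time `t - T x`, but it hits `S` at
    -- the time `s < r < t - T x`.
    · exact absurd (Glide.le_of_hits hk hxs hs.1.le) (not_le.2 (hs.2.trans hr))
    · obtain ⟨t₁, y, h3, -, h4⟩ := hk
      exact ⟨k, rfl, t₁, y, h3, h4⟩
  have hex : ∀ x ∈ V, ∃ (t₁ : ℝ) (y : S), 𝓗.Glide t₁ (q x) y := fun x hx => by
    obtain ⟨k, hk⟩ := hf x (hV x hx).2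
    obtain ⟨-, -, t₁, y, h3, -⟩ := key x hx k hk
    exact ⟨t₁, y, h3⟩
  choose! τ y hg using hex
  refine ⟨V, fun x hx => (hV x hx).2, hVo, ⟨x₀, hxV⟩, τ, y, fun x hx => ⟨hg x hx, fun k hk => ?_⟩⟩
  obtain ⟨j, rfl, t₁, y', h3, h4⟩ := key x hx k hk
  obtain ⟨rfl, rfl⟩ := h3.unique (hg x hx)
  exact ⟨j, rfl, by rwa [← sub_sub]⟩

/-- Induction on the number `k` of impacts, which is prescribed only on a set `D` dense in `W`,
since it need not be locally constant. If all of `W` glides, `IsState.pullback_eq` concludes.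
Otherwise an open subfamily has an impact; beyond it the state is again an `IsState` and the count
on `D` drops by one. -/
theorem exists_pullback_eq (h𝓗 : 𝓗.IsSmooth) (hμ : IsSmoothForm (𝓡 (n + 1)) μ)
    (hL : ∀ x, lieDeriv (𝓡 (n + 1)) 𝓗.X μ x = 0) (hE : 𝓗.EnergyCondition μ) {t : ℝ} {f : M → M}
    (k : ℕ) : ∀ {W D : Set M} {T : M → ℝ} {q : M → M}, IsOpen W → W.Nonempty →
      (∀ x ∈ W, 𝓗.IsState μ T q x) → (∀ x ∈ W, ∃ j, 𝓗.FlowCount j (t - T x) (q x) (f x)) →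
      W ⊆ closure D → (∀ x ∈ D, x ∈ W → 𝓗.FlowCount k (t - T x) (q x) (f x)) →
      ∃ x ∈ W, pullback (𝓡 (n + 1)) (𝓡 (n + 1)) f μ x = μ x := by
  have := ChartedSpace.locallyCompactSpace (EuclideanSpace ℝ (Fin (n + 1))) M
  induction k with
  | zero =>
    intro W D T q hW hne hs hf hWD hD
    by_cases hg : ∀ x ∈ W, 𝓗.Glide (t - T x) (q x) (f x)
    · obtain ⟨x, hx⟩ := hne
      exact ⟨x, hx, (hs x hx).pullback_eq hμ hL (Filter.eventually_of_mem (hW.mem_nhds hx) hg)⟩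
    push Not at hg
    obtain ⟨V, hVW, hV, ⟨x, hx⟩, τ, y, hVg⟩ := exists_impact h𝓗 hW
      (fun x hx => (hs x hx).smooth_time.continuousAt)
      (fun x hx => (hs x hx).smooth_point.continuousAt) (fun x hx => (hs x hx).notMem) hf hg
    -- Every trajectory from `V` has an impact, while `D` contains points of `V` without one.
    obtain ⟨z, hzV, hzD⟩ := mem_closure_iff.1 (hWD (hVW hx)) V hV hx
    obtain ⟨j, hj, -⟩ := (hVg z hzV).2 0 (hD z hzD (hVW hzV))
    exact absurd hj.symm (Nat.succ_ne_zero j)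
  | succ k ih =>
    intro W D T q hW hne hs hf hWD hD
    by_cases hg : ∀ x ∈ W, 𝓗.Glide (t - T x) (q x) (f x)
    · obtain ⟨x, hx⟩ := hne
      exact ⟨x, hx, (hs x hx).pullback_eq hμ hL (Filter.eventually_of_mem (hW.mem_nhds hx) hg)⟩
    push Not at hg
    obtain ⟨V, hVW, hV, hVne, τ, y, hVg⟩ := exists_impact h𝓗 hW
      (fun x hx => (hs x hx).smooth_time.continuousAt)
      (fun x hx => (hs x hx).smooth_point.continuousAt) (fun x hx => (hs x hx).notMem) hf hg
    have hqc : ∀ x ∈ V, ContinuousAt q x := fun x hx => (hs x (hVW hx)).smooth_point.continuousAt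
    have hge : ∀ x ∈ V, ∀ᶠ z in 𝓝 x, 𝓗.Glide (τ z) (q z) (y z) := fun x hx =>
      Filter.eventually_of_mem (hV.mem_nhds hx) fun z hz => (hVg z hz).1
    -- The hitting time is upper semicontinuous, hence continuous at some point; there it is given
    -- by a smooth section, and so it is continuous on a neighbourhood.
    obtain ⟨x₁, hx₁, hτ₁⟩ := exists_continuousAt_of_eventually_lt hV hVne (τ := τ)
      fun x hx r hr => eventually_glide_lt h𝓗 (hqc x hx) (hs x (hVW hx)).notMem (hge x hx) hr
    have h1 := eventually_continuousAt h𝓗 hV hx₁ hqc hτ₁ fun x hx => (hVg x hx).1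
    obtain ⟨V', hV', hV'o, hxV'⟩ := eventually_nhds_iff.1 (h1.and (hV.mem_nhds hx₁))
    have hV'V : V' ⊆ V := fun x hx => (hV' x hx).2
    obtain ⟨x, hx, hfx⟩ := ih (W := V') (D := D) (T := fun x => T x + τ x)
      (q := fun x => 𝓗.reset (y x)) hV'o ⟨x₁, hxV'⟩
      (fun x hx => (hs x (hVW (hV'V hx))).impact h𝓗 hμ hL hE (hV' x hx).1 (hge x (hV'V hx)))
      (fun x hx => by
        obtain ⟨j, hj⟩ := hf x (hVW (hV'V hx))
        obtain ⟨i, -, hi⟩ := (hVg x (hV'V hx)).2 j hj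
        exact ⟨i, hi⟩)
      ((hV'V.trans hVW).trans hWD)
      (fun x hxD hx => by
        obtain ⟨i, hi, hi'⟩ := (hVg x (hV'V hx)).2 (k + 1) (hD x hxD (hVW (hV'V hx)))
        rwa [Nat.succ.inj hi])
    exact ⟨x, hVW (hV'V hx), hfx⟩

/-- Both forms are continuous on `U`, so each open subset only has to contain one point where they
agree. Baire's theorem finds an open piece in which a fixed number of impacts is attained densely.
-/
theorem isHybridInvariant (h𝓗 : 𝓗.IsSmooth) (hμ : IsSmoothForm (𝓡 (n + 1)) μ)
    (hL : ∀ x, lieDeriv (𝓡 (n + 1)) 𝓗.X μ x = 0) (hE : 𝓗.EnergyCondition μ) :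
    𝓗.IsHybridInvariant μ := by
  have := ChartedSpace.locallyCompactSpace (EuclideanSpace ℝ (Fin (n + 1))) M
  intro t U f hU hUS hf hfs x hx hfx
  refine eq_of_mem_closure (T := {z | pullback (𝓡 (n + 1)) (𝓡 (n + 1)) f μ z = μ z})
    (hμ.continuousAt_pullback (hfs.contMDiffAt (hU.mem_nhds hx))) (hμ.continuousAt x)
    (fun z hz => hz) ?_
  rw [mem_closure_iff]
  intro V hV hxV
  set O := V ∩ U with hO
  have hOo : IsOpen O := hV.inter hU
  have hxO : x ∈ O := ⟨hxV, hx⟩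
  set A : ℕ → Set M := fun k => {z ∈ O | 𝓗.FlowCount k t z (f z)} with hA
  -- The index `none` stands for the complement of `O`, so that the closed sets cover all of `M`.
  have hd : Dense (⋃ k : Option ℕ, interior (k.elim Oᶜ fun k => closure (A k))) := by
    refine dense_iUnion_interior_of_closed ?_ ?_
    · rintro (_ | k)
      · exact hOo.isClosed_compl
      · exact isClosed_closure
    · refine eq_univ_of_forall fun z => ?_
      by_cases hz : z ∈ O
      · obtain ⟨k, hk⟩ := (hf z hz.2).exists_flowCount
        exact mem_iUnion.2 ⟨some k, subset_closure ⟨hz, hk⟩⟩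
      · exact mem_iUnion.2 ⟨none, hz⟩
  obtain ⟨z, hzO, hz⟩ := hd.inter_open_nonempty O hOo ⟨x, hxO⟩
  obtain ⟨k, hk⟩ := mem_iUnion.1 hz
  rcases k with _ | k
  · exact absurd hzO (interior_subset hk)
  obtain ⟨w, hw, hw'⟩ := exists_pullback_eq h𝓗 hμ hL hE (t := t) (f := f) k
    (W := O ∩ interior (closure (A k))) (D := A k) (T := fun _ => 0) (q := id)
    (hOo.inter isOpen_interior) ⟨z, hzO, hk⟩
    (fun w hw => isState_id (disjoint_left.1 hUS hw.1.2))
    (fun w hw => by simpa only [sub_zero, id_eq] using (hf w hw.1.2).exists_flowCount)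
    (inter_subset_right.trans interior_subset)
    (fun w hw _ => by simpa only [sub_zero, id_eq] using hw.2)
  exact ⟨w, hw.1.1, hw'⟩

end HybridSystem

/-! ### Invariance implies the two conditions. -/

namespace HybridSystem

variable {n : ℕ} {M : Type*} [TopologicalSpace M] [ChartedSpace (EuclideanSpace ℝ (Fin (n + 1))) M]
  [IsManifold (𝓡 (n + 1)) ∞ M]
  {S : Set M} [ChartedSpace (EuclideanSpace ℝ (Fin n)) S]
  {𝓗 : HybridSystem n M S} {μ : Form (𝓡 (n + 1)) M (n + 1)} [T2Space M]

/-- Near a point of the impact surface, the time coordinate of a section is the flow time. -/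
theorem eventually_section_time {Φ : ℝ × M → M} {ε : ℝ} {W : Set M} {y : S}
    (hΦ : IsFlowOn 𝓗.X Φ (-ε) ε W) (hy : (y : M) ∈ W) {h : M → ℝ} {p : M → S}
    (hs : IsSectionAt (EuclideanSpace ℝ (Fin (n + 1))) (EuclideanSpace ℝ (Fin n)) Φ 0 (y : M) h p) :
    ∀ᶠ s in 𝓝 (0 : ℝ), h (Φ (s, y)) = s := by
  have hc : ContinuousAt (fun s => Φ (s, (y : M))) 0 :=
    (hΦ.hasMFDerivAt_left hΦ.zero_mem hy).continuousAt
  have hc' : ContinuousAt (fun s => (-s, Φ (s, (y : M)))) 0 := continuousAt_neg.prodMk hc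
  have h1 := hc'.eventually (by simpa only [neg_zero, hΦ.zero _ hy] using hs.unique)
  have h2 := hc.eventually (hΦ.isOpen.mem_nhds (by simpa only [hΦ.zero _ hy] using hy))
  filter_upwards [h1, h2, isOpen_Ioo.mem_nhds hΦ.zero_mem] with s hs1 hs2 hs3
  have h4 : Φ (-s, Φ (s, y)) = y := by
    rw [hΦ.add 𝓗.smooth_X hΦ hs3 hy hs2 ⟨by linarith [hs3.2], by linarith [hs3.1]⟩
      (by rw [neg_add_cancel]; exact hΦ.zero_mem), neg_add_cancel, hΦ.zero _ hy]
  have h5 := hs1 (by rw [h4]; exact y.2)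
  linarith

/-- After an impact, the impact surface is not met for some time. -/
theorem exists_not_hits (h𝓗 : 𝓗.IsSmooth) (y : S) :
    ∃ ε > 0, ∀ s ∈ Ioo 0 ε, ¬ 𝓗.Hits (𝓗.reset y) s := by
  set x := 𝓗.reset y
  obtain ⟨ε, hε, W, hW, Φ, hΦ⟩ := exists_isFlowOn 𝓗.smooth_X x
  by_cases hx : x ∈ closure S
  · have h0 : 𝓗.Flow 0 x x := Glide.flow ⟨le_rfl, fun r => Φ (r, x), (hΦ.curve x hW).mono
      (Icc_subset_Ioo (by linarith) hε), hΦ.zero x hW, fun s hs => absurd hs.2 (not_lt.2 hs.1),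
      hΦ.zero x hW⟩
    obtain ⟨η, hη, h⟩ := h𝓗.off_frontier 0 x x h0 ⟨hx, reset_notMem y⟩
    -- By (A.1) the hybrid trajectory is off `S` at time `s`. If the integral curve is on `S` then,
    -- the two have already separated, so an impact occurred earlier. Used twice, this gives a hit
    -- before the first one.
    have key : ∀ s ∈ Ioo 0 η, 𝓗.Hits x s → ∃ t₁ < s, ∃ y₁ : S, 𝓗.Glide t₁ x y₁ := by
      intro s hs hits
      obtain ⟨q, hq, hqS⟩ := h s hs.1 hs.2
      rw [zero_add] at hq
      obtain ⟨k, hk⟩ := hq.exists_flowCount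
      rcases k with _ | k
      · obtain ⟨γ, hγ, hγ0, hγS⟩ := hits
        exact absurd (Glide.eq_of_curve hk hγ hγ0 le_rfl ▸ hγS) hqS
      · obtain ⟨t₁, y₁, hg, hlt, -⟩ := hk
        exact ⟨t₁, hlt, y₁, hg⟩
    refine ⟨η, hη, fun s hs hits => ?_⟩
    obtain ⟨t₁, ht₁, y₁, hg₁⟩ := key s hs hits
    have hpos := hg₁.pos (reset_notMem y)
    obtain ⟨t₂, ht₂, y₂, hg₂⟩ := key t₁ ⟨hpos, ht₁.trans hs.2⟩ (hg₁.hits y₁.2)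
    exact absurd (hg₁.le_of_hits (hg₂.hits y₂.2) hg₂.1) (not_le.2 ht₂)
  · have hc : ContinuousAt (fun s => Φ (s, x)) 0 :=
      (hΦ.hasMFDerivAt_left hΦ.zero_mem hW).continuousAt
    have h1 : ∀ᶠ s in 𝓝 (0 : ℝ), Φ (s, x) ∈ (closure S)ᶜ :=
      hc.eventually (isClosed_closure.isOpen_compl.mem_nhds (by
        simpa only [hΦ.zero _ hW, mem_compl_iff] using hx))
    obtain ⟨η, hη, h⟩ := Metric.eventually_nhds_iff.1 h1
    refine ⟨min η ε, lt_min hη hε, fun s hs hits => ?_⟩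
    obtain ⟨γ, hγ, hγ0, hγS⟩ := hits
    have hse : s < ε := hs.2.trans_le (min_le_right _ _)
    have h2 := eqOn_Icc_of_isMIntegralCurveOn 𝓗.smooth_X hγ ((hΦ.curve x hW).mono
      (Icc_subset_Ioo (by linarith) hse)) (hγ0.trans (hΦ.zero x hW).symm) ⟨hs.1.le, le_rfl⟩
    refine h (y := s) ?_ (subset_closure ((show γ s = Φ (s, x) from h2) ▸ hγS))
    rw [Real.dist_eq, sub_zero, abs_of_pos hs.1]
    exact hs.2.trans_le (min_le_left _ _)

variable [IsManifold (𝓡 n) ∞ S]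

/-- Near a point `z` of `S`, the surface lies in the zero set of the section time `h`, whereas `h`
equals `s` at the point `Φ (s, z)`. So some points arbitrarily near `z` have neighbourhoods disjoint
from `S`. -/
theorem dense_compl_closure (h𝓗 : 𝓗.IsSmooth) : Dense (closure S)ᶜ := by
  rw [dense_iff_inter_open]
  rintro O hO ⟨x, hx⟩
  by_contra hne
  have hOS : ∀ z ∈ O, z ∈ closure S := fun z hz => by
    by_contra h
    exact hne ⟨z, hz, h⟩
  obtain ⟨z, hzO, hzS⟩ := mem_closure_iff.1 (hOS x hx) O hO hx
  set y : S := ⟨z, hzS⟩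
  obtain ⟨ε, hε, W, hW, Φ, hΦ⟩ := exists_isFlowOn 𝓗.smooth_X z
  obtain ⟨h, p, hp⟩ := exists_isSectionAt (E' := EuclideanSpace ℝ (Fin n)) 𝓗.smooth_X
    𝓗.isSmoothEmbedding.contMDiff h𝓗.isTransverse hΦ hΦ.zero_mem hW (by rwa [hΦ.zero _ hW])
  have hc : ContinuousAt (fun s => Φ (s, z)) 0 :=
    (hΦ.hasMFDerivAt_left hΦ.zero_mem hW).continuousAt
  have h1 := eventually_section_time (y := y) hΦ hW hp
  have hc2 : ContinuousAt (fun w : M => ((0 : ℝ), w)) z := by fun_prop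
  have h2 : ∀ᶠ w in 𝓝 z, w ∈ S → h w = 0 := by
    filter_upwards [hc2.eventually hp.unique, hΦ.isOpen.mem_nhds hW] with w hw hwW hwS
    have := hw (by rwa [hΦ.zero _ hwW])
    linarith
  have h3 := hc.eventually (by simpa only [hΦ.zero _ hW] using
    (h2.eventually_nhds.and hp.smooth_time).and (hO.mem_nhds hzO))
  have h4 : ∀ᶠ s in 𝓝[>] (0 : ℝ), 0 < s ∧ h (Φ (s, z)) = s ∧
      ((∀ᶠ w in 𝓝 (Φ (s, z)), w ∈ S → h w = 0) ∧
        ContMDiffAt (𝓡 (n + 1)) 𝓘(ℝ, ℝ) ∞ h (Φ (s, z))) ∧ Φ (s, z) ∈ O :=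
    Filter.Eventually.and self_mem_nhdsWithin (nhdsWithin_le_nhds (h1.and h3))
  obtain ⟨s, hs0, hs1, ⟨hs2, hs3⟩, hs4⟩ := h4.exists
  have h5 : ∀ᶠ w in 𝓝 (Φ (s, z)), h w ≠ 0 :=
    hs3.continuousAt.eventually_ne (by rw [hs1]; exact hs0.ne')
  obtain ⟨w, hw, hw', hwS⟩ := ((mem_closure_iff_frequently.1 (hOS _ hs4)).and_eventually
    (h5.and hs2)).exists
  exact hw' (hwS hw)

/-- Off the closure of `S`, the hybrid flow for small times is the flow of `X`, so invariance can be
differentiated at time `0`. Density and continuity give the remaining points. -/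
theorem lieDeriv_eq_zero (h𝓗 : 𝓗.IsSmooth) (hμ : IsSmoothForm (𝓡 (n + 1)) μ)
    (hinv : 𝓗.IsHybridInvariant μ) (p : M) : lieDeriv (𝓡 (n + 1)) 𝓗.X μ p = 0 := by
  refine lieDeriv_eq_zero_of_mem_closure 𝓗.smooth_X hμ (T := (closure S)ᶜ) (fun x hx hxp => ?_)
    (dense_compl_closure h𝓗 p)
  obtain ⟨ε, hε, W, hW, Φ, hΦ⟩ := exists_isFlowOn 𝓗.smooth_X x
  refine hΦ.lieDerivCoord_eq_zero 𝓗.smooth_X hμ hW ?_ hxp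
  have hc : ContinuousAt Φ (0, x) := (hΦ.contMDiffAt hΦ.zero_mem hW).continuousAt
  have h1 : ∀ᶠ q in 𝓝 ((0 : ℝ), x), Φ q ∈ (closure S)ᶜ :=
    hc.eventually (isClosed_closure.isOpen_compl.mem_nhds (by rwa [hΦ.zero _ hW]))
  rw [nhds_prod_eq, Filter.eventually_prod_iff] at h1
  obtain ⟨P, hP, Q, hQ, hPQ⟩ := h1
  obtain ⟨η, hη, hPη⟩ := Metric.eventually_nhds_iff.1 hP
  obtain ⟨U, hU, hUo, hxU⟩ := eventually_nhds_iff.1 (hQ.and (hΦ.isOpen.mem_nhds hW))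
  have hS : ∀ s, 0 ≤ s → s < η → ∀ z ∈ U, Φ (s, z) ∉ S := fun s hs0 hs z hz h =>
    hPQ (hPη (by rwa [Real.dist_eq, sub_zero, abs_of_nonneg hs0])) (hU z hz).1 (subset_closure h)
  have hsm : ∀ᶠ s in 𝓝[>] (0 : ℝ), s ∈ Ioo 0 (min ε η) := Ioo_mem_nhdsGT (lt_min hε hη)
  filter_upwards [hsm] with s hs
  have hsε : s < ε := hs.2.trans_le (min_le_left _ _)
  have hsη : s < η := hs.2.trans_le (min_le_right _ _)
  refine hinv s U (fun z => Φ (s, z)) hUo ?_ ?_ ?_ x hxU (hS s hs.1.le hsη x hxU)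
  · refine disjoint_left.2 fun z hz hzS => hS 0 le_rfl hη z hz ?_
    rwa [hΦ.zero _ (hU z hz).2]
  · intro z hz
    exact Glide.flow ⟨hs.1.le, fun r => Φ (r, z), (hΦ.curve z (hU z hz).2).mono
      (Icc_subset_Ioo (by linarith) hsε), hΦ.zero z (hU z hz).2,
      fun r hr => hS r hr.1 (hr.2.trans hsη) z hz, rfl⟩
  · exact fun z hz => (hΦ.contMDiffAt_right ⟨by linarith [hs.1], hsε⟩
      (hU z hz).2).contMDiffWithinAt

/-- At a generic point of the impact surface, the trajectories after the impact do not meet the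
impact surface for a time that is locally bounded below. -/
theorem dense_setOf_eventually_not_hits (h𝓗 : 𝓗.IsSmooth) :
    Dense {y : S | ∃ ε > 0, ∀ᶠ y' in 𝓝 y, ∀ s ∈ Ioo 0 ε, ¬ 𝓗.Hits (𝓗.reset y') s} := by
  have := ChartedSpace.locallyCompactSpace (EuclideanSpace ℝ (Fin n)) S
  set A : ℕ → Set S := fun m => {y | ∀ s ∈ Ioo 0 (1 / (m + 1 : ℝ)), ¬ 𝓗.Hits (𝓗.reset y) s} with hA
  -- Closedness is persistence of hits: a hit within the time interval survives small changes of
  -- `y`.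
  have hAc : ∀ m, IsClosed (A m) := by
    intro m
    rw [← isOpen_compl_iff, isOpen_iff_mem_nhds]
    intro y hy
    simp only [hA, mem_compl_iff, mem_ofPred_eq, not_forall, not_not] at hy
    obtain ⟨s, hs, hys⟩ := hy
    filter_upwards [𝓗.smooth_reset.continuous.continuousAt.eventually
      (hys.eventually h𝓗 hs.1.le hs)] with y' hy' hA'
    obtain ⟨s', hs', hy'⟩ := hy'
    exact hA' s' hs' hy'
  have hd : Dense (⋃ m, interior (A m)) := by
    refine dense_iUnion_interior_of_closed hAc (eq_univ_of_forall fun y => ?_)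
    obtain ⟨ε, hε, h⟩ := exists_not_hits h𝓗 y
    obtain ⟨m, hm⟩ := exists_nat_one_div_lt hε
    exact mem_iUnion.2 ⟨m, fun s hs => h s ⟨hs.1, hs.2.trans hm⟩⟩
  refine hd.mono (iUnion_subset fun (m : ℕ) y hy => ⟨1 / (m + 1 : ℝ), by positivity, ?_⟩)
  exact mem_interior_iff_mem_nhds.1 hy

/-- The time-`t` map of points just before `S` is `f z = Ψ (t + h z, Δ (p z))`, a formula that is
smooth across `S`. Its invariance extends to `y` by continuity. As `Ψ` preserves `μ` and `X`, what
remains is `μ (Δ' dp u + dh(u) X) = μ u`, which is the energy condition. -/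
theorem energy_of_eventually_not_hits (h𝓗 : 𝓗.IsSmooth) (hμ : IsSmoothForm (𝓡 (n + 1)) μ)
    (hinv : 𝓗.IsHybridInvariant μ) {y : S} {ε : ℝ} (hε : 0 < ε)
    (hy : ∀ᶠ y' in 𝓝 y, ∀ s ∈ Ioo 0 ε, ¬ 𝓗.Hits (𝓗.reset y') s) :
    𝓗.resetForm (interiorProduct (𝓡 (n + 1)) 𝓗.X μ) y =
      restrictForm (interiorProduct (𝓡 (n + 1)) 𝓗.X μ) y := by
  obtain ⟨a, ha, W, hW, Φ, hΦ⟩ := exists_isFlowOn 𝓗.smooth_X (y : M)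
  obtain ⟨b, hb, W', hW', Ψ, hΨ⟩ := exists_isFlowOn 𝓗.smooth_X (𝓗.reset y)
  obtain ⟨h, p, hp⟩ := exists_isSectionAt (E' := EuclideanSpace ℝ (Fin n)) 𝓗.smooth_X
    𝓗.isSmoothEmbedding.contMDiff h𝓗.isTransverse hΦ hΦ.zero_mem hW
    (by rw [hΦ.zero _ hW]; exact y.2)
  have hpy : p y = y := Subtype.ext (hp.apply_eq.symm.trans (hΦ.zero _ hW))
  have hm : 0 < min b ε := lt_min hb hε
  -- After the impact, the flow `Ψ` must exist up to a time near `t` and no second impact may occur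
  -- by then.
  set t := min b ε / 2 with ht
  have ht0 : 0 < t := half_pos hm
  have htm : t < min b ε := half_lt_self hm
  have hhs := hp.smooth_time.self_of_nhds
  have hps := hp.smooth_point.self_of_nhds
  have huniq := hp.unique
  rw [nhds_prod_eq, Filter.eventually_prod_iff] at huniq
  obtain ⟨P, hP, Q, hQ, hPQ⟩ := huniq
  obtain ⟨η, hη, hPη⟩ := Metric.eventually_nhds_iff.1 hP
  have hev1 : ∀ᶠ z in 𝓝 (y : M), z ∈ W ∧ Q z ∧ Φ (0 - h z, z) = p z :=
    Filter.Eventually.and (hΦ.isOpen.mem_nhds hW) (hQ.and hp.hit)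
  have hev2 : ∀ᶠ z in 𝓝 (y : M), |h z| < min a η ∧ t + h z ∈ Ioo 0 (min b ε) := by
    have h1 : ContinuousAt (fun z => |h z|) (y : M) := hhs.continuousAt.abs
    have h2 : ContinuousAt (fun z => t + h z) (y : M) := continuousAt_const.add hhs.continuousAt
    refine (h1.eventually (gt_mem_nhds ?_)).and (h2.eventually (isOpen_Ioo.mem_nhds ?_))
    · simp only [hp.zero, abs_zero]
      exact lt_min ha hη
    · simp only [hp.zero, add_zero]
      exact ⟨ht0, htm⟩
  have hev3 : ∀ᶠ z in 𝓝 (y : M),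
      𝓗.reset (p z) ∈ W' ∧ ∀ s ∈ Ioo 0 ε, ¬ 𝓗.Hits (𝓗.reset (p z)) s := by
    refine Filter.Eventually.and ?_ (hps.continuousAt.eventually (by rwa [hpy]))
    exact (𝓗.smooth_reset.continuous.continuousAt.comp hps.continuousAt).eventually
      (hΨ.isOpen.mem_nhds (by simpa only [Function.comp_apply, hpy] using hW'))
  obtain ⟨V, hV, hVo, hyV⟩ := eventually_nhds_iff.1
    ((hev1.and hev2).and (hev3.and (hp.smooth_time.and hp.smooth_point)))
  set f : M → M := fun z => Ψ (t + h z, 𝓗.reset (p z)) with hf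
  have hgs : ∀ z ∈ V, ContMDiffAt (𝓡 (n + 1)) 𝓘(ℝ, ℝ) ∞ (fun z => t + h z) z := fun z hz =>
    contMDiffAt_const.add (hV z hz).2.2.1
  have hqs : ∀ z ∈ V, ContMDiffAt (𝓡 (n + 1)) (𝓡 (n + 1)) ∞ (fun z => 𝓗.reset (p z)) z :=
    fun z hz => ContMDiffAt.comp (g := 𝓗.reset) z 𝓗.smooth_reset.contMDiffAt (hV z hz).2.2.2
  have htb : ∀ z ∈ V, t + h z ∈ Ioo (-b) b := fun z hz =>
    ⟨by linarith [(hV z hz).1.2.2.1], (hV z hz).1.2.2.2.trans_le (min_le_left _ _)⟩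
  have hfs : ∀ z ∈ V, ContMDiffAt (𝓡 (n + 1)) (𝓡 (n + 1)) ∞ f z := fun z hz =>
    ContMDiffAt.comp (g := Ψ) z (hΨ.contMDiffAt (htb z hz) (hV z hz).2.1.1)
      ((hgs z hz).prodMk (hqs z hz))
  -- The hit occurs at the flow time `-h z`, so these are the points that have not yet reached the
  -- surface.
  set U : Set M := {z ∈ V | h z < 0} with hU
  have hUo : IsOpen U := isOpen_iff_mem_nhds.2 fun z hz => Filter.inter_mem (hVo.mem_nhds hz.1)
    ((hV z hz.1).2.2.1.continuousAt.eventually (gt_mem_nhds hz.2))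
  have hΦS : ∀ z ∈ V, ∀ s, |s| < η → Φ (s, z) ∈ S → s = -h z := fun z hz s hs hsS => by
    have := hPQ (hPη (by rwa [Real.dist_eq, sub_zero])) (hV z hz).1.1.2.1 hsS
    rwa [zero_sub] at this
  have hΨS : ∀ z ∈ V, ∀ s, 0 ≤ s → s ≤ t + h z → Ψ (s, 𝓗.reset (p z)) ∉ S := by
    intro z hz s hs0 hs hsS
    have hz2 := (hV z hz).2.1
    rcases hs0.eq_or_lt with rfl | hs0
    · rw [hΨ.zero _ hz2.1] at hsS
      exact reset_notMem _ hsS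
    · exact hz2.2 s ⟨hs0, hs.trans_lt ((hV z hz).1.2.2.2.trans_le (min_le_right _ _))⟩
        (hΨ.hits ⟨by linarith, hs.trans_lt (htb z hz).2⟩ hz2.1 hsS)
  have hpull : ∀ z ∈ U, pullback (𝓡 (n + 1)) (𝓡 (n + 1)) f μ z = μ z := by
    intro z hz
    refine hinv t U f hUo ?_ ?_ (fun w hw => (hfs w hw.1).contMDiffWithinAt) z hz
      (hΨS z hz.1 _ (hV z hz.1).1.2.2.1.le le_rfl)
    · refine disjoint_left.2 fun w hw hwS => ?_
      have := hΦS w hw.1 0 (by rwa [abs_zero]) (by rwa [hΦ.zero _ (hV w hw.1).1.1.1])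
      linarith [hw.2]
    · intro w hw
      have hw1 := (hV w hw.1).1
      have hlt := hw1.2.1
      rw [abs_of_neg hw.2] at hlt
      have hg1 : 𝓗.Glide (-h w) w (p w) := by
        refine ⟨by linarith [hw.2], fun s => Φ (s, w), (hΦ.curve w hw1.1.1).mono
          (Icc_subset_Ioo (by linarith) (hlt.trans_le (min_le_left _ _))), hΦ.zero _ hw1.1.1,
          fun s hs hsS => ?_, by simpa only [zero_sub] using hw1.1.2.2⟩
        have := hΦS w hw.1 s (by
          rw [abs_of_nonneg hs.1]
          exact hs.2.trans (hlt.trans_le (min_le_right _ _))) hsS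
        linarith [hs.2]
      have hg2 : 𝓗.Glide (t + h w) (𝓗.reset (p w)) (f w) :=
        ⟨hw1.2.2.1.le, fun s => Ψ (s, 𝓗.reset (p w)), (hΨ.curve _ (hV w hw.1).2.1.1).mono
          (Icc_subset_Ioo (by linarith) (htb w hw.1).2), hΨ.zero _ (hV w hw.1).2.1.1,
          fun s hs => hΨS w hw.1 s hs.1 hs.2.le, rfl⟩
      have := hg1.flow_impact hw1.2.2.1 hg2.flow
      rwa [show -h w + (t + h w) = t by ring] at this
  -- The points `Φ (s, y)` with `s < 0` lie in `U` and tend to `y`.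
  have hycl : (y : M) ∈ closure U := by
    rw [mem_closure_iff_frequently]
    have hc : ContinuousAt (fun s => Φ (s, (y : M))) 0 :=
      (hΦ.hasMFDerivAt_left hΦ.zero_mem hW).continuousAt
    have hc' : Filter.Tendsto (fun s => Φ (s, (y : M))) (𝓝[<] 0) (𝓝 (y : M)) := by
      have h1 := hc.tendsto
      simp only [hΦ.zero _ hW] at h1
      exact h1.mono_left nhdsWithin_le_nhds
    refine hc'.frequently (Filter.Eventually.frequently ?_)
    filter_upwards [hc'.eventually (hVo.mem_nhds hyV), self_mem_nhdsWithin,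
      nhdsWithin_le_nhds (eventually_section_time hΦ hW hp)] with s hs1 hs2 hs3
    exact ⟨hs1, by rw [hs3]; exact hs2⟩
  have hfy : pullback (𝓡 (n + 1)) (𝓡 (n + 1)) f μ y = μ y :=
    eq_of_mem_closure (hμ.continuousAt_pullback (hfs y hyV)) (hμ.continuousAt _) hpull hycl
  have hL := lieDeriv_eq_zero h𝓗 hμ hinv
  have hΨp := hΨ.pullback_eq 𝓗.smooth_X hμ hL (htb y hyV) (hV y hyV).2.1.1
  have hΨX := hΨ.mfderiv_field 𝓗.smooth_X (htb y hyV) (hV y hyV).2.1.1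
  have hhd := hhs.mdifferentiableAt (by simp : (∞ : WithTop ℕ∞) ≠ 0)
  have hpd := hps.mdifferentiableAt (by simp : (∞ : WithTop ℕ∞) ≠ 0)
  have hdg : differential (F := EuclideanSpace ℝ (Fin (n + 1))) (fun z => t + h z) (y : M) =
      differential (F := EuclideanSpace ℝ (Fin (n + 1))) h (y : M) := by
    have h1 : HasMFDerivAt (𝓡 (n + 1)) 𝓘(ℝ, ℝ) (fun z => t + h z) (y : M)
        (differential (F := EuclideanSpace ℝ (Fin (n + 1))) h (y : M)) := by
      have h1 : HasMFDerivAt 𝓘(ℝ, ℝ) 𝓘(ℝ, ℝ) (fun r : ℝ => t + r) (h y)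
          (ContinuousLinearMap.id ℝ ℝ) := ((hasFDerivAt_id (h y)).const_add t).hasMFDerivAt
      exact HasMFDerivAt.comp (y : M) h1 hhd.hasMFDerivAt
    exact h1.mfderiv
  have hdq : mfderiv (𝓡 (n + 1)) (𝓡 (n + 1)) (fun z => 𝓗.reset (p z)) (y : M) =
      mfderiv (𝓡 n) (𝓡 (n + 1)) 𝓗.reset (p y) ∘L mfderiv (𝓡 (n + 1)) (𝓡 n) p (y : M) :=
    mfderiv_comp (g := 𝓗.reset) (y : M) (𝓗.smooth_reset.mdifferentiableAt (by simp)) hpd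
  have hkey : ∀ w : Fin (n + 1) → TangentSpace (𝓡 (n + 1)) (y : M),
      μ (𝓗.reset (p y)) (fun i => mfderiv (𝓡 n) (𝓡 (n + 1)) 𝓗.reset (p y)
        (mfderiv (𝓡 (n + 1)) (𝓡 n) p (y : M) (w i)) +
        differential (F := EuclideanSpace ℝ (Fin (n + 1))) h (y : M) (w i) •
          𝓗.X (𝓗.reset (p y))) = μ y w := by
    intro w
    rw [← hΨp, ← hfy]
    refine congrArg (μ (Ψ (t + h y, 𝓗.reset (p y)))) (funext fun i => ?_)
    have h1 := hΨ.mfderiv_comp ((hgs y hyV).mdifferentiableAt (by simp))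
      ((hqs y hyV).mdifferentiableAt (by simp)) (htb y hyV) (hV y hyV).2.1.1 (w i)
    rw [hdg, hdq] at h1
    refine Eq.trans ?_ h1.symm
    rw [map_add, map_smul]
    have h2 : ∀ (A B B' : EuclideanSpace ℝ (Fin (n + 1))) (c : ℝ), B = B' →
        A + c • B = c • B' + A := fun A B B' c hB => hB ▸ add_comm _ _
    exact h2 _ _ _ _ hΨX
  rw [← hpy, energy_iff]
  intro v
  set T : EuclideanSpace ℝ (Fin n) × ℝ → EuclideanSpace ℝ (Fin (n + 1)) := fun q =>
    (mfderiv (𝓡 n) (𝓡 (n + 1)) (Subtype.val : S → M) (p y) q.1 + q.2 • 𝓗.X (p y) :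
      TangentSpace (𝓡 (n + 1)) (p y : M)) with hT
  have hid : (fun z => Φ (0, z)) =ᶠ[𝓝 (y : M)] id :=
    Filter.eventually_of_mem (hΦ.isOpen.mem_nhds hW) fun z hz => hΦ.zero z hz
  have hdec : ∀ u : EuclideanSpace ℝ (Fin (n + 1)),
      T (mfderiv (𝓡 (n + 1)) (𝓡 n) p (y : M) u,
        differential (F := EuclideanSpace ℝ (Fin (n + 1))) h (y : M) u) = u := fun u => by
    have h1 := hp.mfderiv_eq 𝓗.isSmoothEmbedding.contMDiff hΦ hΦ.zero_mem hW u
    rw [hid.mfderiv_eq, mfderiv_id] at h1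
    exact h1.symm
  -- A right inverse of the injective map `T` is also a left inverse, so every pair `(w, r)` arises
  -- from a tangent vector of `M`.
  have hproj : ∀ q, (mfderiv (𝓡 (n + 1)) (𝓡 n) p (y : M) (T q),
      differential (F := EuclideanSpace ℝ (Fin (n + 1))) h (y : M) (T q)) = q := fun q =>
    (h𝓗.isTransverse (p y)).1 (hdec (T q))
  have h1 := hkey fun i => T (v i)
  have h2 : ∀ z : S, z = y → ∀ w : Fin (n + 1) → EuclideanSpace ℝ (Fin (n + 1)),
      μ y w = μ z w := by
    rintro z rfl w
    rfl
  refine Eq.trans (congrArg (μ (𝓗.reset (p y))) (funext fun i => ?_))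
    (h1.trans (h2 _ hpy fun i => T (v i)))
  exact congrArg (fun q : EuclideanSpace ℝ (Fin n) × ℝ =>
    mfderiv (𝓡 n) (𝓡 (n + 1)) 𝓗.reset (p y) q.1 + q.2 • 𝓗.X (𝓗.reset (p y))) (hproj (v i)).symm

end HybridSystem

/-- More vectors than the dimension of `N` are linearly dependent. -/
theorem pullback_eq_zero_of_finrank_lt {E : Type*} [NormedAddCommGroup E] [NormedSpace ℝ E]
    {H : Type*} [TopologicalSpace H] {I : ModelWithCorners ℝ E H}
    {M : Type*} [TopologicalSpace M] [ChartedSpace H M]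
    {E' : Type*} [NormedAddCommGroup E'] [NormedSpace ℝ E'] [FiniteDimensional ℝ E']
    {H' : Type*} [TopologicalSpace H'] {J : ModelWithCorners ℝ E' H'}
    {N : Type*} [TopologicalSpace N] [ChartedSpace H' N] {k : ℕ}
    (hk : Module.finrank ℝ E' < k) (f : N → M) (α : Form I M k) : pullback I J f α = 0 := by
  funext x
  ext v
  refine AlternatingMap.map_linearDependent (K := ℝ) (M := E') (N := ℝ)
    (pullback I J f α x).toAlternatingMap v fun h => ?_
  have h' : LinearIndependent ℝ (show Fin k → E' from v) := h
  have := h'.fintype_card_le_finrank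
  rw [Fintype.card_fin] at this
  omega

theorem divergence_eq_zero_iff {d : ℕ} {M : Type*} [TopologicalSpace M]
    [ChartedSpace (EuclideanSpace ℝ (Fin d)) M] {μ : Form (𝓡 d) M d}
    {X : (x : M) → TangentSpace (𝓡 d) x} {x : M} (hμ : μ x ≠ 0) :
    divergence μ X x = 0 ↔ lieDeriv (𝓡 d) X μ x = 0 := by
  refine ⟨fun h => ?_, fun h => ?_⟩
  · rw [lieDeriv_eq_divergence_smul μ X x hμ, h, zero_smul]
  · rw [divergence, h]
    exact zero_div _

namespace HybridSystem

variable {n : ℕ} {M : Type*} [TopologicalSpace M] [T2Space M]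
  [ChartedSpace (EuclideanSpace ℝ (Fin (n + 1))) M] [IsManifold (𝓡 (n + 1)) ∞ M]
  {S : Set M} [ChartedSpace (EuclideanSpace ℝ (Fin n)) S] [IsManifold (𝓡 n) ∞ S]
  {𝓗 : HybridSystem n M S} {μ : Form (𝓡 (n + 1)) M (n + 1)}

/-- Both sides are continuous forms on `S`, so the dense set of points with locally uniform
impact-free time suffices. -/
theorem energyCondition_of_isHybridInvariant (h𝓗 : 𝓗.IsSmooth)
    (hμ : IsSmoothForm (𝓡 (n + 1)) μ) (hinv : 𝓗.IsHybridInvariant μ) : 𝓗.EnergyCondition μ := by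
  funext y
  have hi := hμ.interiorProduct 𝓗.smooth_X
  exact eq_of_mem_closure (hi.continuousAt_pullback 𝓗.smooth_reset.contMDiffAt)
    (hi.continuousAt_pullback 𝓗.isSmoothEmbedding.contMDiff.contMDiffAt)
    (fun _ hz => hz.elim fun _ hε => energy_of_eventually_not_hits h𝓗 hμ hinv hε.1 hε.2)
    (dense_setOf_eventually_not_hits h𝓗 y)

end HybridSystem

end Hybrid

theorem mainTheorem12 {n : ℕ} {M : Type*} [TopologicalSpace M] [T2Space M]
    [SecondCountableTopology M] [ChartedSpace (EuclideanSpace ℝ (Fin (n + 1))) M]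
    [IsManifold (𝓡 (n + 1)) ∞ M]
    {S : Set M} [ChartedSpace (EuclideanSpace ℝ (Fin n)) S] [IsManifold (𝓡 n) ∞ S]
    (𝓗 : Hybrid.HybridSystem n M S) (h𝓗 : 𝓗.IsSmooth)
    (μ : Hybrid.Form (𝓡 (n + 1)) M (n + 1)) (hμ : Hybrid.IsVolumeForm μ) :
    (𝓗.IsHybridInvariant μ ↔
      (∀ x, Hybrid.divergence μ 𝓗.X x = 0) ∧ 𝓗.EnergyCondition μ) ∧
    𝓗.SpecularCondition μ := by
  refine ⟨⟨fun h => ⟨fun x => ?_, 𝓗.energyCondition_of_isHybridInvariant h𝓗 hμ.1 h⟩,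
    fun h => Hybrid.HybridSystem.isHybridInvariant h𝓗 hμ.1
      (fun x => (Hybrid.divergence_eq_zero_iff (hμ.2 x)).1 (h.1 x)) h.2⟩, ?_⟩
  · exact (Hybrid.divergence_eq_zero_iff (hμ.2 x)).2
      (Hybrid.HybridSystem.lieDeriv_eq_zero h𝓗 hμ.1 h x)
  · have hn : Module.finrank ℝ (EuclideanSpace ℝ (Fin n)) < n + 1 := by simp
    exact (Hybrid.pullback_eq_zero_of_finrank_lt hn _ μ).trans
      (Hybrid.pullback_eq_zero_of_finrank_lt hn _ μ).symm
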